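/- **Setting.** Let $d\in\{2,3\}$ and let $\Omega\subset\mathbb{R}^d$ be a bounded domain with Lipschitz boundary, $\Gamma_D\cap\Gamma_N=\emptyset$, $\overline{\Gamma_D}\cup\overline{\Gamma_N}=\partial\Omega$. Let $A=(a_{ij})\in L^\infty(\Omega)^{d\times d}$ be symmetric with $\alpha|\xi|^2\le A(x)\xi\cdot\xi\le\beta|\xi|^2$ for all $\xi\in\mathbb{R}^d$ and a.e. $x\in\Omega$, where $0<\alpha<\beta<\infty$. Let $f\in L^2(\Omega)$, $g\in H^{-1/2}(\Gamma_N)$, $q\in H^{1/2}(\Gamma_D)$. For open $\omega\subset\Omega$ put $a_\omega(u,v)=\int_\omega A\nabla u\cdot\nabla v\,dx$ and $\|u\|_{a,\omega}=\sqrt{a_\omega(u,u)}$. Let $u_0\in H^1(\Omega)$ with $u_0=q$ on $\Gamma_D$ be a weak solution of the mixed boundary value problem, i.e. $a_\Omega(u_0,v)=\int_{\Gamma_N}gv\,ds+\int_\Omega fv\,dx$ for all $v\in H^1(\Omega)$ with $v=0$ on $\Gamma_D$. Let $\omega\subseteq\omega^*\subseteq\Omega$, where $\omega$ is open and $\omega^*$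 is a domain with Lipschitz boundary. Let $\chi$ be a partition of unity function supported on the interior subdomain $\omega$: $0\le\chi\le1$, $\chi=0$ outside $\omega$, $\chi$ is continuous on $\mathbb{R}^d$, $\chi\in C^1(\omega)$ with bounded gradient, and $\chi\not\equiv0$. Define $$H_A(\omega^*)=\{v\in H^1(\omega^*): a_{\omega^*}(v,\varphi)=0\ \ \forall\varphi\in H_0^1(\omega^*)\},$$ $$H_{A,0}(\omega^*)=\Big\{v\in H_A(\omega^*): \mathcal{M}_\omega(v):=\frac{\int_\omega A\nabla(\chi v)\cdot\nabla\chi\,dx}{\int_\omega A\nabla\chi\cdot\nabla\chi\,dx}=0\Big\},$$ and, for $m\ge0$, the Kolmogorov $m$-width $$d_m(\omega,\omega^*)=\inf_{\substack{Q\subset H_0^1(\omega)\\ \dim Q=m}}\ \sup_{u\in H_{A,0}(\omega^*)}\ \inf_{v\in Q}\frac{\|\chi u-v\|_{a,\omega}}{\|u\|_{a,\omega^*}}$$ (the quotient being omitted for $u=0$). Let $\psi\in H_0^1(\omega^*)$ be the weak solution of $-\operatorname{div}(A\nabla\psi)=f$ in $\omega^*$, $\psi=0$ on $\partial\omega^*$,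 and let $u^p=\psi|_\omega$. **Theorem.** Let $n\ge1$, let $v_1,\dots,v_n$ be linearly independent eigenfunctions belonging to the first $n$ eigenvalues $\lambda_1\le\dots\le\lambda_n$ (arranged in increasing order and counted with multiplicity) of the eigenproblem of finding $\lambda\in\mathbb{R}$ and $0\neq v\in H_A(\omega^*)$ with $$a_{\omega^*}(v,\varphi)=\lambda\,a_\omega(\chi v,\chi\varphi)\qquad\forall\varphi\in H_A(\omega^*),$$ and let $S_n(\omega)=\operatorname{span}\{v_1|_\omega,\dots,v_n|_\omega\}$. Then $S_n(\omega)$ contains the constant functions, $d_{n-1}(\omega,\omega^*)$ is finite, and there exists $\phi\in S_n(\omega)$ such that $$\|\chi(u_0-u^p-\phi)\|_{a,\omega}\le d_{n-1}(\omega,\omega^*)\,\|u_0\|_{a,\omega^*}.$$ -/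

import Mathlib

open MeasureTheory Filter Topology Set
open scoped ENNReal

noncomputable section

namespace MSGFEM

/-- Euclidean space `ℝ^d`. -/
abbrev Euc (d : ℕ) := EuclideanSpace ℝ (Fin d)

variable {d : ℕ}

/-! ### Domains -/

/-- `Ω` has a Lipschitz boundary: near each boundary point, `Ω` is the set of points lying strictly
above the graph of a Lipschitz function over the hyperplane orthogonal to some unit vector `e`. -/
def HasLipschitzBoundary (Ω : Set (Euc d)) : Prop :=
  ∀ x ∈ frontier Ω, ∃ r > 0, ∃ e : Euc d, ‖e‖ = 1 ∧
    ∃ (K : NNReal) (γ : Euc d → ℝ), LipschitzWith K γ ∧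
      ∀ y ∈ Metric.ball x r, y ∈ Ω ↔ γ (y - inner ℝ e y • e) < inner ℝ e y

/-- Bounded Lipschitz domain (open, nonempty, connected, bounded, with Lipschitz boundary). -/
structure IsLipschitzDomain (Ω : Set (Euc d)) : Prop where
  isOpen : IsOpen Ω
  isConnected : IsConnected Ω
  isBounded : Bornology.IsBounded Ω
  lipschitz : HasLipschitzBoundary Ω

/-! ### Sobolev spaces

A (class of) function(s) on an open set `ω` is represented by a function on `ℝ^d`, of which only
the values on `ω`, up to null sets, matter; so restriction to a smaller set needs no notation. -/

/-- Test functions: `C_c^∞(ω)`. -/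
def IsTestFun (ω : Set (Euc d)) (φ : Euc d → ℝ) : Prop :=
  ContDiff ℝ (⊤ : ℕ∞) φ ∧ HasCompactSupport φ ∧ tsupport φ ⊆ ω

/-- `G ∈ L²(ω)^d` is a weak gradient of `u` on `ω`. -/
def HasWeakGrad (ω : Set (Euc d)) (u : Euc d → ℝ) (G : Euc d → Euc d) : Prop :=
  MemLp G 2 (volume.restrict ω) ∧
    ∀ φ, IsTestFun ω φ → ∀ e : Euc d,
      ∫ x in ω, u x * fderiv ℝ φ x e = -∫ x in ω, inner ℝ (G x) e * φ x

/-- `u ∈ H¹(ω)`. -/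
def InH1 (ω : Set (Euc d)) (u : Euc d → ℝ) : Prop :=
  MemLp u 2 (volume.restrict ω) ∧ ∃ G, HasWeakGrad ω u G

open Classical in
/-- The weak gradient `∇u` on `ω` (determined almost everywhere on `ω` for `u ∈ H¹(ω)`). -/
def weakGrad (ω : Set (Euc d)) (u : Euc d → ℝ) : Euc d → Euc d :=
  if h : ∃ G, HasWeakGrad ω u G then h.choose else 0

/-- The norm of `H¹(ω)`. -/
def h1Norm (ω : Set (Euc d)) (u : Euc d → ℝ) : ℝ :=
  √(∫ x in ω, (u x ^ 2 + ‖weakGrad ω u x‖ ^ 2))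

/-- `u ∈ H¹₀(ω)`, the closure of `C_c^∞(ω)` in `H¹(ω)`. -/
def InH10 (ω : Set (Euc d)) (u : Euc d → ℝ) : Prop :=
  InH1 ω u ∧ ∀ ε > 0, ∃ φ, IsTestFun ω φ ∧ h1Norm ω (u - φ) < ε

/-! ### Boundary values -/

/-- The surface measure of `∂Ω` (up to a positive normalizing constant, which is immaterial
here). -/
def surf (Ω : Set (Euc d)) : Measure (Euc d) :=
  (Measure.hausdorffMeasure ((d : ℝ) - 1)).restrict (frontier Ω)

/-- `t ∈ L²(∂Ω)` is the trace of `u ∈ H¹(Ω)`: the continuous extension to `H¹(Ω)` of the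
restriction to `∂Ω` of functions that are smooth up to the boundary. -/
def IsTrace (Ω : Set (Euc d)) (u t : Euc d → ℝ) : Prop :=
  InH1 Ω u ∧ MemLp t 2 (surf Ω) ∧ ∃ w : ℕ → Euc d → ℝ,
    (∀ k, ContDiff ℝ (⊤ : ℕ∞) (w k)) ∧
    Tendsto (fun k => h1Norm Ω (u - w k)) atTop (𝓝 0) ∧
    Tendsto (fun k => eLpNorm (t - w k) 2 (surf Ω)) atTop (𝓝 0)

/-- `u ∈ H¹(Ω)` satisfies `u = t` on the part `Γ` of `∂Ω`, in the sense of traces. -/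
def HasTraceOn (Ω Γ : Set (Euc d)) (u t : Euc d → ℝ) : Prop :=
  ∃ s, IsTrace Ω u s ∧ s =ᵐ[(surf Ω).restrict Γ] t

/-- `v ∈ H¹_{0D}(Ω)`: `v ∈ H¹(Ω)` and `v = 0` on `Γ_D`. -/
def InH10D (Ω ΓD : Set (Euc d)) (v : Euc d → ℝ) : Prop :=
  InH1 Ω v ∧ HasTraceOn Ω ΓD v 0

/-- `g ∈ H^{-1/2}(Γ_N)`: a linear functional of the boundary values on `Γ_N` of functions of
`H¹_{0D}(Ω)`, bounded for the quotient norm `inf ‖v‖_{H¹(Ω)}` over all `v` with those boundary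
values (in particular it only depends on the boundary values up to null sets of `Γ_N`). Its values
off this trace space are never used; a linear functional on the trace space can always be extended
linearly to all functions. -/
def InHMinusHalf (Ω ΓD ΓN : Set (Euc d)) (g : (Euc d → ℝ) →ₗ[ℝ] ℝ) : Prop :=
  ∃ C : ℝ, ∀ v, InH10D Ω ΓD v → ∀ t, HasTraceOn Ω ΓN v t → |g t| ≤ C * h1Norm Ω v

/-! ### The elliptic problem -/

/-- `A ∈ L^∞(Ω)^{d×d}` is symmetric and uniformly elliptic, with bounds `α` and `β`. -/
structure IsCoeff (Ω : Set (Euc d)) (A : Euc d → Matrix (Fin d) (Fin d) ℝ) (α β : ℝ) : Prop where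
  pos : 0 < α
  lt : α < β
  meas : ∀ i j, AEMeasurable (fun x => A x i j) (volume.restrict Ω)
  symm : ∀ᵐ x ∂volume.restrict Ω, (A x).IsSymm
  elliptic : ∀ᵐ x ∂volume.restrict Ω, ∀ ξ : Fin d → ℝ,
    α * ∑ i, ξ i ^ 2 ≤ ∑ i, ∑ j, A x i j * ξ i * ξ j ∧
    ∑ i, ∑ j, A x i j * ξ i * ξ j ≤ β * ∑ i, ξ i ^ 2

/-- `a_ω(u, v) = ∫_ω A ∇u · ∇v`. -/
def aForm (A : Euc d → Matrix (Fin d) (Fin d) ℝ) (ω : Set (Euc d)) (u v : Euc d → ℝ) : ℝ :=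
  ∫ x in ω, ∑ i, ∑ j, A x i j * weakGrad ω u x j * weakGrad ω v x i

/-- The energy norm `‖u‖_{a,ω}`. -/
def aNorm (A : Euc d → Matrix (Fin d) (Fin d) ℝ) (ω : Set (Euc d)) (u : Euc d → ℝ) : ℝ :=
  √(aForm A ω u u)

/-- `u₀ ∈ H¹_{qD}(Ω)` and `a(u₀, v) = F(v)` for all `v ∈ H¹_{0D}(Ω)`, where
`F(v) = ∫_{Γ_N} g v + ∫_Ω f v`. -/
def IsWeakSolution (A : Euc d → Matrix (Fin d) (Fin d) ℝ) (Ω ΓD ΓN : Set (Euc d))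
    (f : Euc d → ℝ) (g : (Euc d → ℝ) →ₗ[ℝ] ℝ) (q u₀ : Euc d → ℝ) : Prop :=
  InH1 Ω u₀ ∧ HasTraceOn Ω ΓD u₀ q ∧
    ∀ v, InH10D Ω ΓD v → ∀ t, HasTraceOn Ω ΓN v t →
      aForm A Ω u₀ v = g t + ∫ x in Ω, f x * v x

/-- `ψ ∈ H¹₀(ω*)` is the weak solution of `-div(A∇ψ) = f` in `ω*`, `ψ = 0` on `∂ω*`. -/
def IsDirichletSolution (A : Euc d → Matrix (Fin d) (Fin d) ℝ) (ωs : Set (Euc d))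
    (f ψ : Euc d → ℝ) : Prop :=
  InH10 ωs ψ ∧ ∀ φ, InH10 ωs φ → aForm A ωs ψ φ = ∫ x in ωs, f x * φ x

/-! ### `A`-harmonic functions, the `n`-width and the eigenproblem -/

/-- The properties of a partition of unity function `χ` supported on an interior subdomain `ω`,
extended by zero: `0 ≤ χ ≤ 1`, `χ = 0` off `ω`, `χ` is continuous (so it vanishes on `∂ω`) and
`C¹` in `ω` with bounded gradient; `χ` is not the zero function. -/
structure IsCutoff (ω : Set (Euc d)) (χ : Euc d → ℝ) : Prop where
  nonneg : ∀ x, 0 ≤ χ x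
  le_one : ∀ x, χ x ≤ 1
  eq_zero : ∀ x, x ∉ ω → χ x = 0
  cont : Continuous χ
  contDiffOn : ContDiffOn ℝ 1 χ ω
  grad_bdd : ∃ C : ℝ, ∀ x ∈ ω, ‖fderiv ℝ χ x‖ ≤ C
  nontrivial : ∃ x, χ x ≠ 0

/-- `v ∈ H_A(ω*)`. -/
def InHA (A : Euc d → Matrix (Fin d) (Fin d) ℝ) (ωs : Set (Euc d)) (v : Euc d → ℝ) : Prop :=
  InH1 ωs v ∧ ∀ φ, InH10 ωs φ → aForm A ωs v φ = 0

/-- The weighted mean `𝓜_ω(v) = ∫_ω A∇(χv)·∇χ / ∫_ω A∇χ·∇χ`. -/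
def wMean (A : Euc d → Matrix (Fin d) (Fin d) ℝ) (χ : Euc d → ℝ) (ω : Set (Euc d))
    (v : Euc d → ℝ) : ℝ :=
  aForm A ω (χ * v) χ / aForm A ω χ χ

/-- `v ∈ H_{A,0}(ω*)`. -/
def InHA0 (A : Euc d → Matrix (Fin d) (Fin d) ℝ) (χ : Euc d → ℝ) (ω ωs : Set (Euc d))
    (v : Euc d → ℝ) : Prop :=
  InHA A ωs v ∧ wMean A χ ω v = 0

/-- Linear independence of functions on `ω`, up to null sets. -/
def LinIndepOn (ω : Set (Euc d)) {n : ℕ} (v : Fin n → Euc d → ℝ) : Prop :=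
  ∀ c : Fin n → ℝ, ∑ k, c k • v k =ᵐ[volume.restrict ω] 0 → c = 0

/-- The Kolmogorov `n`-width `d_n(ω, ω*)` of `P : H_{A,0}(ω*) → H¹₀(ω)`, `Pu = χu`: the infimum
over the `n`-dimensional subspaces `Q(n)` of `H¹₀(ω)` (given by a basis `b`) of the supremum over
`u ∈ H_{A,0}(ω*)` of the infimum over `v ∈ Q(n)` of `‖Pu - v‖_{a,ω} / ‖u‖_{a,ω*}`. (For `u = 0`
the infimum over `v` is `0`, by `0 / 0 = 0`.) -/
def nWidth (A : Euc d → Matrix (Fin d) (Fin d) ℝ) (χ : Euc d → ℝ) (ω ωs : Set (Euc d))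
    (n : ℕ) : ℝ≥0∞ :=
  ⨅ (b : Fin n → Euc d → ℝ) (_ : ∀ k, InH10 ω (b k)) (_ : LinIndepOn ω b),
    ⨆ (u : Euc d → ℝ) (_ : InHA0 A χ ω ωs u),
      ⨅ v ∈ Submodule.span ℝ (range b),
        ENNReal.ofReal (aNorm A ω (χ * u - v)) / ENNReal.ofReal (aNorm A ωs u)

/-- `v ∈ H_A(ω*)`, `v ≠ 0`, is an eigenfunction for the eigenvalue `lam`:
`a_{ω*}(v, φ) = lam a_ω(χv, χφ)` for all `φ ∈ H_A(ω*)`. -/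
def IsEigenpair (A : Euc d → Matrix (Fin d) (Fin d) ℝ) (χ : Euc d → ℝ) (ω ωs : Set (Euc d))
    (lam : ℝ) (v : Euc d → ℝ) : Prop :=
  InHA A ωs v ∧ ¬ v =ᵐ[volume.restrict ωs] 0 ∧
    ∀ φ, InHA A ωs φ → aForm A ωs v φ = lam * aForm A ω (χ * v) (χ * φ)

/-- `(lam k, v k)`, `k = 0, …, n - 1`, are the first `n` eigenpairs, the eigenvalues being counted
with multiplicity and arranged in increasing order. The last condition says that no eigenfunction
is skipped: those with an eigenvalue below one of the `lam k` are combinations of the `v k`. -/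
structure IsFirstEigenpairs (A : Euc d → Matrix (Fin d) (Fin d) ℝ) (χ : Euc d → ℝ)
    (ω ωs : Set (Euc d)) {n : ℕ} (lam : Fin n → ℝ) (v : Fin n → Euc d → ℝ) : Prop where
  eigen : ∀ k, IsEigenpair A χ ω ωs (lam k) (v k)
  indep : LinIndepOn ωs v
  mono : Monotone lam
  first : ∀ μ w, IsEigenpair A χ ω ωs μ w → (∃ k, μ < lam k) →
    ∃ φ ∈ Submodule.span ℝ (range v), w =ᵐ[volume.restrict ωs] φ

end MSGFEM

end

/-! Write a(u,v) = a_{ω*}(u,v) and b(u,v) = a_ω(χu,χv) for the two forms on H_A(ω*). The function u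
= u₀ - ψ is A-harmonic, hence a-orthogonal to ψ ∈ H¹₀(ω*), so a(u,u) ≤ a(u₀,u₀). Let φ be the
b-orthogonal projection of u onto the span of the eigenfunctions and w = u - φ. The eigenvalue
equation turns b-orthogonality to the v_k into a-orthogonality, so a(w,w) ≤ a(u,u). It remains to
show b(w,w) ≤ d_{n-1}² a(w,w) for every w that is b-orthogonal to v_1, …, v_n.

Constants solve the eigenproblem with eigenvalue 0, the least possible one, so they lie in the span
(`exists_comb_one`). Hence such a w has weighted mean zero.

The bound by the width is a dimension count (`exists_test_vector`). Given Q of dimension n - 1, the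
combinations of v_1, …, v_n and w have n + 1 coefficients. Zero weighted mean is one linear
condition and orthogonality of χu to Q is n - 1 more, so a nontrivial combination u survives. On the
span a ≤ λ_n b (`a_comb_le`), while a(w,w) ≥ λ_n b(w,w) by the minimum principle (`lam_mul_b_le`);
therefore b/a at u is at least b/a at w. As χu is orthogonal to Q, no element of Q approximates it
better than 0 does. Neither an (n+1)-st eigenvalue nor an eigenbasis is needed.

The minimum principle rests on maximizing b over the a-unit ball of the b-complement of the v_k: a
maximizer violating the inequality would be an eigenfunction omitted from the list. It exists
because b is compact relative to a (`isCompactPair`). By Caccioppoli's inequality b(u,u) is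
controlled by the L² norm of u, Rellich's theorem on the Lipschitz domain ω* gives L² compactness,
and a Poincaré inequality for weighted mean zero bounds the L² norm by a.

The Sobolev facts are derived from the definition of weak gradients by two tools: mollification and
the estimate of u(· + z) - u by |z| ‖∇u‖. -/

open MeasureTheory Filter Topology Set
open scoped ENNReal

noncomputable section

namespace MSGFEM

variable {d : ℕ}

/-! ### Weak gradients -/

/-- `u ∈ H¹(ω)` with weak gradient `G`. -/
def IsH1Pair (ω : Set (Euc d)) (u : Euc d → ℝ) (G : Euc d → Euc d) : Prop :=
  MemLp u 2 (volume.restrict ω) ∧ HasWeakGrad ω u G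

theorem memLp_restrict_of_continuous {E : Type*} [NormedAddCommGroup E] {ω : Set (Euc d)}
    {ζ : Euc d → E} (hc : Continuous ζ) (hs : HasCompactSupport ζ) :
    MemLp ζ 2 (volume.restrict ω) :=
  (hc.memLp_of_hasCompactSupport hs).restrict ω

theorem integrable_mul_of_continuous {ω : Set (Euc d)} {u ζ : Euc d → ℝ}
    (hu : MemLp u 2 (volume.restrict ω)) (hc : Continuous ζ) (hs : HasCompactSupport ζ) :
    Integrable (fun x => u x * ζ x) (volume.restrict ω) :=
  hu.integrable_mul (memLp_restrict_of_continuous hc hs)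

theorem continuous_fderiv_apply_of_contDiff {φ : Euc d → ℝ} (hφ : ContDiff ℝ 1 φ) (e : Euc d) :
    Continuous fun x => fderiv ℝ φ x e :=
  (hφ.continuous_fderiv one_ne_zero).clm_apply continuous_const

theorem hasCompactSupport_fderiv_apply {φ : Euc d → ℝ} (hφ : HasCompactSupport φ) (e : Euc d) :
    HasCompactSupport fun x => fderiv ℝ φ x e :=
  hφ.fderiv_apply (𝕜 := ℝ) e

theorem IsTestFun.contDiff_one {ω : Set (Euc d)} {φ : Euc d → ℝ} (hφ : IsTestFun ω φ) :
    ContDiff ℝ 1 φ :=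
  hφ.1.of_le (by exact_mod_cast le_top)

theorem IsTestFun.mono {ω ω' : Set (Euc d)} (h : ω ⊆ ω') {φ : Euc d → ℝ} (hφ : IsTestFun ω φ) :
    IsTestFun ω' φ :=
  ⟨hφ.1, hφ.2.1, hφ.2.2.trans h⟩

theorem memLp_inner_const {ω : Set (Euc d)} {G : Euc d → Euc d}
    (hG : MemLp G 2 (volume.restrict ω)) (e : Euc d) :
    MemLp (fun x => inner ℝ (G x) e) 2 (volume.restrict ω) :=
  hG.inner_const e

theorem locallyIntegrableOn_of_memLp {E : Type*} [NormedAddCommGroup E] {ω : Set (Euc d)}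
    (hω : IsOpen ω) {G : Euc d → E} (hG : MemLp G 2 (volume.restrict ω)) :
    LocallyIntegrableOn G ω volume := by
  rw [locallyIntegrableOn_iff hω.isLocallyClosed]
  intro k hk hkc
  have h1 : MemLp G 2 (volume.restrict k) := hG.mono_measure (Measure.restrict_mono hk le_rfl)
  have : IsFiniteMeasure (volume.restrict k) := ⟨by simpa using hkc.measure_lt_top⟩
  exact h1.integrable (by norm_num)

/-- The fundamental lemma of the calculus of variations on an open set. -/
theorem ae_eq_zero_of_forall_testFun {E : Type*} [NormedAddCommGroup E] [NormedSpace ℝ E]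
    [CompleteSpace E] {ω : Set (Euc d)} (hω : IsOpen ω) {D : Euc d → E}
    (hD : MemLp D 2 (volume.restrict ω))
    (h : ∀ φ, IsTestFun ω φ → ∫ x in ω, φ x • D x = 0) : D =ᵐ[volume.restrict ω] 0 := by
  have := hω.ae_eq_zero_of_integral_contDiff_smul_eq_zero
    (locallyIntegrableOn_of_memLp hω hD) (fun g h1 h2 h3 => by
      rw [← h g ⟨h1, h2, h3⟩]
      refine (setIntegral_eq_integral_of_forall_compl_eq_zero fun x hx => ?_).symm
      rw [image_eq_zero_of_notMem_tsupport (fun hx' => hx (h3 hx')), zero_smul])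
  exact (ae_restrict_iff' hω.measurableSet).2 this

/-- The difference of two weak gradients annihilates every test function. This is what allows the
chosen representative `weakGrad` to be replaced by an explicit gradient everywhere below. -/
theorem HasWeakGrad.unique {ω : Set (Euc d)} (hω : IsOpen ω) {u : Euc d → ℝ}
    {G G' : Euc d → Euc d} (h : HasWeakGrad ω u G) (h' : HasWeakGrad ω u G') :
    G =ᵐ[volume.restrict ω] G' := by
  have hD := h.1.sub h'.1
  have := ae_eq_zero_of_forall_testFun hω hD fun φ hφ => by
    have hφ2 : MemLp φ 2 (volume.restrict ω) :=
      memLp_restrict_of_continuous hφ.1.continuous hφ.2.1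
    have hi : Integrable (fun x => φ x • (G - G') x) (volume.restrict ω) :=
      memLp_one_iff_integrable.1 (hD.smul hφ2)
    refine ext_inner_right ℝ fun e => ?_
    rw [inner_zero_left, real_inner_comm, ← integral_inner hi]
    have h1 := (h.2 φ hφ e).symm.trans (h'.2 φ hφ e)
    have i1 := integrable_mul_of_continuous (memLp_inner_const h.1 e) hφ.1.continuous hφ.2.1
    have i2 := integrable_mul_of_continuous (memLp_inner_const h'.1 e) hφ.1.continuous hφ.2.1
    have h2 : ∀ x, inner ℝ e (φ x • (G - G') x)
        = inner ℝ (G x) e * φ x - inner ℝ (G' x) e * φ x := fun x => by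
      rw [inner_smul_right, Pi.sub_apply, inner_sub_right, real_inner_comm (G x) e,
        real_inner_comm (G' x) e]; ring
    simp_rw [h2]
    rw [integral_sub i1 i2]
    linarith
  filter_upwards [this] with x hx
  simpa [sub_eq_zero] using hx

theorem IsH1Pair.unique {ω : Set (Euc d)} (hω : IsOpen ω) {u : Euc d → ℝ}
    {G G' : Euc d → Euc d} (h : IsH1Pair ω u G) (h' : IsH1Pair ω u G') :
    G =ᵐ[volume.restrict ω] G' :=
  h.2.unique hω h'.2

theorem IsH1Pair.congr {ω : Set (Euc d)} {u u' : Euc d → ℝ} {G G' : Euc d → Euc d}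
    (h : IsH1Pair ω u G) (hu : u =ᵐ[volume.restrict ω] u') (hG : G =ᵐ[volume.restrict ω] G') :
    IsH1Pair ω u' G' := by
  refine ⟨(memLp_congr_ae hu).1 h.1, (memLp_congr_ae hG).1 h.2.1, fun φ hφ e => ?_⟩
  have h1 : ∫ x in ω, u' x * fderiv ℝ φ x e = ∫ x in ω, u x * fderiv ℝ φ x e :=
    integral_congr_ae (by filter_upwards [hu] with x hx; rw [hx])
  have h2 : ∫ x in ω, inner ℝ (G' x) e * φ x = ∫ x in ω, inner ℝ (G x) e * φ x :=
    integral_congr_ae (by filter_upwards [hG] with x hx; rw [hx])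
  rw [h1, h2, h.2.2 φ hφ e]

theorem IsH1Pair.add {ω : Set (Euc d)} {u u' : Euc d → ℝ} {G G' : Euc d → Euc d}
    (h : IsH1Pair ω u G) (h' : IsH1Pair ω u' G') : IsH1Pair ω (u + u') (G + G') := by
  refine ⟨h.1.add h'.1, h.2.1.add h'.2.1, fun φ hφ e => ?_⟩
  have hc := continuous_fderiv_apply_of_contDiff hφ.contDiff_one e
  have hs := hasCompactSupport_fderiv_apply hφ.2.1 e
  have hc' := hφ.1.continuous
  simp only [Pi.add_apply, add_mul, inner_add_left]
  rw [integral_add (integrable_mul_of_continuous h.1 hc hs)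
    (integrable_mul_of_continuous h'.1 hc hs),
    integral_add (integrable_mul_of_continuous (memLp_inner_const h.2.1 e) hc' hφ.2.1)
    (integrable_mul_of_continuous (memLp_inner_const h'.2.1 e) hc' hφ.2.1),
    h.2.2 φ hφ e, h'.2.2 φ hφ e]
  ring

theorem IsH1Pair.smul {ω : Set (Euc d)} {u : Euc d → ℝ} {G : Euc d → Euc d}
    (c : ℝ) (h : IsH1Pair ω u G) : IsH1Pair ω (c • u) (c • G) := by
  refine ⟨h.1.const_smul c, h.2.1.const_smul c, fun φ hφ e => ?_⟩
  simp only [Pi.smul_apply, smul_eq_mul, mul_assoc, inner_smul_left, RCLike.conj_to_real]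
  rw [integral_const_mul, integral_const_mul, h.2.2 φ hφ e]
  ring

theorem IsH1Pair.sub {ω : Set (Euc d)} {u u' : Euc d → ℝ} {G G' : Euc d → Euc d}
    (h : IsH1Pair ω u G) (h' : IsH1Pair ω u' G') : IsH1Pair ω (u - u') (G - G') := by
  have := h.add (h'.smul (-1))
  rwa [neg_one_smul, neg_one_smul, ← sub_eq_add_neg, ← sub_eq_add_neg] at this

theorem IsH1Pair.mono {ω ω' : Set (Euc d)} (hω : IsOpen ω) (hs : ω' ⊆ ω)
    {u : Euc d → ℝ} {G : Euc d → Euc d} (h : IsH1Pair ω u G) : IsH1Pair ω' u G := by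
  have hm := Measure.restrict_mono hs (le_refl (volume : Measure (Euc d)))
  refine ⟨h.1.mono_measure hm, h.2.1.mono_measure hm, fun φ hφ e => ?_⟩
  have h0 := h.2.2 φ (hφ.mono hs) e
  have hz : ∀ x ∈ ω \ ω', φ x = 0 := fun x hx =>
    image_eq_zero_of_notMem_tsupport fun h' => hx.2 (hφ.2.2 h')
  have hz' : ∀ x ∈ ω \ ω', fderiv ℝ φ x e = 0 := fun x hx => by
    rw [fderiv_of_notMem_tsupport ℝ fun h' => hx.2 (hφ.2.2 h')]; rfl
  rwa [setIntegral_eq_of_subset_of_forall_sdiff_eq_zero hω.measurableSet hs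
      (fun x hx => by rw [hz' x hx, mul_zero]),
    setIntegral_eq_of_subset_of_forall_sdiff_eq_zero hω.measurableSet hs
      (fun x hx => by rw [hz x hx, mul_zero])] at h0

theorem isFiniteMeasure_restrict_of_isBounded {ω : Set (Euc d)} (hb : Bornology.IsBounded ω) :
    IsFiniteMeasure (volume.restrict ω) :=
  ⟨by simpa using hb.measure_lt_top⟩

theorem integral_fderiv_apply_eq_zero {φ : Euc d → ℝ} (hφ : ContDiff ℝ 1 φ)
    (hs : HasCompactSupport φ) (e : Euc d) : ∫ x, fderiv ℝ φ x e = 0 := by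
  have hc := continuous_fderiv_apply_of_contDiff hφ e
  have := integral_mul_fderiv_eq_neg_fderiv_mul_of_integrable (𝕜 := ℝ) (μ := (volume : Measure (Euc d)))
    (f := fun _ => (1 : ℝ)) (g := φ) (v := e) (by simp)
    (by simpa using hc.integrable_of_hasCompactSupport (hasCompactSupport_fderiv_apply hs e))
    (by simpa using hφ.continuous.integrable_of_hasCompactSupport hs)
    (fun x _ => differentiableAt_const _)
    (fun x _ => hφ.differentiable one_ne_zero x)
  simpa using this

theorem setIntegral_fderiv_apply {ω : Set (Euc d)} {φ : Euc d → ℝ} (hs : tsupport φ ⊆ ω)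
    (e : Euc d) : ∫ x in ω, fderiv ℝ φ x e = ∫ x, fderiv ℝ φ x e :=
  setIntegral_eq_integral_of_forall_compl_eq_zero fun x hx => by
    rw [fderiv_of_notMem_tsupport ℝ fun h' => hx (hs h')]; rfl

theorem isH1Pair_const {ω : Set (Euc d)} (hb : Bornology.IsBounded ω) (c : ℝ) :
    IsH1Pair ω (fun _ => c) 0 := by
  have := isFiniteMeasure_restrict_of_isBounded hb
  refine ⟨memLp_const c, MemLp.zero, fun φ hφ e => ?_⟩
  rw [integral_const_mul, setIntegral_fderiv_apply hφ.2.2,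
    integral_fderiv_apply_eq_zero hφ.contDiff_one hφ.2.1]
  simp

theorem InH1.isH1Pair {ω : Set (Euc d)} {u : Euc d → ℝ} (h : InH1 ω u) :
    IsH1Pair ω u (weakGrad ω u) := by
  refine ⟨h.1, ?_⟩
  rw [weakGrad, dif_pos h.2]
  exact h.2.choose_spec

theorem IsH1Pair.inH1 {ω : Set (Euc d)} {u : Euc d → ℝ} {G : Euc d → Euc d}
    (h : IsH1Pair ω u G) : InH1 ω u :=
  ⟨h.1, G, h.2⟩

theorem IsH1Pair.weakGrad_ae {ω : Set (Euc d)} (hω : IsOpen ω) {u : Euc d → ℝ}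
    {G : Euc d → Euc d} (h : IsH1Pair ω u G) : weakGrad ω u =ᵐ[volume.restrict ω] G :=
  h.inH1.isH1Pair.unique hω h

theorem IsH1Pair.h1Norm_eq {ω : Set (Euc d)} (hω : IsOpen ω) {u : Euc d → ℝ}
    {G : Euc d → Euc d} (h : IsH1Pair ω u G) :
    h1Norm ω u = √(∫ x in ω, (u x ^ 2 + ‖G x‖ ^ 2)) := by
  rw [h1Norm]
  congr 1
  exact integral_congr_ae (by filter_upwards [h.weakGrad_ae hω] with x hx; rw [hx])

/-! ### Squared `L²` norms as extended nonnegative integrals -/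

/-- The square of the `L²(ω)` norm. -/
def sqInt {E : Type*} [NormedAddCommGroup E] (ω : Set (Euc d)) (u : Euc d → E) : ℝ≥0∞ :=
  ∫⁻ x in ω, ‖u x‖ₑ ^ 2

theorem sqInt_eq_eLpNorm_sq {E : Type*} [NormedAddCommGroup E] (ω : Set (Euc d))
    (u : Euc d → E) : sqInt ω u = eLpNorm u 2 (volume.restrict ω) ^ 2 := by
  have := eLpNorm_nnreal_pow_eq_lintegral (f := u) (μ := volume.restrict ω) (p := 2) (by norm_num)
  simpa [sqInt] using this.symm

theorem sqInt_lt_top {E : Type*} [NormedAddCommGroup E] {ω : Set (Euc d)} {u : Euc d → E}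
    (hu : MemLp u 2 (volume.restrict ω)) : sqInt ω u < ⊤ := by
  rw [sqInt_eq_eLpNorm_sq]
  exact ENNReal.pow_lt_top hu.2

theorem sqInt_mono_set {E : Type*} [NormedAddCommGroup E] {s t : Set (Euc d)} (h : s ⊆ t)
    (u : Euc d → E) : sqInt s u ≤ sqInt t u :=
  lintegral_mono' (Measure.restrict_mono h le_rfl) le_rfl

theorem sqInt_congr {E : Type*} [NormedAddCommGroup E] {ω : Set (Euc d)} {u v : Euc d → E}
    (h : u =ᵐ[volume.restrict ω] v) : sqInt ω u = sqInt ω v :=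
  lintegral_congr_ae (by filter_upwards [h] with x hx; rw [hx])

theorem enorm_add_sq_le {E : Type*} [NormedAddCommGroup E] (x y : E) :
    ‖x + y‖ₑ ^ 2 ≤ 2 * ‖x‖ₑ ^ 2 + 2 * ‖y‖ₑ ^ 2 := by
  rcases le_total ‖x‖ₑ ‖y‖ₑ with h | h
  all_goals
    have h1 : ‖x + y‖ ^ 2 ≤ 2 * ‖x‖ ^ 2 + 2 * ‖y‖ ^ 2 := by
      nlinarith [norm_add_le x y, sq_nonneg (‖x‖ - ‖y‖), norm_nonneg (x + y), norm_nonneg x,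
        norm_nonneg y]
    simp only [← ofReal_norm, ← ENNReal.ofReal_pow (norm_nonneg _)]
    rw [show (2 : ℝ≥0∞) = ENNReal.ofReal 2 by simp, ← ENNReal.ofReal_mul (by norm_num),
      ← ENNReal.ofReal_mul (by norm_num), ← ENNReal.ofReal_add (by positivity) (by positivity)]
    exact ENNReal.ofReal_le_ofReal h1

theorem sqInt_add_le {E : Type*} [NormedAddCommGroup E] {ω : Set (Euc d)} {u v : Euc d → E}
    (hu : AEStronglyMeasurable u (volume.restrict ω)) :
    sqInt ω (u + v) ≤ 2 * sqInt ω u + 2 * sqInt ω v := by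
  have hm : AEMeasurable (fun x => 2 * ‖u x‖ₑ ^ 2) (volume.restrict ω) :=
    (hu.enorm.pow_const 2).const_mul 2
  calc sqInt ω (u + v) ≤ ∫⁻ x in ω, (2 * ‖u x‖ₑ ^ 2 + 2 * ‖v x‖ₑ ^ 2) :=
        lintegral_mono fun x => enorm_add_sq_le _ _
    _ = 2 * sqInt ω u + 2 * sqInt ω v := by
        rw [lintegral_add_left' hm, lintegral_const_mul' _ _ (by simp),
          lintegral_const_mul' _ _ (by simp)]; rfl

theorem ofReal_integral_norm_sq {E : Type*} [NormedAddCommGroup E] {ω : Set (Euc d)}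
    {u : Euc d → E} (hu : MemLp u 2 (volume.restrict ω)) :
    ENNReal.ofReal (∫ x in ω, ‖u x‖ ^ 2) = sqInt ω u := by
  rw [ofReal_integral_eq_lintegral_ofReal (hu.integrable_norm_pow (by norm_num))
    (Eventually.of_forall fun x => by positivity)]
  exact lintegral_congr fun x => by rw [ENNReal.ofReal_pow (norm_nonneg _), ofReal_norm]

theorem integral_norm_sq_eq_toReal {E : Type*} [NormedAddCommGroup E] {ω : Set (Euc d)}
    {u : Euc d → E} (hu : MemLp u 2 (volume.restrict ω)) :
    ∫ x in ω, ‖u x‖ ^ 2 = (sqInt ω u).toReal := by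
  rw [← ofReal_integral_norm_sq hu,
    ENNReal.toReal_ofReal (integral_nonneg fun x => by positivity)]

theorem IsH1Pair.ofReal_h1Norm_sq {ω : Set (Euc d)} (hω : IsOpen ω) {u : Euc d → ℝ}
    {G : Euc d → Euc d} (h : IsH1Pair ω u G) :
    ENNReal.ofReal (h1Norm ω u ^ 2) = sqInt ω u + sqInt ω G := by
  have h1 := h.1.integrable_norm_pow (by norm_num)
  have h2 := h.2.1.integrable_norm_pow (by norm_num)
  have h1' : Integrable (fun x => u x ^ 2) (volume.restrict ω) := by simpa using h1
  rw [h.h1Norm_eq hω, Real.sq_sqrt (integral_nonneg fun x => by positivity),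
    integral_add h1' (by simpa using h2),
    ENNReal.ofReal_add (integral_nonneg fun x => by positivity)
      (integral_nonneg fun x => by positivity), ofReal_integral_norm_sq h.2.1,
    ← ofReal_integral_norm_sq h.1]
  simp

/-! ### Mollification -/

/-- The gradient of a differentiable function. -/
def cgrad (φ : Euc d → ℝ) (x : Euc d) : Euc d :=
  (InnerProductSpace.toDual ℝ (Euc d)).symm (fderiv ℝ φ x)

theorem inner_cgrad (φ : Euc d → ℝ) (x e : Euc d) : inner ℝ (cgrad φ x) e = fderiv ℝ φ x e :=
  InnerProductSpace.toDual_symm_apply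

theorem norm_cgrad (φ : Euc d → ℝ) (x : Euc d) : ‖cgrad φ x‖ = ‖fderiv ℝ φ x‖ :=
  LinearIsometryEquiv.norm_map _ _

theorem cgrad_eq {φ : Euc d → ℝ} {x G : Euc d} (h : ∀ e, fderiv ℝ φ x e = inner ℝ G e) :
    cgrad φ x = G :=
  ext_inner_right ℝ fun e => by rw [inner_cgrad, h]

/-- A bump function supported in the ball of radius `ε` around the origin. -/
def mollBump {ε : ℝ} (hε : 0 < ε) : ContDiffBump (0 : Euc d) := ⟨ε / 2, ε, by linarith, by linarith⟩

/-- Mollification with a bump function. -/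
def moll {E : Type*} [NormedAddCommGroup E] [NormedSpace ℝ E] (ρ : ContDiffBump (0 : Euc d))
    (u : Euc d → E) (x : Euc d) : E :=
  convolution (ρ.normed volume) u (ContinuousLinearMap.lsmul ℝ ℝ) volume x

theorem moll_apply {E : Type*} [NormedAddCommGroup E] [NormedSpace ℝ E]
    (ρ : ContDiffBump (0 : Euc d)) (u : Euc d → E) (x : Euc d) :
    moll ρ u x = ∫ z, ρ.normed volume z • u (x - z) :=
  rfl

theorem moll_apply' {E : Type*} [NormedAddCommGroup E] [NormedSpace ℝ E]
    (ρ : ContDiffBump (0 : Euc d)) (u : Euc d → E) (x : Euc d) :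
    moll ρ u x = ∫ y, ρ.normed volume (x - y) • u y := by
  rw [moll_apply, ← integral_sub_left_eq_self _ volume x]
  simp

theorem integrable_moll {E : Type*} [NormedAddCommGroup E] [NormedSpace ℝ E]
    (ρ : ContDiffBump (0 : Euc d)) {u : Euc d → E} (hu : LocallyIntegrable u volume)
    (x : Euc d) : Integrable fun z => ρ.normed volume z • u (x - z) :=
  ρ.hasCompactSupport_normed.convolutionExists_left (ContinuousLinearMap.lsmul ℝ ℝ)
    ρ.continuous_normed hu x

theorem normed_eq_zero_of_notMem_ball (ρ : ContDiffBump (0 : Euc d)) {z : Euc d}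
    (hz : z ∉ Metric.ball 0 ρ.rOut) : ρ.normed volume z = 0 := by
  rw [← ρ.support_normed_eq (μ := volume)] at hz
  exact Function.notMem_support.1 hz

/-- Jensen's inequality for the square, obtained as Hölder's inequality against 1 for the
probability measure with density `w`. -/
theorem sq_lintegral_le {α : Type*} [MeasurableSpace α] {μ : Measure α} {w f : α → ℝ≥0∞}
    (hw : Measurable w) (hf : Measurable f) (h1 : ∫⁻ x, w x ∂μ = 1) :
    (∫⁻ x, w x * f x ∂μ) ^ 2 ≤ ∫⁻ x, w x * f x ^ 2 ∂μ := by
  have hprob : IsProbabilityMeasure (μ.withDensity w) :=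
    ⟨by rw [withDensity_apply _ MeasurableSet.univ]; simpa using h1⟩
  have h2 := ENNReal.lintegral_mul_le_Lp_mul_Lq (μ.withDensity w) Real.HolderConjugate.two_two
    hf.aemeasurable (g := fun _ => 1) aemeasurable_const
  simp only [Pi.mul_apply, mul_one, ENNReal.one_rpow, lintegral_const, measure_univ] at h2
  rw [lintegral_withDensity_eq_lintegral_mul _ hw hf,
    lintegral_withDensity_eq_lintegral_mul _ hw (hf.pow_const _)] at h2
  simp only [Pi.mul_apply, ENNReal.rpow_two] at h2
  calc _ ≤ ((∫⁻ x, w x * f x ^ 2 ∂μ) ^ (1 / 2 : ℝ)) ^ 2 := by gcongr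
    _ = _ := by rw [← ENNReal.rpow_natCast, ← ENNReal.rpow_mul]; simp

/-- The mollification error is a weighted average of translation errors, so Jensen and Tonelli bound
it by the worst translation within the radius of the kernel. -/
theorem sqInt_sub_moll_le {E : Type*} [NormedAddCommGroup E] [NormedSpace ℝ E] [CompleteSpace E]
    (ρ : ContDiffBump (0 : Euc d)) {u : Euc d → E} (hm : StronglyMeasurable u)
    (hu : LocallyIntegrable u volume) (U : Set (Euc d)) {C : ℝ≥0∞}
    (hC : ∀ z ∈ Metric.ball (0 : Euc d) ρ.rOut, sqInt U (fun x => u x - u (x - z)) ≤ C) :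
    sqInt U (fun x => u x - moll ρ u x) ≤ C := by
  set w : Euc d → ℝ≥0∞ := fun z => ENNReal.ofReal (ρ.normed volume z) with hw
  have hwm : Measurable w := ρ.continuous_normed.measurable.ennreal_ofReal
  have hw1 : ∫⁻ z, w z = 1 := by
    rw [← ofReal_integral_eq_lintegral_ofReal ρ.integrable_normed
      (Eventually.of_forall fun z => ρ.nonneg_normed z), ρ.integral_normed, ENNReal.ofReal_one]
  have hmp : Measurable fun p : Euc d × Euc d => ‖u p.1 - u (p.1 - p.2)‖ₑ :=
    ((hm.comp_measurable measurable_fst).sub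
      (hm.comp_measurable (measurable_fst.sub measurable_snd))).enorm
  have key : ∀ x, ‖u x - moll ρ u x‖ₑ ^ 2 ≤ ∫⁻ z, w z * ‖u x - u (x - z)‖ₑ ^ 2 := fun x => by
    have h1 : u x - moll ρ u x = ∫ z, ρ.normed volume z • (u x - u (x - z)) := by
      simp_rw [smul_sub]
      rw [integral_sub (ρ.integrable_normed.smul_const _) (integrable_moll ρ hu x),
        integral_smul_const, ρ.integral_normed, one_smul]
      rfl
    have h2 : ‖u x - moll ρ u x‖ₑ ≤ ∫⁻ z, w z * ‖u x - u (x - z)‖ₑ := by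
      rw [h1]
      refine (enorm_integral_le_lintegral_enorm _).trans_eq (lintegral_congr fun z => ?_)
      rw [enorm_smul, Real.enorm_of_nonneg (ρ.nonneg_normed z)]
    exact (by gcongr : _ ≤ (∫⁻ z, w z * ‖u x - u (x - z)‖ₑ) ^ 2).trans
      (sq_lintegral_le hwm (hmp.comp measurable_prodMk_left) hw1)
  calc sqInt U (fun x => u x - moll ρ u x)
      ≤ ∫⁻ x in U, ∫⁻ z, w z * ‖u x - u (x - z)‖ₑ ^ 2 := lintegral_mono key
    _ = ∫⁻ z, ∫⁻ x in U, w z * ‖u x - u (x - z)‖ₑ ^ 2 := by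
        refine lintegral_lintegral_swap (Measurable.aemeasurable ?_)
        exact (hwm.comp measurable_snd).mul (hmp.pow_const 2)
    _ = ∫⁻ z, w z * sqInt U (fun x => u x - u (x - z)) := by
        refine lintegral_congr fun z => ?_
        rw [lintegral_const_mul' _ _ (by simp [hw])]; rfl
    _ ≤ ∫⁻ z, w z * C := by
        refine lintegral_mono fun z => ?_
        by_cases hz : z ∈ Metric.ball (0 : Euc d) ρ.rOut
        · exact mul_le_mul_right (hC z hz) _
        · simp [hw, normed_eq_zero_of_notMem_ball ρ hz]
    _ = C := by rw [lintegral_mul_const _ hwm, hw1, one_mul]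

/-- Continuity of translations in L², read off from the continuous action of the translation group
on `Lp`. -/
theorem exists_sqInt_sub_translate_le {E : Type*} [NormedAddCommGroup E] {u : Euc d → E}
    (hu : MemLp u 2 volume) {ε : ℝ≥0∞} (hε : 0 < ε) :
    ∃ δ > 0, ∀ z ∈ Metric.ball (0 : Euc d) δ, sqInt univ (fun x => u x - u (x - z)) ≤ ε := by
  have : Fact ((2 : ℝ≥0∞) ≠ ⊤) := ⟨by simp⟩
  have hc : Continuous fun z : Euc d => DomAddAct.mk (-z) +ᵥ hu.toLp u :=
    ((DomAddAct.continuous_mk.comp continuous_neg).vadd continuous_const)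
  have h0 : Tendsto (fun z : Euc d => edist (hu.toLp u) (DomAddAct.mk (-z) +ᵥ hu.toLp u) ^ 2)
      (𝓝 0) (𝓝 0) := by
    have h1 : Tendsto (fun z : Euc d => edist (hu.toLp u) (DomAddAct.mk (-z) +ᵥ hu.toLp u))
        (𝓝 0) (𝓝 0) := by
      have := (continuous_const (y := hu.toLp u)).edist hc
      have h2 := this.tendsto 0
      simpa using h2
    have := ENNReal.Tendsto.pow (n := 2) h1
    simpa using this
  obtain ⟨δ, hδ, h⟩ := Metric.eventually_nhds_iff_ball.1 (h0.eventually (gt_mem_nhds hε))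
  refine ⟨δ, hδ, fun z hz => ?_⟩
  have h3 := (h z hz).le
  rw [DomAddAct.mk_vadd_toLp, Lp.edist_toLp_toLp] at h3
  have h4 : (fun x => u x - u (x - z)) = u - fun x => u (-z +ᵥ x) := by
    ext x
    simp [sub_eq_neg_add]
  rwa [sqInt_eq_eLpNorm_sq, Measure.restrict_univ, h4]

theorem moll_eq_zero {E : Type*} [NormedAddCommGroup E] [NormedSpace ℝ E]
    (ρ : ContDiffBump (0 : Euc d)) {u : Euc d → E} {K : Set (Euc d)} (hK : ∀ x ∉ K, u x = 0)
    {x : Euc d} (hx : x ∉ Metric.cthickening ρ.rOut K) : moll ρ u x = 0 := by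
  rw [moll_apply]
  refine integral_eq_zero_of_ae (Eventually.of_forall fun z => ?_)
  by_cases hz : z ∈ Metric.ball (0 : Euc d) ρ.rOut
  · beta_reduce
    rw [hK (x - z) fun h => hx (Metric.mem_cthickening_of_dist_le x (x - z) _ K h ?_)]
    · simp
    · simpa [dist_eq_norm] using (mem_ball_zero_iff.1 hz).le
  · simp [normed_eq_zero_of_notMem_ball ρ hz]

theorem isTestFun_moll (ρ : ContDiffBump (0 : Euc d)) {u : Euc d → ℝ}
    (hu : LocallyIntegrable u volume) {K ω : Set (Euc d)} (hK : IsCompact K)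
    (huK : ∀ x ∉ K, u x = 0) (hω : Metric.cthickening ρ.rOut K ⊆ ω) :
    IsTestFun ω (moll ρ u) := by
  have hsub : tsupport (moll ρ u) ⊆ Metric.cthickening ρ.rOut K :=
    closure_minimal (fun x hx => by_contra fun h => hx (moll_eq_zero ρ huK h))
      Metric.isClosed_cthickening
  refine ⟨?_, ?_, hsub.trans hω⟩
  · exact ρ.hasCompactSupport_normed.contDiff_convolution_left _ ρ.contDiff_normed hu
  · exact hK.cthickening.of_isClosed_subset (isClosed_tsupport _) hsub

theorem norm_moll_sub_le {ζ : Euc d → ℝ} (hc : Continuous ζ) (hs : HasCompactSupport ζ) {η : ℝ}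
    (hη : 0 < η) : ∃ δ > 0, ∀ ρ : ContDiffBump (0 : Euc d), ρ.rOut ≤ δ →
      ∀ x, |moll ρ ζ x - ζ x| ≤ η := by
  obtain ⟨δ, hδ, h⟩ := Metric.uniformContinuous_iff.1
    (hs.uniformContinuous_of_continuous hc) η hη
  refine ⟨δ, hδ, fun ρ hρ x => ?_⟩
  exact ContDiffBump.dist_normed_convolution_le (φ := ρ) hc.aestronglyMeasurable
    fun y hy => (h (lt_of_lt_of_le hy hρ)).le

theorem fderiv_moll_of_contDiff (ρ : ContDiffBump (0 : Euc d)) {ζ : Euc d → ℝ}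
    (hζ : ContDiff ℝ 1 ζ) (hs : HasCompactSupport ζ) (x e : Euc d) :
    fderiv ℝ (moll ρ ζ) x e = moll ρ (fun y => fderiv ℝ ζ y e) x := by
  have hl : LocallyIntegrable (ρ.normed volume) (volume : Measure (Euc d)) :=
    ρ.continuous_normed.locallyIntegrable
  have h := (hs.hasFDerivAt_convolution_right (ContinuousLinearMap.lsmul ℝ ℝ) hl hζ x).fderiv
  have h2 := convolution_precompR_apply (ContinuousLinearMap.lsmul ℝ ℝ) hl (hs.fderiv ℝ)
    (hζ.continuous_fderiv one_ne_zero) x e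
  rw [← h] at h2
  exact h2

/-- Mollifying a compactly supported `C¹` function gives test functions that converge uniformly
together with their derivatives. Admitting such functions in the definition of the weak gradient is
needed for products with a cutoff that is only `C¹`. -/
theorem IsH1Pair.integral_mul_fderiv {ω : Set (Euc d)} (hω : IsOpen ω)
    (hb : Bornology.IsBounded ω) {u : Euc d → ℝ} {G : Euc d → Euc d} (h : IsH1Pair ω u G)
    {ζ : Euc d → ℝ} (hζ : ContDiff ℝ 1 ζ) (hs : HasCompactSupport ζ) (hsω : tsupport ζ ⊆ ω)
    (e : Euc d) : ∫ x in ω, u x * fderiv ℝ ζ x e = -∫ x in ω, inner ℝ (G x) e * ζ x := by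
  have := isFiniteMeasure_restrict_of_isBounded hb
  have hGe := memLp_inner_const h.2.1 e
  have iu : Integrable u (volume.restrict ω) := h.1.integrable (by norm_num)
  have iG : Integrable (fun x => inner ℝ (G x) e) (volume.restrict ω) :=
    hGe.integrable (by norm_num)
  have hdc := continuous_fderiv_apply_of_contDiff hζ e
  have hds := hasCompactSupport_fderiv_apply hs e
  obtain ⟨δ₀, hδ₀, hth⟩ := hs.isCompact.exists_cthickening_subset_open hω hsω
  set M := ∫ x in ω, |u x| with hM
  set N := ∫ x in ω, |inner ℝ (G x) e| with hN
  have hM0 : 0 ≤ M := integral_nonneg fun x => abs_nonneg _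
  have hN0 : 0 ≤ N := integral_nonneg fun x => abs_nonneg _
  rw [eq_neg_iff_add_eq_zero, ← abs_nonpos_iff]
  refine le_of_forall_pos_le_add fun ε hε => ?_
  -- With uniform errors at most `η`, the two integrals change by at most `η * M` and `η * N`; the
  -- extra 1 keeps the denominator positive.
  set η := ε / (M + N + 1) with hη
  have hη0 : 0 < η := by positivity
  obtain ⟨δ₁, hδ₁, h₁⟩ := norm_moll_sub_le hζ.continuous hs hη0
  obtain ⟨δ₂, hδ₂, h₂⟩ := norm_moll_sub_le hdc hds hη0
  have hδ : 0 < min δ₀ (min δ₁ δ₂) := by positivity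
  set ρ : ContDiffBump (0 : Euc d) := mollBump hδ
  have hρ : ρ.rOut = min δ₀ (min δ₁ δ₂) := rfl
  have htest : IsTestFun ω (moll ρ ζ) := isTestFun_moll ρ hζ.continuous.locallyIntegrable
    hs.isCompact (fun x hx => image_eq_zero_of_notMem_tsupport hx)
    ((Metric.cthickening_mono (hρ ▸ min_le_left _ _) _).trans hth)
  have h0 := h.2.2 _ htest e
  have b1 : |∫ x in ω, (u x * fderiv ℝ (moll ρ ζ) x e - u x * fderiv ℝ ζ x e)| ≤ η * M := by
    rw [hM, ← integral_const_mul, ← Real.norm_eq_abs]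
    refine norm_integral_le_of_norm_le (iu.abs.const_mul η) (Eventually.of_forall fun x => ?_)
    rw [← mul_sub, Real.norm_eq_abs, abs_mul, mul_comm, fderiv_moll_of_contDiff ρ hζ hs]
    exact mul_le_mul_of_nonneg_right
      (h₂ ρ (hρ ▸ (min_le_right _ _).trans (min_le_right _ _)) x) (abs_nonneg _)
  have b2 : |∫ x in ω, (inner ℝ (G x) e * moll ρ ζ x - inner ℝ (G x) e * ζ x)| ≤ η * N := by
    rw [hN, ← integral_const_mul, ← Real.norm_eq_abs]
    refine norm_integral_le_of_norm_le (iG.abs.const_mul η) (Eventually.of_forall fun x => ?_)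
    rw [← mul_sub, Real.norm_eq_abs, abs_mul, mul_comm]
    exact mul_le_mul_of_nonneg_right
      (h₁ ρ (hρ ▸ (min_le_right _ _).trans (min_le_left _ _)) x) (abs_nonneg _)
  rw [integral_sub (integrable_mul_of_continuous h.1
    (continuous_fderiv_apply_of_contDiff htest.contDiff_one e)
    (hasCompactSupport_fderiv_apply htest.2.1 e)) (integrable_mul_of_continuous h.1 hdc hds)] at b1
  rw [integral_sub (integrable_mul_of_continuous hGe htest.1.continuous htest.2.1)
    (integrable_mul_of_continuous hGe hζ.continuous hs)] at b2
  have hfin : η * (M + N) ≤ ε := by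
    rw [hη, div_mul_eq_mul_div, div_le_iff₀ (by positivity)]
    nlinarith
  rw [abs_le] at b1 b2 ⊢
  constructor <;> nlinarith [b1.1, b1.2, b2.1, b2.2]

/-! ### Products with `C¹` functions -/

theorem contDiff_mul_testFun {ω : Set (Euc d)} (hω : IsOpen ω) {η φ : Euc d → ℝ}
    (hη : ContDiffOn ℝ 1 η ω) (hφ : IsTestFun ω φ) : ContDiff ℝ 1 (fun x => η x * φ x) := by
  rw [contDiff_iff_contDiffAt]
  intro x
  by_cases hx : x ∈ tsupport φ
  · exact (hη.contDiffAt (hω.mem_nhds (hφ.2.2 hx))).mul hφ.contDiff_one.contDiffAt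
  · have : (fun x => η x * φ x) =ᶠ[𝓝 x] fun _ => 0 := by
      filter_upwards [notMem_tsupport_iff_eventuallyEq.1 hx] with y hy
      simp [hy]
    exact contDiffAt_const.congr_of_eventuallyEq this

theorem aestronglyMeasurable_of_contDiffOn {ω : Set (Euc d)} (hω : IsOpen ω) {η : Euc d → ℝ}
    (hη : ContDiffOn ℝ 1 η ω) : AEStronglyMeasurable η (volume.restrict ω) :=
  hη.continuousOn.aestronglyMeasurable hω.measurableSet

theorem aestronglyMeasurable_cgrad_of_contDiffOn {ω : Set (Euc d)} (hω : IsOpen ω)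
    {η : Euc d → ℝ} (hη : ContDiffOn ℝ 1 η ω) :
    AEStronglyMeasurable (cgrad η) (volume.restrict ω) := by
  refine ContinuousOn.aestronglyMeasurable ?_ hω.measurableSet
  exact (InnerProductSpace.toDual ℝ (Euc d)).symm.continuous.comp_continuousOn
    (hη.continuousOn_fderiv_of_isOpen hω le_rfl)

theorem memLp_smul_of_bound {E : Type*} [NormedAddCommGroup E] [NormedSpace ℝ E]
    {ω : Set (Euc d)} (hω : IsOpen ω) {η : Euc d → ℝ}
    (hm : AEStronglyMeasurable η (volume.restrict ω)) {C : ℝ} (hC : ∀ x ∈ ω, |η x| ≤ C)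
    {G : Euc d → E} (hG : MemLp G 2 (volume.restrict ω)) :
    MemLp (fun x => η x • G x) 2 (volume.restrict ω) :=
  hG.of_le_mul (c := C) (hm.smul hG.1) <| by
    filter_upwards [ae_restrict_mem hω.measurableSet] with x hx
    rw [norm_smul, Real.norm_eq_abs]
    exact mul_le_mul_of_nonneg_right (hC x hx) (norm_nonneg _)

theorem memLp_smul_field_of_bound {ω : Set (Euc d)} (hω : IsOpen ω) {F : Euc d → Euc d}
    (hm : AEStronglyMeasurable F (volume.restrict ω)) {C : ℝ} (hC : ∀ x ∈ ω, ‖F x‖ ≤ C)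
    {u : Euc d → ℝ} (hu : MemLp u 2 (volume.restrict ω)) :
    MemLp (fun x => u x • F x) 2 (volume.restrict ω) :=
  hu.of_le_mul (c := C) (hu.1.smul hm) <| by
    filter_upwards [ae_restrict_mem hω.measurableSet] with x hx
    rw [norm_smul, mul_comm]
    exact mul_le_mul_of_nonneg_right (hC x hx) (norm_nonneg _)

/-- The product rule follows by inserting the `C¹` function `η φ` in the identity defining the weak
gradient of `u` and expanding its derivative. -/
theorem IsH1Pair.contDiffOn_mul {ω : Set (Euc d)} (hω : IsOpen ω)
    (hb : Bornology.IsBounded ω) {u : Euc d → ℝ} {G : Euc d → Euc d} (h : IsH1Pair ω u G)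
    {η : Euc d → ℝ} (hη : ContDiffOn ℝ 1 η ω) {C C' : ℝ} (hC : ∀ x ∈ ω, |η x| ≤ C)
    (hC' : ∀ x ∈ ω, ‖fderiv ℝ η x‖ ≤ C') :
    IsH1Pair ω (η * u) (fun x => η x • G x + u x • cgrad η x) := by
  have hm := aestronglyMeasurable_of_contDiffOn hω hη
  have m1 : MemLp (η * u) 2 (volume.restrict ω) := memLp_smul_of_bound hω hm hC h.1
  have m2 := memLp_smul_of_bound hω hm hC h.2.1
  have m3 := memLp_smul_field_of_bound hω (aestronglyMeasurable_cgrad_of_contDiffOn hω hη)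
    (fun x hx => (norm_cgrad η x).trans_le (hC' x hx)) h.1
  refine ⟨m1, m2.add m3, fun φ hφ e => ?_⟩
  have hζ := contDiff_mul_testFun hω hη hφ
  have hζs : HasCompactSupport (fun x => η x * φ x) := hφ.2.1.mul_left
  have hsub : tsupport (fun x => η x * φ x) ⊆ tsupport φ :=
    closure_mono fun x hx => right_ne_zero_of_mul hx
  have key := h.integral_mul_fderiv hω hb hζ hζs (hsub.trans hφ.2.2) e
  have e1 : ∫ x in ω, u x * fderiv ℝ (fun x => η x * φ x) x e
      = ∫ x in ω, ((η * u) x * fderiv ℝ φ x e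
        + inner ℝ (u x • cgrad η x) e * φ x) := by
    refine setIntegral_congr_fun hω.measurableSet fun x hx => ?_
    have := fderiv_fun_mul ((hη.differentiableOn one_ne_zero).differentiableAt (hω.mem_nhds hx))
      (hφ.contDiff_one.differentiable one_ne_zero x)
    simp only [this, Pi.mul_apply, inner_smul_left, inner_cgrad, RCLike.conj_to_real,
      add_apply, smul_apply, smul_eq_mul]
    ring
  have i3 := integrable_mul_of_continuous (memLp_inner_const m3 e) hφ.1.continuous hφ.2.1
  rw [e1, integral_add (integrable_mul_of_continuous m1
    (continuous_fderiv_apply_of_contDiff hφ.contDiff_one e)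
    (hasCompactSupport_fderiv_apply hφ.2.1 e)) i3] at key
  have e2 : ∀ x, inner ℝ (η x • G x + u x • cgrad η x) e * φ x
      = inner ℝ (G x) e * (η x * φ x) + inner ℝ (u x • cgrad η x) e * φ x := fun x => by
    rw [inner_add_left, inner_smul_left, RCLike.conj_to_real]; ring
  have i4 := integrable_mul_of_continuous (memLp_inner_const h.2.1 e) hζ.continuous hζs
  beta_reduce
  simp_rw [e2]
  rw [integral_add i4 i3]
  linarith

theorem IsTestFun.isH1Pair {ω : Set (Euc d)} {φ : Euc d → ℝ} (hφ : IsTestFun ω φ)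
    (ω' : Set (Euc d)) (hω : IsOpen ω') (hb : Bornology.IsBounded ω') :
    IsH1Pair ω' φ (cgrad φ) := by
  obtain ⟨C, hC⟩ := hφ.1.continuous.bounded_above_of_compact_support hφ.2.1
  obtain ⟨C', hC'⟩ := (hφ.contDiff_one.continuous_fderiv one_ne_zero).bounded_above_of_compact_support
    (hφ.2.1.fderiv ℝ)
  refine ((isH1Pair_const hb 1).contDiffOn_mul hω hb hφ.contDiff_one.contDiffOn
    (fun x _ => hC x) (fun x _ => hC' x)).congr ?_ ?_
  · exact Eventually.of_forall fun x => by simp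
  · exact Eventually.of_forall fun x => by simp

/-! ### The Cauchy–Schwarz inequality and closedness of weak gradients -/

theorem norm_toLp_eq {E : Type*} [NormedAddCommGroup E] {ω : Set (Euc d)} {F : Euc d → E}
    (hF : MemLp F 2 (volume.restrict ω)) : ‖hF.toLp F‖ = √(sqInt ω F).toReal := by
  rw [Lp.norm_toLp, sqInt_eq_eLpNorm_sq, ENNReal.toReal_pow, Real.sqrt_sq ENNReal.toReal_nonneg]

theorem inner_toLp_eq {E : Type*} [NormedAddCommGroup E] [InnerProductSpace ℝ E]
    {ω : Set (Euc d)} {F H : Euc d → E} (hF : MemLp F 2 (volume.restrict ω))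
    (hH : MemLp H 2 (volume.restrict ω)) :
    inner ℝ (hF.toLp F) (hH.toLp H) = ∫ x in ω, inner ℝ (F x) (H x) := by
  rw [L2.inner_def]
  refine integral_congr_ae ?_
  filter_upwards [hF.coeFn_toLp, hH.coeFn_toLp] with x h1 h2
  rw [h1, h2]

theorem integrable_inner {E : Type*} [NormedAddCommGroup E] [InnerProductSpace ℝ E]
    {ω : Set (Euc d)} {F H : Euc d → E} (hF : MemLp F 2 (volume.restrict ω))
    (hH : MemLp H 2 (volume.restrict ω)) :
    Integrable (fun x => inner ℝ (F x) (H x)) (volume.restrict ω) := by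
  refine (L2.integrable_inner (𝕜 := ℝ) (hF.toLp F) (hH.toLp H)).congr ?_
  filter_upwards [hF.coeFn_toLp, hH.coeFn_toLp] with x h1 h2
  rw [h1, h2]

theorem abs_integral_inner_le {E : Type*} [NormedAddCommGroup E] [InnerProductSpace ℝ E]
    {ω : Set (Euc d)} {F H : Euc d → E} (hF : MemLp F 2 (volume.restrict ω))
    (hH : MemLp H 2 (volume.restrict ω)) :
    |∫ x in ω, inner ℝ (F x) (H x)| ≤ √(sqInt ω F).toReal * √(sqInt ω H).toReal := by
  rw [← inner_toLp_eq hF hH, ← norm_toLp_eq hF, ← norm_toLp_eq hH]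
  exact abs_real_inner_le_norm _ _

theorem abs_integral_mul_le {ω : Set (Euc d)} {F H : Euc d → ℝ}
    (hF : MemLp F 2 (volume.restrict ω)) (hH : MemLp H 2 (volume.restrict ω)) :
    |∫ x in ω, F x * H x| ≤ √(sqInt ω F).toReal * √(sqInt ω H).toReal := by
  have := abs_integral_inner_le hF hH
  simpa [mul_comm] using this

/-- The graph of the weak gradient is closed in L², since both sides of its defining identity are
L²-continuous by Cauchy–Schwarz. -/
theorem IsH1Pair.of_approx {ω : Set (Euc d)} {u : Euc d → ℝ}
    {G : Euc d → Euc d} (hu : MemLp u 2 (volume.restrict ω)) (hG : MemLp G 2 (volume.restrict ω))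
    (h : ∀ ε : ℝ, 0 < ε → ∃ u' G', IsH1Pair ω u' G' ∧
      sqInt ω (u - u') ≤ ENNReal.ofReal ε ∧ sqInt ω (G - G') ≤ ENNReal.ofReal ε) :
    IsH1Pair ω u G := by
  refine ⟨hu, hG, fun φ hφ e => ?_⟩
  have hdc := continuous_fderiv_apply_of_contDiff hφ.contDiff_one e
  have hds := hasCompactSupport_fderiv_apply hφ.2.1 e
  have m1 := memLp_restrict_of_continuous (ω := ω) hdc hds
  have m2 : MemLp (fun x => φ x • e) 2 (volume.restrict ω) :=
    memLp_restrict_of_continuous (hφ.1.continuous.smul continuous_const) hφ.2.1.smul_right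
  set M := √(sqInt ω (fun x => fderiv ℝ φ x e)).toReal
  set N := √(sqInt ω (fun x => φ x • e)).toReal
  have hM : 0 ≤ M := Real.sqrt_nonneg _
  have hN : 0 ≤ N := Real.sqrt_nonneg _
  rw [eq_neg_iff_add_eq_zero, ← abs_nonpos_iff]
  refine le_of_forall_pos_le_add fun ε hε => ?_
  set η := ε / (M + N + 1) with hη
  have hη0 : 0 < η := by positivity
  obtain ⟨u', G', hp, h1, h2⟩ := h (η ^ 2) (by positivity)
  have r1 : √(sqInt ω (u - u')).toReal ≤ η :=
    Real.sqrt_le_iff.2 ⟨hη0.le, ENNReal.toReal_le_of_le_ofReal (by positivity) h1⟩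
  have r2 : √(sqInt ω (G - G')).toReal ≤ η :=
    Real.sqrt_le_iff.2 ⟨hη0.le, ENNReal.toReal_le_of_le_ofReal (by positivity) h2⟩
  have b1 := (abs_integral_mul_le (hu.sub hp.1) m1).trans (mul_le_mul_of_nonneg_right r1 hM)
  have b2 := (abs_integral_inner_le (hG.sub hp.2.1) m2).trans (mul_le_mul_of_nonneg_right r2 hN)
  have e2 : ∀ x, inner ℝ ((G - G') x) (φ x • e)
      = inner ℝ (G x) e * φ x - inner ℝ (G' x) e * φ x := fun x => by
    rw [Pi.sub_apply, inner_smul_right, inner_sub_left]; ring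
  simp_rw [e2] at b2
  simp only [Pi.sub_apply, sub_mul] at b1
  rw [integral_sub (integrable_mul_of_continuous hu hdc hds)
    (integrable_mul_of_continuous hp.1 hdc hds)] at b1
  rw [integral_sub (integrable_mul_of_continuous (memLp_inner_const hG e) hφ.1.continuous hφ.2.1)
    (integrable_mul_of_continuous (memLp_inner_const hp.2.1 e) hφ.1.continuous hφ.2.1)] at b2
  have h0 := hp.2.2 φ hφ e
  have hfin : η * (M + N) ≤ ε := by
    rw [hη, div_mul_eq_mul_div, div_le_iff₀ (by positivity)]
    nlinarith
  rw [abs_le] at b1 b2 ⊢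
  constructor <;> nlinarith [b1.1, b1.2, b2.1, b2.2]

/-! ### The space `H¹₀` -/

/-- A form of the definition that works with any weak gradient and with squared norms in `ℝ≥0∞`,
where no integrability has to be carried along. -/
theorem inH10_iff {ω : Set (Euc d)} (hω : IsOpen ω) (hb : Bornology.IsBounded ω)
    {u : Euc d → ℝ} {G : Euc d → Euc d} (h : IsH1Pair ω u G) :
    InH10 ω u ↔ ∀ ε : ℝ, 0 < ε → ∃ φ, IsTestFun ω φ ∧
      sqInt ω (u - φ) + sqInt ω (G - cgrad φ) ≤ ENNReal.ofReal ε := by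
  constructor
  · rintro ⟨-, h2⟩ ε hε
    obtain ⟨φ, hφ, hlt⟩ := h2 (√ε) (Real.sqrt_pos.2 hε)
    refine ⟨φ, hφ, ?_⟩
    rw [← (h.sub (hφ.isH1Pair ω hω hb)).ofReal_h1Norm_sq hω]
    refine ENNReal.ofReal_le_ofReal ?_
    calc h1Norm ω (u - φ) ^ 2 ≤ √ε ^ 2 := by
          gcongr
          exact Real.sqrt_nonneg _
      _ = ε := Real.sq_sqrt hε.le
  · refine fun h2 => ⟨h.inH1, fun ε hε => ?_⟩
    obtain ⟨φ, hφ, hle⟩ := h2 ((ε / 2) ^ 2) (by positivity)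
    refine ⟨φ, hφ, ?_⟩
    rw [← (h.sub (hφ.isH1Pair ω hω hb)).ofReal_h1Norm_sq hω,
      ENNReal.ofReal_le_ofReal_iff (by positivity)] at hle
    have := abs_le_of_sq_le_sq' hle (by positivity)
    linarith [this.2]

theorem inH10_of_approx {ω : Set (Euc d)} (hω : IsOpen ω) (hb : Bornology.IsBounded ω)
    {u : Euc d → ℝ} {G : Euc d → Euc d} (h : IsH1Pair ω u G)
    (happ : ∀ ε : ℝ, 0 < ε → ∃ u' G', IsH1Pair ω u' G' ∧ InH10 ω u' ∧
      sqInt ω (u - u') ≤ ENNReal.ofReal ε ∧ sqInt ω (G - G') ≤ ENNReal.ofReal ε) :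
    InH10 ω u := by
  refine (inH10_iff hω hb h).2 fun ε hε => ?_
  -- Each of the three error terms is doubled by the squared triangle inequality, so the total is at
  -- most `6 * ε / 8`.
  obtain ⟨u', G', hp, h0, h1, h2⟩ := happ (ε / 8) (by positivity)
  obtain ⟨φ, hφ, h3⟩ := (inH10_iff hω hb hp).1 h0 (ε / 8) (by positivity)
  refine ⟨φ, hφ, ?_⟩
  have e1 : u - φ = (u - u') + (u' - φ) := by abel
  have e2 : G - cgrad φ = (G - G') + (G' - cgrad φ) := by abel
  have b1 := sqInt_add_le (v := u' - φ) (h.1.sub hp.1).1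
  have b2 := sqInt_add_le (v := G' - cgrad φ) (h.2.1.sub hp.2.1).1
  rw [← e1] at b1
  rw [← e2] at b2
  calc sqInt ω (u - φ) + sqInt ω (G - cgrad φ)
      ≤ (2 * sqInt ω (u - u') + 2 * sqInt ω (u' - φ))
        + (2 * sqInt ω (G - G') + 2 * sqInt ω (G' - cgrad φ)) := add_le_add b1 b2
    _ = 2 * sqInt ω (u - u') + 2 * sqInt ω (G - G')
        + 2 * (sqInt ω (u' - φ) + sqInt ω (G' - cgrad φ)) := by ring
    _ ≤ 2 * ENNReal.ofReal (ε / 8) + 2 * ENNReal.ofReal (ε / 8)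
        + 2 * ENNReal.ofReal (ε / 8) := by gcongr
    _ ≤ ENNReal.ofReal ε := by
        rw [show (2 : ℝ≥0∞) = ENNReal.ofReal 2 by simp, ← ENNReal.ofReal_mul (by norm_num),
          ← ENNReal.ofReal_add (by positivity) (by positivity),
          ← ENNReal.ofReal_add (by positivity) (by positivity)]
        exact ENNReal.ofReal_le_ofReal (by linarith)

theorem InH10.congr {ω : Set (Euc d)} (hω : IsOpen ω) (hb : Bornology.IsBounded ω)
    {u u' : Euc d → ℝ} (h : InH10 ω u) (he : u =ᵐ[volume.restrict ω] u') : InH10 ω u' := by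
  have hp := h.1.isH1Pair
  refine (inH10_iff hω hb (hp.congr he (ae_eq_refl _))).2 fun ε hε => ?_
  obtain ⟨φ, hφ, h1⟩ := (inH10_iff hω hb hp).1 h ε hε
  refine ⟨φ, hφ, ?_⟩
  rwa [← sqInt_congr (u := u - φ) (v := u' - φ) (he.sub (ae_eq_refl _))]

theorem sqInt_indicator {E : Type*} [NormedAddCommGroup E] {ω ω' : Set (Euc d)}
    (hω : MeasurableSet ω) (hs : ω ⊆ ω') (u : Euc d → E) :
    sqInt ω' (ω.indicator u) = sqInt ω u := by
  have : ∀ x, ‖ω.indicator u x‖ₑ ^ 2 = ω.indicator (fun x => ‖u x‖ₑ ^ 2) x := fun x => by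
    by_cases hx : x ∈ ω <;> simp [hx]
  simp only [sqInt, this]
  rw [setLIntegral_indicator hω, inter_eq_left.2 hs]

theorem memLp_indicator {E : Type*} [NormedAddCommGroup E] {ω ω' : Set (Euc d)}
    (hω : MeasurableSet ω) {u : Euc d → E} (hu : MemLp u 2 (volume.restrict ω)) :
    MemLp (ω.indicator u) 2 (volume.restrict ω') :=
  ((memLp_indicator_iff_restrict hω).2 hu).restrict ω'

theorem IsTestFun.indicator_eq {ω : Set (Euc d)} {φ : Euc d → ℝ} (hφ : IsTestFun ω φ) :
    ω.indicator φ = φ :=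
  indicator_eq_self.2 ((subset_tsupport φ).trans hφ.2.2)

theorem IsTestFun.indicator_cgrad_eq {ω : Set (Euc d)} {φ : Euc d → ℝ} (hφ : IsTestFun ω φ) :
    ω.indicator (cgrad φ) = cgrad φ := by
  refine indicator_eq_self.2 fun x hx => by_contra fun hxω => hx ?_
  rw [cgrad, fderiv_of_notMem_tsupport ℝ fun h => hxω (hφ.2.2 h), map_zero]

/-- Extension by zero of functions in `H¹₀`. -/
theorem InH10.extend {ω ω' : Set (Euc d)} (hω : IsOpen ω) (hb : Bornology.IsBounded ω)
    (hω' : IsOpen ω') (hb' : Bornology.IsBounded ω') (hs : ω ⊆ ω')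
    {u : Euc d → ℝ} {G : Euc d → Euc d} (h0 : InH10 ω u) (h : IsH1Pair ω u G) :
    IsH1Pair ω' (ω.indicator u) (ω.indicator G) ∧ InH10 ω' (ω.indicator u) := by
  have key : ∀ ε : ℝ, 0 < ε → ∃ φ, IsTestFun ω φ ∧
      sqInt ω' (ω.indicator u - φ) + sqInt ω' (ω.indicator G - cgrad φ)
        ≤ ENNReal.ofReal ε := fun ε hε => by
    obtain ⟨φ, hφ, h1⟩ := (inH10_iff hω hb h).1 h0 ε hε
    refine ⟨φ, hφ, ?_⟩
    rw [← hφ.indicator_eq, ← indicator_sub', sqInt_indicator hω.measurableSet hs,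
      hφ.indicator_eq, ← hφ.indicator_cgrad_eq, ← indicator_sub',
      sqInt_indicator hω.measurableSet hs]
    exact h1
  have hp : IsH1Pair ω' (ω.indicator u) (ω.indicator G) :=
    IsH1Pair.of_approx (memLp_indicator hω.measurableSet h.1)
      (memLp_indicator hω.measurableSet h.2.1) fun ε hε => by
    obtain ⟨φ, hφ, h1⟩ := key ε hε
    exact ⟨φ, cgrad φ, hφ.isH1Pair ω' hω' hb', le_self_add.trans h1, le_add_self.trans h1⟩
  refine ⟨hp, (inH10_iff hω' hb' hp).2 fun ε hε => ?_⟩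
  obtain ⟨φ, hφ, h1⟩ := key ε hε
  exact ⟨φ, hφ.mono hs, h1⟩

/-! ### Compactly supported `H¹` functions belong to `H¹₀`. -/

theorem fderiv_moll (ρ : ContDiffBump (0 : Euc d)) {w : Euc d → ℝ}
    (hw : LocallyIntegrable w volume) (x e : Euc d) :
    fderiv ℝ (moll ρ w) x e = ∫ y, w y * fderiv ℝ (ρ.normed volume) (x - y) e := by
  have hsm : ContDiff ℝ 1 (ρ.normed (volume : Measure (Euc d))) := ρ.contDiff_normed
  have hL := ρ.hasCompactSupport_normed (μ := (volume : Measure (Euc d)))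
  have h0 : moll ρ w = convolution w (ρ.normed volume)
      (ContinuousLinearMap.lsmul ℝ ℝ).flip volume := by
    ext y
    rw [convolution_flip]
    rfl
  have h := (hL.hasFDerivAt_convolution_right (ContinuousLinearMap.lsmul ℝ ℝ).flip hw hsm x).fderiv
  have h2 := convolution_precompR_apply (ContinuousLinearMap.lsmul ℝ ℝ).flip hw (hL.fderiv ℝ)
    (hsm.continuous_fderiv one_ne_zero) x e
  rw [← h, ← h0] at h2
  rw [h2, convolution_def]
  refine integral_congr_ae (Eventually.of_forall fun y => ?_)
  simp [mul_comm]

theorem isTestFun_normed_sub (ρ : ContDiffBump (0 : Euc d)) {x : Euc d} {ω : Set (Euc d)}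
    (h : Metric.closedBall x ρ.rOut ⊆ ω) :
    IsTestFun ω fun y => ρ.normed volume (x - y) := by
  have hsub : tsupport (fun y => ρ.normed volume (x - y)) ⊆ Metric.closedBall x ρ.rOut := by
    refine closure_minimal (fun y hy => by_contra fun hn => hy ?_) Metric.isClosed_closedBall
    refine normed_eq_zero_of_notMem_ball ρ fun hb => hn ?_
    rw [Metric.mem_closedBall, dist_comm, dist_eq_norm]
    exact (mem_ball_zero_iff.1 hb).le
  exact ⟨ρ.contDiff_normed.comp (contDiff_const.sub contDiff_id),
    (isCompact_closedBall x _).of_isClosed_subset (isClosed_tsupport _) hsub, hsub.trans h⟩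

theorem fderiv_normed_sub (ρ : ContDiffBump (0 : Euc d)) (x y e : Euc d) :
    fderiv ℝ (fun y => ρ.normed volume (x - y)) y e
      = -fderiv ℝ (ρ.normed (volume : Measure (Euc d))) (x - y) e := by
  have hd : DifferentiableAt ℝ (ρ.normed (volume : Measure (Euc d))) (x - y) :=
    (ρ.contDiff_normed (n := 1)).differentiable (by norm_num) _
  have h := hd.hasFDerivAt.comp y ((hasFDerivAt_const x y).sub (hasFDerivAt_id y))
  have h' : HasFDerivAt (fun y => ρ.normed volume (x - y)) _ y := h
  rw [h'.fderiv]
  simp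

theorem locallyIntegrable_of_memLp {E : Type*} [NormedAddCommGroup E] {u : Euc d → E}
    (hu : MemLp u 2 volume) : LocallyIntegrable u volume :=
  hu.locallyIntegrable (by norm_num)

/-- If `x` is within the kernel radius of `K`, the doubled thickening ensures that the kernel
centred at `x` is a test function on `ω`, and the weak gradient identity applies to it. Otherwise
both sides vanish. -/
theorem IsH1Pair.cgrad_moll {ω : Set (Euc d)} {w : Euc d → ℝ} {G : Euc d → Euc d}
    (h : IsH1Pair ω w G) {K : Set (Euc d)} (hKω : K ⊆ ω)
    (hwK : ∀ x ∉ K, w x = 0) (hGK : ∀ x ∉ K, G x = 0)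
    (hw : LocallyIntegrable w volume) (hG : LocallyIntegrable G volume)
    (ρ : ContDiffBump (0 : Euc d)) (hρ : Metric.cthickening (2 * ρ.rOut) K ⊆ ω) (x : Euc d) :
    cgrad (moll ρ w) x = moll ρ G x := by
  refine cgrad_eq fun e => ?_
  have hi : Integrable (fun y => ρ.normed volume (x - y) • G y) := by
    have := (integrable_moll ρ hG x).comp_sub_left x
    simpa using this
  rw [fderiv_moll ρ hw, moll_apply', real_inner_comm, ← integral_inner hi]
  by_cases hx : ∃ y ∈ K, y ∈ Metric.closedBall x ρ.rOut
  · obtain ⟨y, hyK, hy⟩ := hx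
    have hsub : Metric.closedBall x ρ.rOut ⊆ ω := fun z hz => hρ <| by
      refine Metric.mem_cthickening_of_dist_le z y _ K hyK ?_
      have := dist_triangle_right z y x
      rw [Metric.mem_closedBall] at hz hy
      linarith
    have h1 := h.2.2 _ (isTestFun_normed_sub ρ hsub) e
    rw [setIntegral_eq_integral_of_forall_compl_eq_zero
        (fun z hz => by rw [hwK z fun hzK => hz (hKω hzK), zero_mul]),
      setIntegral_eq_integral_of_forall_compl_eq_zero
        (fun z hz => by rw [hGK z fun hzK => hz (hKω hzK), inner_zero_left, zero_mul])] at h1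
    simp only [fderiv_normed_sub, mul_neg, integral_neg, neg_inj] at h1
    rw [h1]
    refine integral_congr_ae (Eventually.of_forall fun z => ?_)
    simp only [inner_smul_right, real_inner_comm e]
    ring
  · push Not at hx
    have hz : ∀ z, z ∈ K → ρ.normed volume (x - z) = 0 := fun z hz =>
      normed_eq_zero_of_notMem_ball ρ fun hb => hx z hz <| by
        rw [Metric.mem_closedBall, dist_comm, dist_eq_norm]
        exact (mem_ball_zero_iff.1 hb).le
    have hz' : ∀ z, z ∈ K → fderiv ℝ (ρ.normed (volume : Measure (Euc d))) (x - z) e = 0 :=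
      fun z hz => by
        rw [fderiv_of_notMem_tsupport ℝ]
        · rfl
        · rw [ρ.tsupport_normed_eq]
          intro hb
          refine hx z hz ?_
          rw [Metric.mem_closedBall, dist_comm, dist_eq_norm]
          exact mem_closedBall_zero_iff.1 hb
    rw [integral_eq_zero_of_ae, integral_eq_zero_of_ae]
    · refine Eventually.of_forall fun z => ?_
      by_cases hzK : z ∈ K
      · simp [hz z hzK]
      · simp [hGK z hzK]
    · refine Eventually.of_forall fun z => ?_
      by_cases hzK : z ∈ K
      · simp [hz' z hzK]
      · simp [hwK z hzK]

/-- Mollifications with small radius are test functions on `ω`, and they converge together with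
their gradients because mollification commutes with the weak gradient here. -/
theorem inH10_of_isCompact {ω : Set (Euc d)} (hω : IsOpen ω) (hb : Bornology.IsBounded ω)
    {w : Euc d → ℝ} {G : Euc d → Euc d} (h : IsH1Pair ω w G) {K : Set (Euc d)}
    (hK : IsCompact K) (hKω : K ⊆ ω) (hwK : ∀ x ∉ K, w x = 0) (hGK : ∀ x ∉ K, G x = 0) :
    InH10 ω w := by
  -- Only values on `ω` up to null sets are controlled by the hypotheses; these representatives are
  -- measurable on the whole space and vanish everywhere off `K`, so they can be translated and
  -- mollified.
  set w' := K.indicator (h.1.1.mk w) with hw'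
  set G' := K.indicator (h.2.1.1.mk G) with hG'
  have hwe : w =ᵐ[volume.restrict ω] w' := by
    filter_upwards [h.1.1.ae_eq_mk] with x hx
    by_cases hxK : x ∈ K
    · simp [hw', hxK, hx]
    · simp [hw', hxK, hwK x hxK]
  have hGe : G =ᵐ[volume.restrict ω] G' := by
    filter_upwards [h.2.1.1.ae_eq_mk] with x hx
    by_cases hxK : x ∈ K
    · simp [hG', hxK, hx]
    · simp [hG', hxK, hGK x hxK]
  have hp : IsH1Pair ω w' G' := h.congr hwe hGe
  have hwm : StronglyMeasurable w' := h.1.1.stronglyMeasurable_mk.indicator hK.measurableSet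
  have hGm : StronglyMeasurable G' := h.2.1.1.stronglyMeasurable_mk.indicator hK.measurableSet
  have hwK' : ∀ x ∉ K, w' x = 0 := fun x hx => by simp [hw', hx]
  have hGK' : ∀ x ∉ K, G' x = 0 := fun x hx => by simp [hG', hx]
  have hwL : MemLp w' 2 volume := by
    have := memLp_indicator (ω' := univ) hω.measurableSet hp.1
    rw [Measure.restrict_univ] at this
    rwa [indicator_eq_self.2 fun x hx => hKω (by_contra fun hn => hx (hwK' x hn))] at this
  have hGL : MemLp G' 2 volume := by
    have := memLp_indicator (ω' := univ) hω.measurableSet hp.2.1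
    rw [Measure.restrict_univ] at this
    rwa [indicator_eq_self.2 fun x hx => hKω (by_contra fun hn => hx (hGK' x hn))] at this
  refine InH10.congr hω hb ((inH10_iff hω hb hp).2 fun ε hε => ?_) hwe.symm
  have hε2 : 0 < ENNReal.ofReal (ε / 2) := ENNReal.ofReal_pos.2 (by positivity)
  obtain ⟨δ₀, hδ₀, hth⟩ := hK.exists_cthickening_subset_open hω hKω
  obtain ⟨δ₁, hδ₁, h₁⟩ := exists_sqInt_sub_translate_le hwL hε2
  obtain ⟨δ₂, hδ₂, h₂⟩ := exists_sqInt_sub_translate_le hGL hε2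
  have hδ : 0 < min (δ₀ / 2) (min δ₁ δ₂) := by positivity
  set ρ : ContDiffBump (0 : Euc d) := mollBump hδ
  have hρ : ρ.rOut = min (δ₀ / 2) (min δ₁ δ₂) := rfl
  have hρ0 : 2 * ρ.rOut ≤ δ₀ := by
    have := min_le_left (δ₀ / 2) (min δ₁ δ₂)
    rw [hρ]; linarith
  have hth2 : Metric.cthickening (2 * ρ.rOut) K ⊆ ω :=
    (Metric.cthickening_mono hρ0 _).trans hth
  have hth1 : Metric.cthickening ρ.rOut K ⊆ ω :=
    (Metric.cthickening_mono (by linarith [ρ.rOut_pos]) _).trans hth2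
  refine ⟨moll ρ w', isTestFun_moll ρ (locallyIntegrable_of_memLp hwL) hK hwK' hth1, ?_⟩
  have e : cgrad (moll ρ w') = moll ρ G' := funext fun x =>
    hp.cgrad_moll hKω hwK' hGK' (locallyIntegrable_of_memLp hwL)
      (locallyIntegrable_of_memLp hGL) ρ hth2 x
  have b1 := sqInt_sub_moll_le ρ hwm (locallyIntegrable_of_memLp hwL) univ
    (C := ENNReal.ofReal (ε / 2)) fun z hz => h₁ z <| Metric.ball_subset_ball
      (hρ ▸ (min_le_right _ _).trans (min_le_left _ _)) hz
  have b2 := sqInt_sub_moll_le ρ hGm (locallyIntegrable_of_memLp hGL) univ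
    (C := ENNReal.ofReal (ε / 2)) fun z hz => h₂ z <| Metric.ball_subset_ball
      (hρ ▸ (min_le_right _ _).trans (min_le_right _ _)) hz
  rw [e]
  calc sqInt ω (w' - moll ρ w') + sqInt ω (G' - moll ρ G')
      ≤ ENNReal.ofReal (ε / 2) + ENNReal.ofReal (ε / 2) :=
        add_le_add ((sqInt_mono_set (subset_univ _) _).trans b1)
          ((sqInt_mono_set (subset_univ _) _).trans b2)
    _ = ENNReal.ofReal ε := by
        rw [← ENNReal.ofReal_add (by positivity) (by positivity), add_halves]

/-! ### Multiplication by a cutoff function -/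

theorem tendsto_sqInt_of_dominated {E : Type*} [NormedAddCommGroup E] {ω : Set (Euc d)}
    {F : ℕ → Euc d → E} {b : Euc d → ℝ} (hF : ∀ k, AEStronglyMeasurable (F k) (volume.restrict ω))
    (hb : MemLp b 2 (volume.restrict ω)) (hFb : ∀ k, ∀ᵐ x ∂volume.restrict ω, ‖F k x‖ ≤ ‖b x‖)
    (h0 : ∀ᵐ x ∂volume.restrict ω, Tendsto (fun k => F k x) atTop (𝓝 0)) :
    Tendsto (fun k => sqInt ω (F k)) atTop (𝓝 0) := by
  have := tendsto_lintegral_of_dominated_convergence' (μ := volume.restrict ω)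
    (F := fun k x => ‖F k x‖ₑ ^ 2) (f := fun _ => 0) (fun x => ‖b x‖ₑ ^ 2)
    (fun k => (hF k).enorm.pow_const 2) (fun k => by
      filter_upwards [hFb k] with x hx
      gcongr
      exact enorm_le_iff_norm_le.2 hx) (sqInt_lt_top hb).ne (by
      filter_upwards [h0] with x hx
      have h1 : Tendsto (fun k => ‖F k x‖ₑ) atTop (𝓝 0) := by simpa using hx.enorm
      have := ENNReal.Tendsto.pow (n := 2) h1
      simpa using this)
  simpa [sqInt] using this

/-- A smooth function vanishing near zero and equal to the identity for large arguments. -/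
def smoothCut (s : ℝ) : ℝ := s * Real.smoothTransition (s - 1)

theorem contDiff_smoothCut : ContDiff ℝ 1 smoothCut :=
  contDiff_id.mul (Real.smoothTransition.contDiff.comp (contDiff_id.sub contDiff_const))

theorem smoothCut_of_le {s : ℝ} (h : s ≤ 1) : smoothCut s = 0 := by
  rw [smoothCut, Real.smoothTransition.zero_of_nonpos (by linarith), mul_zero]

theorem smoothCut_of_ge {s : ℝ} (h : 2 ≤ s) : smoothCut s = s := by
  rw [smoothCut, Real.smoothTransition.one_of_one_le (by linarith), mul_one]

theorem smoothCut_nonneg {s : ℝ} (h : 0 ≤ s) : 0 ≤ smoothCut s :=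
  mul_nonneg h (Real.smoothTransition.nonneg _)

theorem smoothCut_le {s : ℝ} (h : 0 ≤ s) : smoothCut s ≤ s :=
  mul_le_of_le_one_right h (Real.smoothTransition.le_one _)

theorem deriv_smoothCut_of_gt {s : ℝ} (h : 2 < s) : deriv smoothCut s = 1 := by
  have : smoothCut =ᶠ[𝓝 s] id := by
    filter_upwards [lt_mem_nhds h] with t ht using smoothCut_of_ge (le_of_lt ht)
  rw [this.deriv_eq, deriv_id]

theorem deriv_smoothCut_of_lt {s : ℝ} (h : s < 1) : deriv smoothCut s = 0 := by
  have : smoothCut =ᶠ[𝓝 s] fun _ => 0 := by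
    filter_upwards [gt_mem_nhds h] with t ht using smoothCut_of_le (le_of_lt ht)
  rw [this.deriv_eq, deriv_const]

/-- The derivative is 0 below 1 and equals 1 above 2, so only the compact interval between them
matters. -/
theorem exists_deriv_smoothCut_bound : ∃ M : ℝ, 1 ≤ M ∧ ∀ s, |deriv smoothCut s| ≤ M := by
  obtain ⟨M, hM⟩ := (isCompact_Icc (a := (1 : ℝ)) (b := 2)).exists_bound_of_continuousOn
    (contDiff_smoothCut.continuous_deriv le_rfl).continuousOn
  refine ⟨max 1 M, le_max_left _ _, fun s => ?_⟩
  rcases lt_or_ge s 1 with h1 | h1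
  · rw [deriv_smoothCut_of_lt h1]; simp
  rcases lt_or_ge 2 s with h2 | h2
  · rw [deriv_smoothCut_of_gt h2]; simp
  · exact (hM s ⟨h1, h2⟩).trans (le_max_right _ _)

/-- Approximations of `χ` with compact support. -/
def cutApprox (χ : Euc d → ℝ) (k : ℕ) (x : Euc d) : ℝ :=
  ((k : ℝ) + 1)⁻¹ * smoothCut (((k : ℝ) + 1) * χ x)

theorem abs_cutoff_le {ω : Set (Euc d)} {χ : Euc d → ℝ} (hχ : IsCutoff ω χ) (x : Euc d) :
    |χ x| ≤ 1 :=
  abs_le.2 ⟨by linarith [hχ.nonneg x], hχ.le_one x⟩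

/-- Zeros of a nonnegative function are minima. At a point where `χ` is not differentiable, for
instance on the boundary of `ω`, `fderiv` is 0 by default. -/
theorem fderiv_eq_zero_of_cutoff_eq_zero {ω : Set (Euc d)} {χ : Euc d → ℝ} (hχ : IsCutoff ω χ)
    {x : Euc d} (hx : χ x = 0) : fderiv ℝ χ x = 0 :=
  IsLocalMin.fderiv_eq_zero (Eventually.of_forall fun y => hx ▸ hχ.nonneg y)

section cutApprox

variable {ω : Set (Euc d)} {χ : Euc d → ℝ} (k : ℕ)

theorem cutApprox_nonneg (x : Euc d) (hχ : IsCutoff ω χ) : 0 ≤ cutApprox χ k x :=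
  mul_nonneg (by positivity) (smoothCut_nonneg (mul_nonneg (by positivity) (hχ.nonneg x)))

theorem cutApprox_le (hχ : IsCutoff ω χ) (x : Euc d) : cutApprox χ k x ≤ χ x := by
  rw [cutApprox, inv_mul_le_iff₀ (by positivity)]
  exact smoothCut_le (mul_nonneg (by positivity) (hχ.nonneg x))

theorem contDiffOn_cutApprox (hχ : IsCutoff ω χ) : ContDiffOn ℝ 1 (cutApprox χ k) ω :=
  contDiffOn_const.mul (contDiff_smoothCut.comp_contDiffOn (contDiffOn_const.mul hχ.contDiffOn))

theorem fderiv_cutApprox (hω : IsOpen ω) (hχ : IsCutoff ω χ) {x : Euc d} (hx : x ∈ ω) :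
    fderiv ℝ (cutApprox χ k) x = deriv smoothCut (((k : ℝ) + 1) * χ x) • fderiv ℝ χ x := by
  have h1 : HasFDerivAt χ (fderiv ℝ χ x) x :=
    ((hχ.contDiffOn.differentiableOn one_ne_zero).differentiableAt (hω.mem_nhds hx)).hasFDerivAt
  have h2 : HasDerivAt smoothCut (deriv smoothCut (((k : ℝ) + 1) * χ x)) (((k : ℝ) + 1) * χ x) :=
    (contDiff_smoothCut.differentiable one_ne_zero _).hasDerivAt
  have h3 := (h2.comp_hasFDerivAt x (h1.const_mul ((k : ℝ) + 1))).const_mul (((k : ℝ) + 1)⁻¹)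
  have h4 : HasFDerivAt (cutApprox χ k) _ x := h3
  have hk : ((k : ℝ) + 1) ≠ 0 := by positivity
  rw [h4.fderiv]
  simp only [smul_smul]
  congr 1
  field_simp

theorem cgrad_cutApprox (hω : IsOpen ω) (hχ : IsCutoff ω χ) {x : Euc d} (hx : x ∈ ω) :
    cgrad (cutApprox χ k) x = deriv smoothCut (((k : ℝ) + 1) * χ x) • cgrad χ x := by
  rw [cgrad, fderiv_cutApprox k hω hχ hx, map_smul]; rfl

theorem isCompact_cutoff_level (hb : Bornology.IsBounded ω) (hχ : IsCutoff ω χ) :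
    IsCompact {x | ((k : ℝ) + 1)⁻¹ ≤ χ x} :=
  Metric.isCompact_of_isClosed_isBounded (isClosed_le continuous_const hχ.cont)
    (hb.subset fun x hx => by_contra fun hn => by
      have : (0 : ℝ) < ((k : ℝ) + 1)⁻¹ := by positivity
      have h2 : ((k : ℝ) + 1)⁻¹ ≤ χ x := hx
      rw [hχ.eq_zero x hn] at h2
      linarith)

theorem cutoff_level_subset (hχ : IsCutoff ω χ) : {x | ((k : ℝ) + 1)⁻¹ ≤ χ x} ⊆ ω :=
  fun x hx => by_contra fun hn => by
    have : (0 : ℝ) < ((k : ℝ) + 1)⁻¹ := by positivity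
    have h2 : ((k : ℝ) + 1)⁻¹ ≤ χ x := hx
    rw [hχ.eq_zero x hn] at h2
    linarith

theorem cutApprox_eq_zero {x : Euc d} (hx : χ x ≤ ((k : ℝ) + 1)⁻¹) : cutApprox χ k x = 0 := by
  rw [cutApprox, smoothCut_of_le, mul_zero]
  have : (0 : ℝ) < (k : ℝ) + 1 := by positivity
  calc ((k : ℝ) + 1) * χ x ≤ ((k : ℝ) + 1) * ((k : ℝ) + 1)⁻¹ := by gcongr
    _ = 1 := mul_inv_cancel₀ this.ne'

theorem cgrad_cutApprox_eq_zero (hχ : IsCutoff ω χ) {x : Euc d} (hx : χ x < ((k : ℝ) + 1)⁻¹) :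
    cgrad (cutApprox χ k) x = 0 := by
  have : cutApprox χ k =ᶠ[𝓝 x] fun _ => 0 := by
    filter_upwards [hχ.cont.continuousAt.eventually (gt_mem_nhds hx)] with y hy
    exact cutApprox_eq_zero k hy.le
  rw [cgrad, this.fderiv_eq]
  simp

end cutApprox

theorem IsCutoff.isH1Pair_mul {ω : Set (Euc d)} (hω : IsOpen ω) (hb : Bornology.IsBounded ω)
    {χ : Euc d → ℝ} (hχ : IsCutoff ω χ) {u : Euc d → ℝ} {G : Euc d → Euc d}
    (h : IsH1Pair ω u G) : IsH1Pair ω (χ * u) (fun x => χ x • G x + u x • cgrad χ x) := by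
  obtain ⟨C, hC⟩ := hχ.grad_bdd
  exact h.contDiffOn_mul hω hb hχ.contDiffOn (fun x _ => abs_cutoff_le hχ x) hC

/-- Multiplication by a cutoff function maps `H¹(ω)` to `H¹₀(ω)`. -/
theorem IsCutoff.inH10_mul {ω : Set (Euc d)} (hω : IsOpen ω) (hb : Bornology.IsBounded ω)
    {χ : Euc d → ℝ} (hχ : IsCutoff ω χ) {u : Euc d → ℝ} {G : Euc d → Euc d}
    (h : IsH1Pair ω u G) : InH10 ω (χ * u) := by
  obtain ⟨C, hC⟩ := hχ.grad_bdd
  obtain ⟨M, hM1, hM⟩ := exists_deriv_smoothCut_bound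
  obtain ⟨x₀, hx₀⟩ := hχ.nontrivial
  have hC0 : 0 ≤ C := (norm_nonneg _).trans (hC x₀ (by_contra fun hn => hx₀ (hχ.eq_zero _ hn)))
  have hbd : ∀ k, ∀ x ∈ ω, |cutApprox χ k x| ≤ 1 := fun k x _ =>
    abs_le.2 ⟨by linarith [cutApprox_nonneg k x hχ], (cutApprox_le k hχ x).trans (hχ.le_one x)⟩
  -- The bound is uniform in `k`: the factor `k + 1` from the chain rule cancels against the
  -- prefactor of `cutApprox`.
  have hbd' : ∀ k, ∀ x ∈ ω, ‖fderiv ℝ (cutApprox χ k) x‖ ≤ M * C := fun k x hx => by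
    rw [fderiv_cutApprox k hω hχ hx, norm_smul, Real.norm_eq_abs]
    exact mul_le_mul (hM _) (hC x hx) (norm_nonneg _) (by linarith)
  have hp := hχ.isH1Pair_mul hω hb h
  have hpk : ∀ k, IsH1Pair ω (cutApprox χ k * u)
      (fun x => cutApprox χ k x • G x + u x • cgrad (cutApprox χ k) x) := fun k =>
    h.contDiffOn_mul hω hb (contDiffOn_cutApprox k hχ) (hbd k) (hbd' k)
  have h0k : ∀ k, InH10 ω (cutApprox χ k * u) := fun k =>
    inH10_of_isCompact hω hb (hpk k) (isCompact_cutoff_level k hb hχ)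
      (cutoff_level_subset k hχ)
      (fun x hx => by simp [cutApprox_eq_zero k (not_le.1 hx).le])
      (fun x hx => by
        simp [cutApprox_eq_zero k (not_le.1 hx).le, cgrad_cutApprox_eq_zero k hχ (not_le.1 hx)])
  -- Values and gradients are eventually equal at each point: where `χ` vanishes its gradient
  -- vanishes too, and where `χ` is positive `(k + 1) * χ x` eventually exceeds 2, in the range
  -- where `smoothCut` is the identity.
  have hev : ∀ x ∈ ω, ∀ᶠ k : ℕ in atTop, cutApprox χ k x = χ x ∧
      cgrad (cutApprox χ k) x = cgrad χ x := fun x hx => by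
    rcases (hχ.nonneg x).eq_or_lt with h0 | h0
    · refine Eventually.of_forall fun k => ⟨?_, ?_⟩
      · rw [← h0, cutApprox_eq_zero]
        rw [← h0]; positivity
      · rw [cgrad_cutApprox_eq_zero k hχ (by rw [← h0]; positivity), cgrad,
          fderiv_eq_zero_of_cutoff_eq_zero hχ h0.symm, map_zero]
    · obtain ⟨N, hN⟩ := exists_nat_gt (2 / χ x)
      filter_upwards [eventually_ge_atTop N] with k hk
      have h2 : 2 < ((k : ℝ) + 1) * χ x := by
        rw [div_lt_iff₀ h0] at hN
        have : (N : ℝ) ≤ k := by exact_mod_cast hk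
        nlinarith
      have hk0 : ((k : ℝ) + 1) ≠ 0 := by positivity
      refine ⟨?_, ?_⟩
      · rw [cutApprox, smoothCut_of_ge h2.le, inv_mul_cancel_left₀ hk0]
      · rw [cgrad_cutApprox k hω hχ hx, deriv_smoothCut_of_gt h2, one_smul]
  have t1 : Tendsto (fun k => sqInt ω (χ * u - cutApprox χ k * u)) atTop (𝓝 0) := by
    refine tendsto_sqInt_of_dominated (fun k => (hp.1.sub (hpk k).1).1) h.1 (fun k => ?_) ?_
    · refine Eventually.of_forall fun x => ?_
      rw [Pi.sub_apply, Pi.mul_apply, Pi.mul_apply, ← sub_mul, norm_mul]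
      refine mul_le_of_le_one_left (norm_nonneg _) ?_
      rw [Real.norm_eq_abs, abs_le]
      constructor <;> linarith [cutApprox_nonneg k x hχ, cutApprox_le k hχ x, hχ.le_one x]
    · filter_upwards [ae_restrict_mem hω.measurableSet] with x hx
      refine tendsto_const_nhds.congr' ?_
      filter_upwards [hev x hx] with k hk
      simp [hk.1]
  have t2 : Tendsto (fun k => sqInt ω ((fun x => χ x • G x + u x • cgrad χ x) -
      (fun x => cutApprox χ k x • G x + u x • cgrad (cutApprox χ k) x))) atTop (𝓝 0) := by
    refine tendsto_sqInt_of_dominated (b := fun x => ‖G x‖ + (C + M * C) * ‖u x‖)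
      (fun k => (hp.2.1.sub (hpk k).2.1).1)
      (h.2.1.norm.add (h.1.norm.const_mul _)) (fun k => ?_) ?_
    · filter_upwards [ae_restrict_mem hω.measurableSet] with x hx
      have e : ((fun x => χ x • G x + u x • cgrad χ x) -
          (fun x => cutApprox χ k x • G x + u x • cgrad (cutApprox χ k) x)) x
          = (χ x - cutApprox χ k x) • G x + u x • (cgrad χ x - cgrad (cutApprox χ k) x) := by
        simp only [Pi.sub_apply, sub_smul, smul_sub]; abel
      have hMC : 0 ≤ M * C := mul_nonneg (by linarith) hC0
      rw [e, Real.norm_of_nonneg (by positivity)]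
      refine (norm_add_le _ _).trans (add_le_add ?_ ?_)
      · rw [norm_smul]
        refine mul_le_of_le_one_left (norm_nonneg _) ?_
        rw [Real.norm_eq_abs, abs_le]
        constructor <;> linarith [cutApprox_nonneg k x hχ, cutApprox_le k hχ x, hχ.le_one x]
      · rw [norm_smul, mul_comm]
        refine mul_le_mul_of_nonneg_right ((norm_sub_le _ _).trans ?_) (norm_nonneg _)
        rw [norm_cgrad, norm_cgrad]
        exact add_le_add (hC x hx) (hbd' k x hx)
    · filter_upwards [ae_restrict_mem hω.measurableSet] with x hx
      refine tendsto_const_nhds.congr' ?_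
      filter_upwards [hev x hx] with k hk
      simp [hk.1, hk.2]
  refine inH10_of_approx hω hb hp fun ε hε => ?_
  have hε' : 0 < ENNReal.ofReal ε := ENNReal.ofReal_pos.2 hε
  obtain ⟨k, hk1, hk2⟩ := ((t1.eventually (gt_mem_nhds hε')).and
    (t2.eventually (gt_mem_nhds hε'))).exists
  exact ⟨_, _, hpk k, h0k k, hk1.le, hk2.le⟩

/-! ### Translations -/

theorem IsTestFun.add {ω : Set (Euc d)} {φ ζ : Euc d → ℝ} (hφ : IsTestFun ω φ)
    (hζ : IsTestFun ω ζ) : IsTestFun ω (φ + ζ) :=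
  ⟨hφ.1.add hζ.1, hφ.2.1.add hζ.2.1,
    (tsupport_add φ ζ).trans (union_subset hφ.2.2 hζ.2.2)⟩

theorem IsTestFun.const_smul {ω : Set (Euc d)} {φ : Euc d → ℝ} (c : ℝ) (hφ : IsTestFun ω φ) :
    IsTestFun ω (c • φ) :=
  ⟨contDiff_const.smul hφ.1, hφ.2.1.smul_left (f := fun _ => c),
    (tsupport_smul_subset_right (fun _ => c) φ).trans hφ.2.2⟩

theorem isTestFun_zero (ω : Set (Euc d)) : IsTestFun ω 0 :=
  ⟨contDiff_const, HasCompactSupport.zero, by simp [tsupport]⟩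

/-- The subspace of `L²(U)` of (classes of) test functions. -/
def testSubmodule (U : Set (Euc d)) : Submodule ℝ (Lp ℝ 2 (volume.restrict U)) where
  carrier := {f | ∃ φ, IsTestFun U φ ∧ f =ᵐ[volume.restrict U] φ}
  zero_mem' := ⟨0, isTestFun_zero U, Lp.coeFn_zero _ _ _⟩
  add_mem' := by
    rintro f g ⟨φ, hφ, h1⟩ ⟨ζ, hζ, h2⟩
    exact ⟨φ + ζ, hφ.add hζ, (Lp.coeFn_add f g).trans (h1.add h2)⟩
  smul_mem' := by
    rintro c f ⟨φ, hφ, h1⟩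
    exact ⟨c • φ, hφ.const_smul c, (Lp.coeFn_smul c f).trans (h1.const_smul c)⟩

/-- A function orthogonal to all test functions vanishes, by the fundamental lemma. -/
theorem testSubmodule_topologicalClosure {U : Set (Euc d)} (hU : IsOpen U) :
    (testSubmodule U).topologicalClosure = ⊤ := by
  rw [Submodule.topologicalClosure_eq_top_iff, Submodule.eq_bot_iff]
  intro g hg
  have h0 := ae_eq_zero_of_forall_testFun hU (Lp.memLp g) fun φ hφ => by
    have m := memLp_restrict_of_continuous (ω := U) hφ.1.continuous hφ.2.1
    have := (Submodule.mem_orthogonal _ g).1 hg (m.toLp φ) ⟨φ, hφ, m.coeFn_toLp⟩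
    rw [L2.inner_def] at this
    rw [← this]
    refine integral_congr_ae ?_
    filter_upwards [m.coeFn_toLp] with x hx
    rw [hx]
    simp [mul_comm]
  exact (Lp.eq_zero_iff_ae_eq_zero).2 h0

/-- The duality characterization of the L² norm: by density the bound extends from test functions to
all of L², and then it is applied to `D` itself. -/
theorem sqrt_sqInt_le_of_forall_testFun {U : Set (Euc d)} (hU : IsOpen U) {D : Euc d → ℝ}
    (hD : MemLp D 2 (volume.restrict U)) {M : ℝ}
    (h : ∀ φ, IsTestFun U φ → |∫ x in U, D x * φ x| ≤ M * √(sqInt U φ).toReal) (hM : 0 ≤ M) :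
    √(sqInt U D).toReal ≤ M := by
  have key : ∀ f ∈ (testSubmodule U).topologicalClosure,
      |inner ℝ (hD.toLp D) f| ≤ M * ‖f‖ := by
    intro f hf
    have hcl : IsClosed {f : Lp ℝ 2 (volume.restrict U) | |inner ℝ (hD.toLp D) f| ≤ M * ‖f‖} :=
      isClosed_le ((continuous_const.inner continuous_id).abs) (continuous_const.mul continuous_norm)
    refine closure_minimal ?_ hcl hf
    rintro f ⟨φ, hφ, hfφ⟩
    have m := memLp_restrict_of_continuous (ω := U) hφ.1.continuous hφ.2.1
    have hf : f = m.toLp φ := Lp.ext (hfφ.trans m.coeFn_toLp.symm)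
    rw [mem_ofPred_eq, hf, inner_toLp_eq, norm_toLp_eq]
    have := h φ hφ
    simpa [mul_comm] using this
  have h1 := key (hD.toLp D) (by rw [testSubmodule_topologicalClosure hU]; trivial)
  rw [real_inner_self_eq_norm_sq, abs_of_nonneg (by positivity), norm_toLp_eq] at h1
  rcases (Real.sqrt_nonneg (sqInt U D).toReal).eq_or_lt with h0 | h0
  · rw [← h0]; exact hM
  · rw [sq] at h1
    exact le_of_mul_le_mul_right h1 h0

theorem memLp_translate {E : Type*} [NormedAddCommGroup E] {U ω : Set (Euc d)}
    (hω : MeasurableSet ω) {u : Euc d → E} (hu : MemLp u 2 (volume.restrict ω)) {z : Euc d}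
    (hz : ∀ x ∈ U, x + z ∈ ω) : MemLp (fun x => u (x + z)) 2 (volume.restrict U) := by
  have mp := (measurePreserving_add_right (volume : Measure (Euc d)) z).restrict_preimage hω
  exact (hu.comp_measurePreserving mp).mono_measure (Measure.restrict_mono hz le_rfl)

theorem sqInt_translate {E : Type*} [NormedAddCommGroup E] (u : Euc d → E) (z : Euc d)
    (U : Set (Euc d)) :
    sqInt U (fun x => u (x + z)) = sqInt ((fun x => x - z) ⁻¹' U) u := by
  have mp := (measurePreserving_add_right (volume : Measure (Euc d)) z)
  have := mp.setLIntegral_comp_preimage_emb (measurableEmbedding_addRight z)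
    (fun x => ‖u x‖ₑ ^ 2) ((fun x => x - z) ⁻¹' U)
  rw [sqInt, sqInt, ← this]
  congr 2
  ext x
  simp

theorem sqInt_testFun {U ω : Set (Euc d)} {φ : Euc d → ℝ} (hφ : IsTestFun U φ) (hs : U ⊆ ω)
    (hU : MeasurableSet U) : sqInt ω φ = sqInt U φ := by
  rw [← hφ.indicator_eq, sqInt_indicator hU hs, hφ.indicator_eq]

theorem isTestFun_translate {U ω : Set (Euc d)} {φ : Euc d → ℝ} (hφ : IsTestFun U φ) {z : Euc d}
    (hz : ∀ x ∈ U, x + z ∈ ω) : IsTestFun ω fun y => φ (y - z) := by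
  have e : tsupport (fun y => φ (y - z)) = (Homeomorph.subRight z) ⁻¹' tsupport φ :=
    tsupport_comp_eq_preimage φ (Homeomorph.subRight z)
  refine ⟨hφ.1.comp (contDiff_id.sub contDiff_const), ?_, ?_⟩
  · exact hφ.2.1.comp_homeomorph (Homeomorph.subRight z)
  · rw [e]
    intro y hy
    have := hz _ (hφ.2.2 hy)
    simpa using this

/-- By duality it is enough to pair the difference with a test function on `U`. The translation is
moved onto the test function, and the mean value inequality along the segment brings in the weak
gradient. -/
theorem IsH1Pair.sqInt_translate_sub_le {ω U : Set (Euc d)} (hω : IsOpen ω)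
    (hb : Bornology.IsBounded ω) {u : Euc d → ℝ} {G : Euc d → Euc d} (h : IsH1Pair ω u G)
    (hU : IsOpen U) {z : Euc d} (hz : ∀ x ∈ U, ∀ s ∈ Icc (0 : ℝ) 1, x + s • z ∈ ω) :
    sqInt U (fun x => u (x + z) - u x) ≤ ENNReal.ofReal (‖z‖ ^ 2) * sqInt ω G := by
  have := isFiniteMeasure_restrict_of_isBounded hb
  have iu : Integrable u (volume.restrict ω) := h.1.integrable (by norm_num)
  have hz1 : ∀ x ∈ U, x + z ∈ ω := fun x hx => by simpa using hz x hx 1 (by simp)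
  have hUω : U ⊆ ω := fun x hx => by simpa using hz x hx 0 (by simp)
  have mu : MemLp u 2 (volume.restrict U) := h.1.mono_measure (Measure.restrict_mono hUω le_rfl)
  have mz := memLp_translate hω.measurableSet h.1 hz1
  have hD : MemLp (fun x => u (x + z) - u x) 2 (volume.restrict U) := mz.sub mu
  have hGfin := sqInt_lt_top h.2.1
  have key : √(sqInt U (fun x => u (x + z) - u x)).toReal ≤ ‖z‖ * √(sqInt ω G).toReal := by
    refine sqrt_sqInt_le_of_forall_testFun hU hD (fun φ hφ => ?_) (by positivity)
    -- `F` interpolates between the pairings of `φ` with `u` and with `u(· + z)`. Since the segments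
    -- stay in `ω`, each translate of `φ` is a test function there, so `F'` is an integral of `G ·
    -- z` against it.
    set F : ℝ → ℝ := fun s => ∫ y in ω, u y * φ (y - s • z) with hF
    have hφd : Differentiable ℝ φ := hφ.contDiff_one.differentiable one_ne_zero
    obtain ⟨C, hC⟩ := (hφ.contDiff_one.continuous_fderiv one_ne_zero).bounded_above_of_compact_support
      (hφ.2.1.fderiv ℝ)
    have hderiv : ∀ s, HasDerivAt F (∫ y in ω, u y * -(fderiv ℝ φ (y - s • z) z)) s := by
      intro s
      refine (hasDerivAt_integral_of_dominated_loc_of_deriv_le (μ := volume.restrict ω)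
        (F := fun s y => u y * φ (y - s • z))
        (F' := fun s y => u y * -(fderiv ℝ φ (y - s • z) z)) (x₀ := s) (s := univ)
        (bound := fun y => |u y| * (C * ‖z‖)) univ_mem ?_ ?_ ?_ ?_ ?_ ?_).2
      · refine Eventually.of_forall fun s => h.1.1.mul ?_
        exact (hφ.1.continuous.comp (continuous_id.sub continuous_const)).aestronglyMeasurable
      · exact integrable_mul_of_continuous h.1
          (hφ.1.continuous.comp (continuous_id.sub continuous_const))
          (hφ.2.1.comp_homeomorph (Homeomorph.subRight (s • z)))
      · refine h.1.1.mul (Continuous.aestronglyMeasurable ?_)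
        exact ((continuous_fderiv_apply_of_contDiff hφ.contDiff_one z).comp
          (continuous_id.sub continuous_const)).neg
      · refine Eventually.of_forall fun y s _ => ?_
        rw [norm_mul, Real.norm_eq_abs, norm_neg]
        refine mul_le_mul_of_nonneg_left ?_ (abs_nonneg _)
        exact (ContinuousLinearMap.le_opNorm _ _).trans
          (mul_le_mul_of_nonneg_right (hC _) (norm_nonneg _))
      · exact iu.abs.mul_const _
      · refine Eventually.of_forall fun y s _ => HasDerivAt.const_mul (u y) ?_
        have h1 : HasDerivAt (fun s : ℝ => y - s • z) (-z) s := by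
          simpa using ((hasDerivAt_id s).smul_const z).const_sub y
        have h2 := (hφd (y - s • z)).hasFDerivAt.comp_hasDerivAt s h1
        rw [map_neg] at h2
        exact h2
    have htest : ∀ s ∈ Icc (0 : ℝ) 1, IsTestFun ω fun y => φ (y - s • z) := fun s hs =>
      isTestFun_translate hφ fun x hx => hz x hx s hs
    have hderiv' : ∀ s ∈ Icc (0 : ℝ) 1, ∫ y in ω, u y * -(fderiv ℝ φ (y - s • z) z)
        = ∫ y in ω, inner ℝ (G y) z * φ (y - s • z) := fun s hs => by
      have h1 := h.2.2 _ (htest s hs) z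
      have h2 : ∀ y, fderiv ℝ (fun y => φ (y - s • z)) y z = fderiv ℝ φ (y - s • z) z := fun y => by
        rw [fderiv_comp_sub]
      simp_rw [h2] at h1
      simp only [mul_neg, integral_neg, h1, neg_neg]
    have hbound : ∀ s ∈ Icc (0 : ℝ) 1, ‖∫ y in ω, u y * -(fderiv ℝ φ (y - s • z) z)‖
        ≤ ‖z‖ * √(sqInt ω G).toReal * √(sqInt U φ).toReal := fun s hs => by
      rw [hderiv' s hs, Real.norm_eq_abs]
      have m := memLp_restrict_of_continuous (ω := ω) (htest s hs).1.continuous (htest s hs).2.1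
      have m2 : MemLp (fun y => φ (y - s • z) • z) 2 (volume.restrict ω) :=
        memLp_restrict_of_continuous ((htest s hs).1.continuous.smul continuous_const)
          (htest s hs).2.1.smul_right
      have h1 := abs_integral_inner_le h.2.1 m2
      have e1 : ∀ y, inner ℝ (G y) (φ (y - s • z) • z) = inner ℝ (G y) z * φ (y - s • z) :=
        fun y => by rw [inner_smul_right, mul_comm]
      have e2 : sqInt ω (fun y => φ (y - s • z) • z) ≤ ‖z‖ₑ ^ 2 * sqInt U φ := by
        have e3 : sqInt univ (fun y => φ (y - s • z)) = sqInt U φ := by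
          have := sqInt_translate φ (-(s • z)) univ
          simp only [← sub_eq_add_neg] at this
          rw [this, preimage_univ, sqInt_testFun hφ (subset_univ _) hU.measurableSet]
        calc sqInt ω (fun y => φ (y - s • z) • z)
            = ‖z‖ₑ ^ 2 * sqInt ω (fun y => φ (y - s • z)) := by
              simp only [sqInt]
              rw [← lintegral_const_mul' _ _ (by simp)]
              exact lintegral_congr fun y => by rw [enorm_smul, mul_pow, mul_comm]
          _ ≤ ‖z‖ₑ ^ 2 * sqInt U φ := by
              rw [← e3]
              gcongr
              exact sqInt_mono_set (subset_univ _) _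
      have hφfin : sqInt U φ < ⊤ :=
        sqInt_lt_top (memLp_restrict_of_continuous hφ.1.continuous hφ.2.1)
      simp_rw [e1] at h1
      refine h1.trans ?_
      rw [mul_comm ‖z‖, mul_assoc]
      refine mul_le_mul_of_nonneg_left ?_ (Real.sqrt_nonneg _)
      rw [← Real.sqrt_sq (norm_nonneg z), ← Real.sqrt_mul (by positivity)]
      refine Real.sqrt_le_sqrt ?_
      have := ENNReal.toReal_mono (ENNReal.mul_ne_top (by simp) hφfin.ne) e2
      rw [ENNReal.toReal_mul, ENNReal.toReal_pow, toReal_enorm] at this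
      exact this
    have hmv := norm_image_sub_le_of_norm_deriv_le_segment_01'
      (fun s hs => (hderiv s).hasDerivWithinAt) fun s hs => hbound s ⟨hs.1, hs.2.le⟩
    have hF0 : F 0 = ∫ x in U, u x * φ x := by
      simp only [hF, zero_smul, sub_zero]
      exact setIntegral_eq_of_subset_of_forall_sdiff_eq_zero hω.measurableSet hUω fun x hx => by
        rw [image_eq_zero_of_notMem_tsupport fun h' => hx.2 (hφ.2.2 h'), mul_zero]
    have hF1 : F 1 = ∫ x in U, u (x + z) * φ x := by
      simp only [hF, one_smul]
      rw [setIntegral_eq_integral_of_forall_compl_eq_zero, ← integral_add_right_eq_self _ z,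
        setIntegral_eq_integral_of_forall_compl_eq_zero]
      · simp
      · intro x hx
        rw [image_eq_zero_of_notMem_tsupport fun h' => hx (hφ.2.2 h'), mul_zero]
      · intro y hy
        have h0 : φ (y - z) = 0 := image_eq_zero_of_notMem_tsupport fun h' =>
          hy (by simpa using hz1 _ (hφ.2.2 h'))
        rw [h0, mul_zero]
    have hi1 := integrable_mul_of_continuous mz hφ.1.continuous hφ.2.1
    have hi2 := integrable_mul_of_continuous mu hφ.1.continuous hφ.2.1
    have e : ∫ x in U, (u (x + z) - u x) * φ x = F 1 - F 0 := by
      rw [hF1, hF0, ← integral_sub hi1 hi2]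
      exact integral_congr_ae (Eventually.of_forall fun x => sub_mul _ _ _)
    rw [e]
    exact hmv
  have h2 : (sqInt U (fun x => u (x + z) - u x)).toReal ≤ ‖z‖ ^ 2 * (sqInt ω G).toReal := by
    have := pow_le_pow_left₀ (Real.sqrt_nonneg _) key 2
    rwa [mul_pow, Real.sq_sqrt ENNReal.toReal_nonneg, Real.sq_sqrt ENNReal.toReal_nonneg] at this
  rw [← ENNReal.ofReal_toReal (sqInt_lt_top hD).ne]
  refine (ENNReal.ofReal_le_ofReal h2).trans_eq ?_
  rw [ENNReal.ofReal_mul (by positivity), ENNReal.ofReal_toReal hGfin.ne]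

/-! ### Functions with vanishing weak gradient -/

theorem exists_stronglyMeasurable_extension {E : Type*} [NormedAddCommGroup E]
    {ω : Set (Euc d)} (hω : MeasurableSet ω) {u : Euc d → E}
    (hu : MemLp u 2 (volume.restrict ω)) :
    ∃ u' : Euc d → E, StronglyMeasurable u' ∧ MemLp u' 2 volume ∧ (∀ x ∉ ω, u' x = 0) ∧
      u =ᵐ[volume.restrict ω] u' := by
  have he : u =ᵐ[volume.restrict ω] ω.indicator (hu.1.mk u) := by
    filter_upwards [hu.1.ae_eq_mk, ae_restrict_mem hω] with x h1 h2
    rw [indicator_of_mem h2, h1]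
  refine ⟨ω.indicator (hu.1.mk u), hu.1.stronglyMeasurable_mk.indicator hω, ?_,
    fun x hx => indicator_of_notMem hx _, he⟩
  exact (memLp_indicator_iff_restrict hω).2 ((memLp_congr_ae hu.1.ae_eq_mk).1 hu)

/-- With zero gradient the translation estimate makes `u` invariant under every small translation,
almost everywhere near `x₀`. -/
theorem IsH1Pair.exists_locally_const {ω : Set (Euc d)} (hω : IsOpen ω)
    (hb : Bornology.IsBounded ω) {u : Euc d → ℝ} (h : IsH1Pair ω u 0) {x₀ : Euc d} (hx₀ : x₀ ∈ ω) :
    ∃ r > 0, ∃ c : ℝ, Metric.ball x₀ r ⊆ ω ∧ ∀ᵐ x ∂volume.restrict (Metric.ball x₀ r), u x = c := by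
  obtain ⟨u', hm, -, -, he⟩ := exists_stronglyMeasurable_extension hω.measurableSet h.1
  have h' : IsH1Pair ω u' 0 := h.congr he (ae_eq_refl _)
  obtain ⟨R, hR, hball⟩ := Metric.isOpen_iff.1 hω x₀ hx₀
  set r := R / 2 with hr
  have hr0 : 0 < r := by positivity
  set U := Metric.ball x₀ r
  set B := Metric.ball (0 : Euc d) r
  have hseg : ∀ z ∈ B, ∀ x ∈ U, ∀ s ∈ Icc (0 : ℝ) 1, x + s • z ∈ ω := fun z hz x hx s hs => by
    refine hball ?_
    rw [Metric.mem_ball, dist_eq_norm] at hx ⊢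
    have h1 : ‖s • z‖ < r := by
      rw [norm_smul, Real.norm_of_nonneg hs.1]
      exact (mul_le_of_le_one_left (norm_nonneg _) hs.2).trans_lt (mem_ball_zero_iff.1 hz)
    calc ‖x + s • z - x₀‖ = ‖(x - x₀) + s • z‖ := by congr 1; abel
      _ ≤ ‖x - x₀‖ + ‖s • z‖ := norm_add_le _ _
      _ < R := by rw [hr] at *; linarith
  have h1 : ∀ z ∈ B, ∀ᵐ x ∂volume.restrict U, u' (x + z) = u' x := fun z hz => by
    have h2 := h'.sqInt_translate_sub_le hω hb Metric.isOpen_ball (hseg z hz)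
    have h3 : sqInt ω (0 : Euc d → Euc d) = 0 := by simp [sqInt]
    have hmeas : Measurable fun x => ‖u' (x + z) - u' x‖ₑ ^ 2 :=
      ((hm.comp_measurable (measurable_id.add_const z)).sub hm).enorm.pow_const 2
    rw [h3, mul_zero, nonpos_iff_eq_zero, sqInt, lintegral_eq_zero_iff hmeas] at h2
    filter_upwards [h2] with x hx
    simpa [sub_eq_zero] using hx
  have hms : MeasurableSet {p : Euc d × Euc d | u' (p.2 + p.1) = u' p.2} :=
    measurableSet_eq_fun (hm.measurable.comp (measurable_snd.add measurable_fst))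
      (hm.measurable.comp measurable_snd)
  -- The exceptional set of `x` depends on `z`. Exchanging the quantifiers by Fubini yields a single
  -- `x` with `u' (x + z) = u' x` for almost every `z`. This `x` is taken in the half ball so that
  -- every `y` of that ball is `x + z` with `‖z‖ < r`.
  have h2 : ∀ᵐ z ∂volume.restrict B, ∀ᵐ x ∂volume.restrict U, u' (x + z) = u' x := by
    filter_upwards [ae_restrict_mem measurableSet_ball] with z hz using h1 z hz
  rw [Measure.ae_ae_comm hms] at h2
  have h3 : ∀ᵐ x ∂volume.restrict (Metric.ball x₀ (r / 2)),
      ∀ᵐ z ∂volume.restrict B, u' (x + z) = u' x :=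
    ae_restrict_of_ae_restrict_of_subset (Metric.ball_subset_ball (by linarith)) h2
  have hne : (ae (volume.restrict (Metric.ball x₀ (r / 2)))).NeBot := by
    rw [ae_neBot, Ne, Measure.restrict_eq_zero]
    exact (Metric.measure_ball_pos volume x₀ (by positivity)).ne'
  obtain ⟨x, hx, hxm⟩ := (h3.and (ae_restrict_mem measurableSet_ball)).exists
  have hsub : Metric.ball x₀ (r / 2) ⊆ ω :=
    (Metric.ball_subset_ball (by linarith)).trans hball
  refine ⟨r / 2, by positivity, u' x, hsub, ?_⟩
  have h4 : ∀ᵐ y ∂volume.restrict (Metric.ball x₀ (r / 2)), u' y = u' x := by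
    rw [ae_restrict_iff' measurableSet_ball] at hx ⊢
    have := (measurePreserving_sub_right (volume : Measure (Euc d)) x).quasiMeasurePreserving.ae hx
    filter_upwards [this] with y hy hyb
    have := hy (by
      rw [mem_ball_zero_iff, ← dist_eq_norm]
      have := dist_triangle_right y x x₀
      rw [Metric.mem_ball] at hyb hxm
      linarith)
    simpa using this
  filter_upwards [h4, ae_restrict_of_ae_restrict_of_subset hsub he] with y hy1 hy2
  rw [hy2, hy1]

/-- The local constants agree on overlapping balls, since nonempty open sets have positive measure.
They form a locally constant function on the connected set `ω`. -/
theorem IsH1Pair.exists_const {ω : Set (Euc d)} (hω : IsOpen ω) (hc : IsConnected ω)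
    (hb : Bornology.IsBounded ω) {u : Euc d → ℝ} (h : IsH1Pair ω u 0) :
    ∃ c : ℝ, u =ᵐ[volume.restrict ω] fun _ => c := by
  have hex := fun x : ω => h.exists_locally_const hω hb x.2
  choose r hr c hsub hae using hex
  have hlc : IsLocallyConstant c := by
    rw [IsLocallyConstant.iff_exists_open]
    intro x
    refine ⟨Subtype.val ⁻¹' Metric.ball (x : Euc d) (r x),
      Metric.isOpen_ball.preimage continuous_subtype_val, Metric.mem_ball_self (hr x),
      fun y hy => ?_⟩
    have hopen : IsOpen (Metric.ball (x : Euc d) (r x) ∩ Metric.ball (y : Euc d) (r y)) :=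
      Metric.isOpen_ball.inter Metric.isOpen_ball
    have hne : (ae (volume.restrict
        (Metric.ball (x : Euc d) (r x) ∩ Metric.ball (y : Euc d) (r y)))).NeBot := by
      rw [ae_neBot, Ne, Measure.restrict_eq_zero]
      exact (hopen.measure_pos volume ⟨y, hy, Metric.mem_ball_self (hr y)⟩).ne'
    obtain ⟨z, h1, h2⟩ := ((ae_restrict_of_ae_restrict_of_subset inter_subset_left (hae x)).and
      (ae_restrict_of_ae_restrict_of_subset inter_subset_right (hae y))).exists
    exact h2.symm.trans h1
  obtain ⟨x₀, hx₀⟩ := hc.nonempty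
  have : PreconnectedSpace ω := Subtype.preconnectedSpace hc.isPreconnected
  have hcc : ∀ x : ω, c x = c ⟨x₀, hx₀⟩ := fun x =>
    hlc.apply_eq_of_isPreconnected isPreconnected_univ (mem_univ _) (mem_univ _)
  refine ⟨c ⟨x₀, hx₀⟩, ?_⟩
  change volume.restrict ω {x | ¬ u x = c ⟨x₀, hx₀⟩} = 0
  rw [Measure.restrict_apply₀']
  · refine measure_null_of_locally_null _ fun x hx => ?_
    refine ⟨{x | ¬ u x = c ⟨x₀, hx₀⟩} ∩ Metric.ball x (r ⟨x, hx.2⟩), ?_, ?_⟩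
    · exact inter_mem (mem_of_superset self_mem_nhdsWithin inter_subset_left) (mem_nhdsWithin_of_mem_nhds
        (Metric.ball_mem_nhds x (hr _)))
    · have := hae ⟨x, hx.2⟩
      rw [hcc, ae_iff, Measure.restrict_apply₀' measurableSet_ball.nullMeasurableSet] at this
      exact this
  · exact hω.measurableSet.nullMeasurableSet

/-! ### Weak compactness -/

/-- Sequential Banach–Alaoglu in the separable space L², transported through the Riesz isomorphism.
-/
theorem exists_subseq_weak_limit {E : Type*} [NormedAddCommGroup E] [InnerProductSpace ℝ E]
    [CompleteSpace E] [TopologicalSpace.SeparableSpace E] {ω : Set (Euc d)}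
    {F : ℕ → Euc d → E} (hF : ∀ k, MemLp (F k) 2 (volume.restrict ω)) {C : ℝ≥0∞} (hC : C ≠ ⊤)
    (hFC : ∀ k, sqInt ω (F k) ≤ C) :
    ∃ s : ℕ → ℕ, StrictMono s ∧ ∃ F₀, MemLp F₀ 2 (volume.restrict ω) ∧
      ∀ H, MemLp H 2 (volume.restrict ω) → Tendsto (fun k => ∫ x in ω, inner ℝ (F (s k) x) (H x))
        atTop (𝓝 (∫ x in ω, inner ℝ (F₀ x) (H x))) := by
  have : Fact ((2 : ℝ≥0∞) ≠ ⊤) := ⟨by simp⟩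
  set X := Lp E 2 (volume.restrict ω)
  have hsc := WeakDual.isSeqCompact_closedBall ℝ X 0 (√C.toReal)
  obtain ⟨a, -, s, hs, hlim⟩ := hsc
    (x := fun k => StrongDual.toWeakDual (InnerProductSpace.toDual ℝ X ((hF k).toLp (F k))))
    (fun k => by
      change InnerProductSpace.toDual ℝ X ((hF k).toLp (F k)) ∈ Metric.closedBall 0 (√C.toReal)
      rw [mem_closedBall_zero_iff, LinearIsometryEquiv.norm_map, norm_toLp_eq]
      exact Real.sqrt_le_sqrt (ENNReal.toReal_mono hC (hFC k)))
  set f : X := (InnerProductSpace.toDual ℝ X).symm (WeakDual.toStrongDual a) with hf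
  refine ⟨s, hs, f, Lp.memLp f, fun H hH => ?_⟩
  have h1 := ((WeakDual.eval_continuous (hH.toLp H)).tendsto a).comp hlim
  have e1 : ∀ k, (fun b : WeakDual ℝ X => b (hH.toLp H)) (StrongDual.toWeakDual
      (InnerProductSpace.toDual ℝ X ((hF (s k)).toLp (F (s k)))))
      = ∫ x in ω, inner ℝ (F (s k) x) (H x) := fun k =>
    inner_toLp_eq (hF (s k)) hH
  have e2 : a (hH.toLp H) = ∫ x in ω, inner ℝ (f x) (H x) := by
    have h2 : inner ℝ f (hH.toLp H) = a (hH.toLp H) := InnerProductSpace.toDual_symm_apply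
    rw [← h2, L2.inner_def]
    refine integral_congr_ae ?_
    filter_upwards [hH.coeFn_toLp] with x hx
    rw [hx]
  rw [e2] at h1
  exact h1.congr e1

theorem isH1Pair_of_weak_limit {ω : Set (Euc d)} {u : ℕ → Euc d → ℝ} {G : ℕ → Euc d → Euc d}
    (h : ∀ k, IsH1Pair ω (u k) (G k)) {u₀ : Euc d → ℝ} {G₀ : Euc d → Euc d}
    (hu₀ : MemLp u₀ 2 (volume.restrict ω)) (hG₀ : MemLp G₀ 2 (volume.restrict ω))
    (hu : ∀ H, MemLp H 2 (volume.restrict ω) → Tendsto (fun k => ∫ x in ω, inner ℝ (u k x) (H x))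
        atTop (𝓝 (∫ x in ω, inner ℝ (u₀ x) (H x))))
    (hG : ∀ H, MemLp H 2 (volume.restrict ω) → Tendsto (fun k => ∫ x in ω, inner ℝ (G k x) (H x))
        atTop (𝓝 (∫ x in ω, inner ℝ (G₀ x) (H x)))) : IsH1Pair ω u₀ G₀ := by
  refine ⟨hu₀, hG₀, fun φ hφ e => ?_⟩
  have l1 := hu _ (memLp_restrict_of_continuous
    (continuous_fderiv_apply_of_contDiff hφ.contDiff_one e)
    (hasCompactSupport_fderiv_apply hφ.2.1 e))
  have l2 := hG (fun x => φ x • e) (memLp_restrict_of_continuous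
    (hφ.1.continuous.smul continuous_const) hφ.2.1.smul_right)
  have e1 : ∀ v : Euc d → ℝ, ∫ x in ω, inner ℝ (v x) (fderiv ℝ φ x e)
      = ∫ x in ω, v x * fderiv ℝ φ x e := fun v =>
    integral_congr_ae (Eventually.of_forall fun x => by simp [mul_comm])
  have e2 : ∀ F : Euc d → Euc d, ∫ x in ω, inner ℝ (F x) (φ x • e)
      = ∫ x in ω, inner ℝ (F x) e * φ x := fun F =>
    integral_congr_ae (Eventually.of_forall fun x => by simp [inner_smul_right, mul_comm])
  simp_rw [e1] at l1
  simp_rw [e2] at l2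
  exact tendsto_nhds_unique (l1.congr fun k => (h k).2.2 φ hφ e) l2.neg

/-! ### Rellich's theorem -/

/-- The pattern of both parts of Rellich's theorem: `c δ` is the cost of smoothing or shifting by
`δ`, uniform in `k`, and `b k δ` is the smoothed or shifted term, which tends to zero for fixed `δ`.
-/
theorem tendsto_zero_of_forall_le_add {a : ℕ → ℝ≥0∞} {b : ℕ → ℝ → ℝ≥0∞} {c : ℝ → ℝ≥0∞}
    (hc : Tendsto c (𝓝[>] 0) (𝓝 0)) {r : ℝ} (hr : 0 < r)
    (hb : ∀ δ ∈ Ioo 0 r, Tendsto (fun k => b k δ) atTop (𝓝 0))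
    (h : ∀ δ ∈ Ioo 0 r, ∀ k, a k ≤ c δ + b k δ) : Tendsto a atTop (𝓝 0) := by
  rw [ENNReal.tendsto_nhds_zero]
  intro ε hε
  have hε2 : 0 < ε / 2 := ENNReal.half_pos hε.ne'
  obtain ⟨δ, h1, h2⟩ := ((ENNReal.tendsto_nhds_zero.1 hc _ hε2).and
    (Ioo_mem_nhdsGT hr)).exists
  filter_upwards [ENNReal.tendsto_nhds_zero.1 (hb δ h2) _ hε2] with k hk
  calc a k ≤ c δ + b k δ := h δ h2 k
    _ ≤ ε / 2 + ε / 2 := add_le_add h1 hk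
    _ = ε := ENNReal.add_halves ε

theorem tendsto_ofReal_sq_mul {C : ℝ≥0∞} (hC : C ≠ ⊤) :
    Tendsto (fun δ : ℝ => ENNReal.ofReal (δ ^ 2) * C) (𝓝[>] 0) (𝓝 0) := by
  have h1 : Tendsto (fun δ : ℝ => ENNReal.ofReal (δ ^ 2)) (𝓝[>] 0) (𝓝 0) := by
    have : Continuous fun δ : ℝ => ENNReal.ofReal (δ ^ 2) :=
      ENNReal.continuous_ofReal.comp (continuous_pow 2)
    have := this.tendsto 0
    simp only [ne_eq, OfNat.ofNat_ne_zero, not_false_eq_true, zero_pow, ENNReal.ofReal_zero] at this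
    exact this.mono_left nhdsWithin_le_nhds
  have := ENNReal.Tendsto.mul_const h1 (Or.inr hC)
  simpa using this

section Rellich

variable {ω : Set (Euc d)} {w : ℕ → Euc d → ℝ} {G : ℕ → Euc d → Euc d} {C : ℝ≥0∞}

/-- Mollification at scale `δ` costs at most `δ` times the bounded gradient norm. For fixed `δ` the
mollified functions tend to zero pointwise by weak convergence and are uniformly bounded, hence tend
to zero in L² of the ball. -/
theorem tendsto_sqInt_ball (hω : IsOpen ω) (hb : Bornology.IsBounded ω)
    (h : ∀ k, IsH1Pair ω (w k) (G k)) (hC : C ≠ ⊤) (hwC : ∀ k, sqInt ω (w k) ≤ C)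
    (hGC : ∀ k, sqInt ω (G k) ≤ C)
    (h0 : ∀ H, MemLp H 2 (volume.restrict ω) →
      Tendsto (fun k => ∫ x in ω, inner ℝ (w k x) (H x)) atTop (𝓝 0))
    {x₀ : Euc d} {r : ℝ} (hr : 0 < r) (hball : Metric.ball x₀ (2 * r) ⊆ ω) :
    Tendsto (fun k => sqInt (Metric.ball x₀ r) (w k)) atTop (𝓝 0) := by
  choose w' hm hL hz he using fun k =>
    exists_stronglyMeasurable_extension hω.measurableSet (h k).1
  have hp : ∀ k, IsH1Pair ω (w' k) (G k) := fun k => (h k).congr (he k) (ae_eq_refl _)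
  set U := Metric.ball x₀ r
  have hUω : U ⊆ ω := (Metric.ball_subset_ball (by linarith)).trans hball
  have hfU : IsFiniteMeasure (volume.restrict U) :=
    isFiniteMeasure_restrict_of_isBounded Metric.isBounded_ball
  have e0 : ∀ k, sqInt U (w k) = sqInt U (w' k) := fun k =>
    sqInt_congr (ae_restrict_of_ae_restrict_of_subset hUω (he k))
  simp_rw [e0]
  -- The kernel `mollBump` takes a proof of positivity; the value for `δ ≤ 0` plays no role.
  set b : ℕ → ℝ → ℝ≥0∞ := fun k δ =>
    if hδ : 0 < δ then 2 * sqInt U (moll (mollBump hδ) (w' k)) else 0 with hbdef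
  have hc0 : Tendsto (fun δ : ℝ => 2 * (ENNReal.ofReal (δ ^ 2) * C)) (𝓝[>] 0) (𝓝 0) := by
    have := ENNReal.Tendsto.const_mul (a := 2) (tendsto_ofReal_sq_mul hC) (Or.inr (by simp))
    simpa using this
  refine tendsto_zero_of_forall_le_add (b := b) hc0 hr ?_ ?_
  · intro δ hδ
    simp only [hbdef, hδ.1, dif_pos]
    set ρ : ContDiffBump (0 : Euc d) := mollBump hδ.1
    have hρc := ρ.continuous_normed (μ := (volume : Measure (Euc d)))
    have hρs := ρ.hasCompactSupport_normed (μ := (volume : Measure (Euc d)))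
    have mρ : ∀ x, MemLp (fun y => ρ.normed volume (x - y)) 2 (volume.restrict ω) := fun x =>
      memLp_restrict_of_continuous (hρc.comp (continuous_const.sub continuous_id))
        (hρs.comp_homeomorph (Homeomorph.subLeft x))
    have eρ : ∀ k x, moll ρ (w' k) x = ∫ y in ω, w k y * ρ.normed volume (x - y) := fun k x => by
      rw [moll_apply', ← setIntegral_eq_integral_of_forall_compl_eq_zero (s := ω)
        (fun y hy => by rw [hz k y hy, smul_zero])]
      refine integral_congr_ae ?_
      filter_upwards [he k] with y hy
      rw [hy, smul_eq_mul, mul_comm]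
    have hS : ∀ x, sqInt ω (fun y => ρ.normed volume (x - y))
        ≤ sqInt univ (ρ.normed (volume : Measure (Euc d))) := fun x => by
      refine (sqInt_mono_set (subset_univ _) _).trans_eq ?_
      simp only [sqInt, Measure.restrict_univ]
      exact lintegral_sub_left_eq_self (fun y => ‖ρ.normed (volume : Measure (Euc d)) y‖ₑ ^ 2) x
    have hSfin : sqInt univ (ρ.normed (volume : Measure (Euc d))) < ⊤ :=
      sqInt_lt_top (memLp_restrict_of_continuous hρc hρs)
    have hlim : Tendsto (fun k => sqInt U (moll ρ (w' k))) atTop (𝓝 0) := by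
      refine tendsto_sqInt_of_dominated
        (b := fun _ => √C.toReal * √(sqInt univ (ρ.normed (volume : Measure (Euc d)))).toReal)
        (fun k => ?_) (memLp_const _) (fun k => Eventually.of_forall fun x => ?_)
        (Eventually.of_forall fun x => ?_)
      · exact (ρ.hasCompactSupport_normed.contDiff_convolution_left (n := 0) _
          (ρ.contDiff_normed) (locallyIntegrable_of_memLp (hL k))).continuous.aestronglyMeasurable
      · rw [eρ, Real.norm_eq_abs, Real.norm_of_nonneg (by positivity)]
        refine (abs_integral_mul_le (h k).1 (mρ x)).trans ?_
        exact mul_le_mul (Real.sqrt_le_sqrt (ENNReal.toReal_mono hC (hwC k)))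
          (Real.sqrt_le_sqrt (ENNReal.toReal_mono hSfin.ne (hS x))) (Real.sqrt_nonneg _)
          (Real.sqrt_nonneg _)
      · refine (h0 _ (mρ x)).congr fun k => ?_
        rw [eρ]
        exact integral_congr_ae (Eventually.of_forall fun y => by simp [mul_comm])
    have := ENNReal.Tendsto.const_mul (a := 2) hlim (Or.inr (by simp))
    simpa using this
  · intro δ hδ k
    simp only [hbdef, hδ.1, dif_pos]
    set ρ : ContDiffBump (0 : Euc d) := mollBump hδ.1
    have hρr : ρ.rOut = δ := rfl
    have b1 : sqInt U (fun x => w' k x - moll ρ (w' k) x) ≤ ENNReal.ofReal (δ ^ 2) * C := by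
      refine sqInt_sub_moll_le ρ (hm k) (locallyIntegrable_of_memLp (hL k)) U fun z hz => ?_
      have hzn : ‖z‖ < δ := by simpa [hρr] using hz
      have b2 := (hp k).sqInt_translate_sub_le hω hb (U := U) Metric.isOpen_ball (z := -z)
        fun x hx s hs => hball ?_
      · have b3 : sqInt U (fun x => w' k x - w' k (x - z))
            = sqInt U (fun x => w' k (x + -z) - w' k x) := by
          simp only [sqInt, ← sub_eq_add_neg]
          exact lintegral_congr fun x => by rw [← enorm_neg, neg_sub]
        rw [b3]
        refine b2.trans (mul_le_mul' (ENNReal.ofReal_le_ofReal ?_) (hGC k))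
        rw [norm_neg]
        exact pow_le_pow_left₀ (norm_nonneg _) hzn.le 2
      · rw [Metric.mem_ball, dist_eq_norm] at hx ⊢
        have h1 : ‖s • -z‖ < r := by
          rw [norm_smul, Real.norm_of_nonneg hs.1, norm_neg]
          exact (mul_le_of_le_one_left (norm_nonneg _) hs.2).trans_lt (hzn.trans hδ.2)
        calc ‖x + s • -z - x₀‖ = ‖(x - x₀) + s • -z‖ := by congr 1; abel
          _ ≤ ‖x - x₀‖ + ‖s • -z‖ := norm_add_le _ _
          _ < 2 * r := by linarith
    have hmm : AEStronglyMeasurable (fun x => w' k x - moll ρ (w' k) x) (volume.restrict U) := by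
      refine (hm k).aestronglyMeasurable.sub ?_
      exact (ρ.hasCompactSupport_normed.contDiff_convolution_left (n := 0) _
        (ρ.contDiff_normed) (locallyIntegrable_of_memLp (hL k))).continuous.aestronglyMeasurable
    have b4 := sqInt_add_le (v := moll ρ (w' k)) hmm
    have e : (fun x => w' k x - moll ρ (w' k) x) + moll ρ (w' k) = w' k := by
      ext x; simp
    rw [e] at b4
    exact b4.trans (add_le_add (mul_le_mul' le_rfl b1) le_rfl)

theorem tendsto_sqInt_of_isCompact_of_locally {S K : Set (Euc d)} (hK : IsCompact K)
    (h : ∀ x ∈ K, ∃ r > 0, Tendsto (fun k => sqInt (Metric.ball x r ∩ S) (w k)) atTop (𝓝 0)) :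
    Tendsto (fun k => sqInt (K ∩ S) (w k)) atTop (𝓝 0) := by
  refine hK.induction_on (p := fun s => Tendsto (fun k => sqInt (s ∩ S) (w k)) atTop (𝓝 0))
    ?_ ?_ ?_ ?_
  · simp [sqInt]
  · intro s t hst ht
    exact tendsto_of_tendsto_of_tendsto_of_le_of_le tendsto_const_nhds ht (fun k => zero_le)
      fun k => sqInt_mono_set (inter_subset_inter_left _ hst) _
  · intro s t hs ht
    have hst := hs.add ht
    rw [add_zero] at hst
    refine tendsto_of_tendsto_of_tendsto_of_le_of_le tendsto_const_nhds hst (fun k => zero_le)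
      fun k => ?_
    rw [union_inter_distrib_right]
    exact lintegral_union_le _ _ _
  · intro x hx
    obtain ⟨r, hr, h1⟩ := h x hx
    exact ⟨Metric.ball x r, mem_nhdsWithin_of_mem_nhds (Metric.ball_mem_nhds x hr), h1⟩

theorem tendsto_sqInt_of_isCompact (hω : IsOpen ω) (hb : Bornology.IsBounded ω)
    (h : ∀ k, IsH1Pair ω (w k) (G k)) (hC : C ≠ ⊤) (hwC : ∀ k, sqInt ω (w k) ≤ C)
    (hGC : ∀ k, sqInt ω (G k) ≤ C)
    (h0 : ∀ H, MemLp H 2 (volume.restrict ω) →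
      Tendsto (fun k => ∫ x in ω, inner ℝ (w k x) (H x)) atTop (𝓝 0))
    {K : Set (Euc d)} (hK : IsCompact K) (hKω : K ⊆ ω) :
    Tendsto (fun k => sqInt K (w k)) atTop (𝓝 0) := by
  have := tendsto_sqInt_of_isCompact_of_locally (w := w) (S := univ) hK fun x hx => by
    obtain ⟨R, hR, hball⟩ := Metric.isOpen_iff.1 hω x (hKω hx)
    refine ⟨R / 2, by positivity, ?_⟩
    rw [inter_univ]
    exact tendsto_sqInt_ball hω hb h hC hwC hGC h0 (by positivity)
      (by rwa [mul_div_cancel₀ _ two_ne_zero])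
  rwa [inter_univ] at this

/-- Above a Lipschitz graph, pushing the boundary piece by `t` in the direction `e` moves it into a
compact subset of `ω`, where the interior result applies. The push costs at most `t` times the
gradient norm, so no extension operator is needed. -/
theorem tendsto_sqInt_boundary (hω : IsOpen ω) (hb : Bornology.IsBounded ω)
    (h : ∀ k, IsH1Pair ω (w k) (G k)) (hC : C ≠ ⊤) (hwC : ∀ k, sqInt ω (w k) ≤ C)
    (hGC : ∀ k, sqInt ω (G k) ≤ C)
    (h0 : ∀ H, MemLp H 2 (volume.restrict ω) →
      Tendsto (fun k => ∫ x in ω, inner ℝ (w k x) (H x)) atTop (𝓝 0))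
    (hlip : HasLipschitzBoundary ω) {x₀ : Euc d} (hx₀ : x₀ ∈ frontier ω) :
    ∃ r > 0, Tendsto (fun k => sqInt (Metric.ball x₀ r ∩ ω) (w k)) atTop (𝓝 0) := by
  obtain ⟨r, hr, e, he, L, γ, hγ, hgraph⟩ := hlip x₀ hx₀
  refine ⟨r / 2, by positivity, ?_⟩
  set U := Metric.ball x₀ (r / 2) ∩ ω
  have hU : IsOpen U := Metric.isOpen_ball.inter hω
  have hproj : ∀ (y : Euc d) (t : ℝ), (y + t • e) - inner ℝ e (y + t • e) • e
      = y - inner ℝ e y • e := fun y t => by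
    rw [inner_add_right, inner_smul_right, real_inner_self_eq_norm_sq, he, add_smul]
    simp
  have hinn : ∀ (y : Euc d) (t : ℝ), inner ℝ e (y + t • e) = inner ℝ e y + t := fun y t => by
    rw [inner_add_right, inner_smul_right, real_inner_self_eq_norm_sq, he]
    ring
  have hcl : ∀ y ∈ closure U, dist y x₀ ≤ r / 2 ∧ γ (y - inner ℝ e y • e) ≤ inner ℝ e y := by
    intro y hy
    have hclosed : IsClosed {y : Euc d | dist y x₀ ≤ r / 2 ∧
        γ (y - inner ℝ e y • e) ≤ inner ℝ e y} := by
      refine IsClosed.and (isClosed_le (continuous_id.dist continuous_const) continuous_const)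
        (isClosed_le ?_ (continuous_const.inner continuous_id))
      have hc : Continuous fun y : Euc d => y - inner ℝ e y • e := by fun_prop
      exact hγ.continuous.comp hc
    refine closure_minimal (fun y hy => ?_) hclosed hy
    have h1 : dist y x₀ < r / 2 := hy.1
    exact ⟨h1.le, ((hgraph y (Metric.mem_ball.2 (by linarith))).1 hy.2).le⟩
  have hshift : ∀ y, dist y x₀ ≤ r / 2 → ∀ t ∈ Ico (0 : ℝ) (r / 2),
      y + t • e ∈ Metric.ball x₀ r := fun y hy t ht => by
    have h1 : dist (y + t • e) y = t := by
      rw [dist_eq_norm, add_sub_cancel_left, norm_smul, he, mul_one, Real.norm_of_nonneg ht.1]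
    rw [Metric.mem_ball]
    have := dist_triangle (y + t • e) y x₀
    linarith [ht.2]
  -- On the closure the graph inequality is only weak. Moving along `e` leaves the argument of `γ`
  -- unchanged and makes the inequality strict; the halved radii keep the point in the chart.
  have hstrict : ∀ y ∈ closure U, ∀ t ∈ Ioo (0 : ℝ) (r / 2), y + t • e ∈ ω := fun y hy t ht => by
    obtain ⟨h1, h2⟩ := hcl y hy
    rw [hgraph _ (hshift y h1 t ⟨ht.1.le, ht.2⟩), hproj, hinn]
    linarith [ht.1]
  have hc0 : Tendsto (fun δ : ℝ => 2 * (ENNReal.ofReal (δ ^ 2) * C)) (𝓝[>] 0) (𝓝 0) := by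
    have := ENNReal.Tendsto.const_mul (a := 2) (tendsto_ofReal_sq_mul hC) (Or.inr (by simp))
    simpa using this
  refine tendsto_zero_of_forall_le_add
    (b := fun k t => 2 * sqInt ((fun x => x + t • e) '' closure U) (w k)) hc0
    (r := r / 2) (by positivity) ?_ ?_
  · intro t ht
    have hK : IsCompact ((fun x : Euc d => x + t • e) '' closure U) :=
      (Metric.isCompact_of_isClosed_isBounded isClosed_closure
        (Metric.isBounded_ball.subset inter_subset_left).closure).image
        (continuous_id.add continuous_const)
    have := ENNReal.Tendsto.const_mul (a := 2) (tendsto_sqInt_of_isCompact hω hb h hC hwC hGC h0 hK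
      (by rintro _ ⟨y, hy, rfl⟩; exact hstrict y hy t ht)) (Or.inr (by simp))
    simpa using this
  · intro t ht k
    have hseg : ∀ x ∈ U, ∀ s ∈ Icc (0 : ℝ) 1, x + s • (t • e) ∈ ω := fun x hx s hs => by
      rw [smul_smul]
      rcases hs.1.eq_or_lt with h1 | h1
      · rw [← h1]; simpa using hx.2
      · exact hstrict x (subset_closure hx) _ ⟨mul_pos h1 ht.1,
          (mul_le_of_le_one_left ht.1.le hs.2).trans_lt ht.2⟩
    have b1 := (h k).sqInt_translate_sub_le hω hb hU hseg
    rw [norm_smul, he, mul_one, Real.norm_of_nonneg ht.1.le] at b1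
    have b2 : sqInt U (fun x => w k (x + t • e))
        ≤ sqInt ((fun x => x + t • e) '' closure U) (w k) := by
      rw [sqInt_translate]
      exact sqInt_mono_set (t := (fun x => x + t • e) '' closure U)
        (fun x hx => ⟨x - t • e, subset_closure hx, by simp⟩) _
    have mD : MemLp (fun x => w k x - w k (x + t • e)) 2 (volume.restrict U) :=
      ((h k).1.mono_measure (Measure.restrict_mono inter_subset_right le_rfl)).sub
        (memLp_translate hω.measurableSet (h k).1 fun x hx => by
          simpa using hseg x hx 1 (by simp))
    have b3 : sqInt U (fun x => w k x - w k (x + t • e))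
        = sqInt U (fun x => w k (x + t • e) - w k x) :=
      lintegral_congr fun x => by rw [← enorm_neg, neg_sub]
    have b4 := sqInt_add_le (v := fun x => w k (x + t • e)) mD.1
    have e1 : (fun x => w k x - w k (x + t • e)) + (fun x => w k (x + t • e)) = w k := by
      ext x; simp
    rw [e1, b3] at b4
    exact b4.trans (add_le_add (mul_le_mul' le_rfl (b1.trans (mul_le_mul' le_rfl (hGC k))))
      (mul_le_mul' le_rfl b2))

theorem tendsto_sqInt_of_weakly_null (hω : IsLipschitzDomain ω)
    (h : ∀ k, IsH1Pair ω (w k) (G k)) (hC : C ≠ ⊤) (hwC : ∀ k, sqInt ω (w k) ≤ C)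
    (hGC : ∀ k, sqInt ω (G k) ≤ C)
    (h0 : ∀ H, MemLp H 2 (volume.restrict ω) →
      Tendsto (fun k => ∫ x in ω, inner ℝ (w k x) (H x)) atTop (𝓝 0)) :
    Tendsto (fun k => sqInt ω (w k)) atTop (𝓝 0) := by
  have := tendsto_sqInt_of_isCompact_of_locally (w := w) (S := ω)
    (Metric.isCompact_of_isClosed_isBounded isClosed_closure hω.isBounded.closure) fun x hx => by
    by_cases hxω : x ∈ ω
    · obtain ⟨R, hR, hball⟩ := Metric.isOpen_iff.1 hω.isOpen x hxω
      refine ⟨R / 2, by positivity, ?_⟩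
      have hsub : Metric.ball x (R / 2) ⊆ ω :=
        (Metric.ball_subset_ball (by linarith)).trans hball
      rw [inter_eq_left.2 hsub]
      exact tendsto_sqInt_ball hω.isOpen hω.isBounded h hC hwC hGC h0 (by positivity)
        (by rwa [mul_div_cancel₀ _ two_ne_zero])
    · exact tendsto_sqInt_boundary hω.isOpen hω.isBounded h hC hwC hGC h0 hω.lipschitz
        (by rw [hω.isOpen.frontier_eq]; exact ⟨hx, hxω⟩)
  rwa [inter_eq_right.2 subset_closure] at this

/-- Rellich's theorem on a Lipschitz domain, with weak convergence of the gradients. -/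
theorem exists_subseq_rellich (hω : IsLipschitzDomain ω)
    (h : ∀ k, IsH1Pair ω (w k) (G k)) (hC : C ≠ ⊤) (hwC : ∀ k, sqInt ω (w k) ≤ C)
    (hGC : ∀ k, sqInt ω (G k) ≤ C) :
    ∃ s : ℕ → ℕ, StrictMono s ∧ ∃ w₀ G₀, IsH1Pair ω w₀ G₀ ∧
      Tendsto (fun k => sqInt ω (w (s k) - w₀)) atTop (𝓝 0) ∧
      ∀ H, MemLp H 2 (volume.restrict ω) → Tendsto (fun k => ∫ x in ω, inner ℝ (G (s k) x) (H x))
        atTop (𝓝 (∫ x in ω, inner ℝ (G₀ x) (H x))) := by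
  obtain ⟨s, hs, w₀, hw₀, hlim⟩ := exists_subseq_weak_limit (fun k => (h k).1) hC hwC
  obtain ⟨t, ht, G₀, hG₀, hlim'⟩ := exists_subseq_weak_limit (fun k => (h (s k)).2.1) hC
    fun k => hGC (s k)
  have hlim2 : ∀ H, MemLp H 2 (volume.restrict ω) →
      Tendsto (fun k => ∫ x in ω, inner ℝ (w (s (t k)) x) (H x)) atTop
        (𝓝 (∫ x in ω, inner ℝ (w₀ x) (H x))) :=
    fun H hH => (hlim H hH).comp ht.tendsto_atTop
  have hp₀ := isH1Pair_of_weak_limit (fun k => h (s (t k))) hw₀ hG₀ hlim2 hlim'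
  refine ⟨s ∘ t, hs.comp ht, w₀, G₀, hp₀, ?_, hlim'⟩
  have e1 : ∀ {E : Type} [NormedAddCommGroup E] (u v : Euc d → E),
      AEStronglyMeasurable u (volume.restrict ω) →
      sqInt ω (u - v) ≤ 2 * sqInt ω u + 2 * sqInt ω v := fun u v hu => by
    have := sqInt_add_le (v := -v) hu
    rw [← sub_eq_add_neg] at this
    refine this.trans_eq ?_
    simp [sqInt]
  -- Subtracting the weak limit makes the sequence weakly null; the constant bounds both the
  -- functions and the gradients after the subtraction.
  refine tendsto_sqInt_of_weakly_null hω (C := 2 * C + 2 * (sqInt ω w₀ + sqInt ω G₀))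
    (fun k => (h (s (t k))).sub hp₀) ?_ (fun k => ?_) (fun k => ?_) fun H hH => ?_
  · exact ENNReal.add_ne_top.2 ⟨ENNReal.mul_ne_top (by simp) hC, ENNReal.mul_ne_top (by simp)
      (ENNReal.add_ne_top.2 ⟨(sqInt_lt_top hw₀).ne, (sqInt_lt_top hG₀).ne⟩)⟩
  · refine (e1 _ _ (h (s (t k))).1.1).trans ?_
    gcongr
    · exact hwC _
    · exact le_self_add
  · refine (e1 _ _ (h (s (t k))).2.1.1).trans ?_
    gcongr
    · exact hGC _
    · exact le_add_self
  · have h1 := (hlim2 H hH).sub_const (∫ x in ω, inner ℝ (w₀ x) (H x))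
    rw [sub_self] at h1
    refine h1.congr fun k => ?_
    rw [← integral_sub (integrable_inner (h (s (t k))).1 hH) (integrable_inner hw₀ hH)]
    refine integral_congr_ae (Eventually.of_forall fun x => ?_)
    simp only [Function.comp, Pi.sub_apply, inner_sub_left]

end Rellich

/-! ### The energy form -/

theorem IsCoeff.mono {ω ω' : Set (Euc d)} (hs : ω' ⊆ ω) {A : Euc d → Matrix (Fin d) (Fin d) ℝ}
    {α β : ℝ} (hA : IsCoeff ω A α β) : IsCoeff ω' A α β :=
  ⟨hA.pos, hA.lt, fun i j => (hA.meas i j).mono_measure (Measure.restrict_mono hs le_rfl),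
    ae_restrict_of_ae_restrict_of_subset hs hA.symm,
    ae_restrict_of_ae_restrict_of_subset hs hA.elliptic⟩

/-- The product of a matrix with a vector of Euclidean space. -/
def cMul (M : Matrix (Fin d) (Fin d) ℝ) (ξ : Euc d) : Euc d :=
  WithLp.toLp 2 fun i => ∑ j, M i j * ξ j

theorem inner_cMul (M : Matrix (Fin d) (Fin d) ℝ) (ξ η : Euc d) :
    inner ℝ (cMul M ξ) η = ∑ i, ∑ j, M i j * ξ j * η i := by
  simp only [cMul, PiLp.inner_apply, RCLike.inner_apply, RCLike.conj_to_real, Finset.mul_sum]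
  exact Finset.sum_congr rfl fun i _ => Finset.sum_congr rfl fun j _ => by ring

theorem cMul_add (M : Matrix (Fin d) (Fin d) ℝ) (ξ η : Euc d) :
    cMul M (ξ + η) = cMul M ξ + cMul M η := by
  ext i
  simp [cMul, mul_add, Finset.sum_add_distrib]

theorem cMul_smul (M : Matrix (Fin d) (Fin d) ℝ) (c : ℝ) (ξ : Euc d) :
    cMul M (c • ξ) = c • cMul M ξ := by
  ext i
  simp only [cMul, PiLp.smul_apply, smul_eq_mul, Finset.mul_sum]
  exact Finset.sum_congr rfl fun j _ => by ring

theorem inner_cMul_comm {M : Matrix (Fin d) (Fin d) ℝ} (hM : M.IsSymm) (ξ η : Euc d) :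
    inner ℝ (cMul M ξ) η = inner ℝ (cMul M η) ξ := by
  rw [inner_cMul, inner_cMul, Finset.sum_comm]
  exact Finset.sum_congr rfl fun i _ => Finset.sum_congr rfl fun j _ => by
    rw [hM.apply i j]; ring

theorem inner_cMul_self_mem {M : Matrix (Fin d) (Fin d) ℝ} {α β : ℝ}
    (hM : ∀ ξ : Fin d → ℝ, α * ∑ i, ξ i ^ 2 ≤ ∑ i, ∑ j, M i j * ξ i * ξ j ∧
      ∑ i, ∑ j, M i j * ξ i * ξ j ≤ β * ∑ i, ξ i ^ 2) (ξ : Euc d) :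
    α * ‖ξ‖ ^ 2 ≤ inner ℝ (cMul M ξ) ξ ∧ inner ℝ (cMul M ξ) ξ ≤ β * ‖ξ‖ ^ 2 := by
  have h := hM ξ
  have e : ∑ i, ∑ j, M i j * ξ i * ξ j = inner ℝ (cMul M ξ) ξ := by
    rw [inner_cMul]
    exact Finset.sum_congr rfl fun i _ => Finset.sum_congr rfl fun j _ => by ring
  rw [e, ← EuclideanSpace.real_norm_sq_eq] at h
  exact h

/-- For a symmetric positive matrix the bound on the quadratic form also bounds the operator norm.
This gives the boundedness of `A` on L² vector fields. -/
theorem norm_cMul_le {M : Matrix (Fin d) (Fin d) ℝ} (hs : M.IsSymm) {α β : ℝ} (hα : 0 < α)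
    (hαβ : α < β)
    (hM : ∀ ξ : Fin d → ℝ, α * ∑ i, ξ i ^ 2 ≤ ∑ i, ∑ j, M i j * ξ i * ξ j ∧
      ∑ i, ∑ j, M i j * ξ i * ξ j ≤ β * ∑ i, ξ i ^ 2) (ξ : Euc d) :
    ‖cMul M ξ‖ ≤ β * ‖ξ‖ := by
  set η := cMul M ξ with hη
  have hβ : 0 < β := hα.trans hαβ
  have h1 := inner_cMul_self_mem hM ξ
  have h2 := inner_cMul_self_mem hM η
  have hcs : ∀ t : ℝ, 0 ≤ inner ℝ (cMul M ξ) ξ + 2 * t * ‖η‖ ^ 2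
      + t ^ 2 * inner ℝ (cMul M η) η := fun t => by
    have h3 := (inner_cMul_self_mem hM (ξ + t • η)).1
    have e : inner ℝ (cMul M (ξ + t • η)) (ξ + t • η) = inner ℝ (cMul M ξ) ξ + 2 * t * ‖η‖ ^ 2
      + t ^ 2 * inner ℝ (cMul M η) η := by
      rw [cMul_add, cMul_smul, inner_add_left, inner_add_right, inner_add_right,
        inner_smul_left, inner_smul_left, inner_smul_right, inner_smul_right,
        inner_cMul_comm hs η ξ, ← hη, real_inner_self_eq_norm_sq]
      simp only [RCLike.conj_to_real]
      ring
    rw [e] at h3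
    exact le_trans (by positivity) h3
  -- This value of `t` minimizes the quadratic `β‖ξ‖² + 2t‖η‖² + t²β‖η‖²` that dominates the form at
  -- `ξ + t • η`.
  have h4 := hcs (-(1 / β))
  have h5 : ‖η‖ ^ 2 ≤ (β * ‖ξ‖) ^ 2 := by
    have h6 : 0 ≤ β * ‖ξ‖ ^ 2 + 2 * -(1 / β) * ‖η‖ ^ 2 + (-(1 / β)) ^ 2 * (β * ‖η‖ ^ 2) := by
      nlinarith [h1.2, h2.2, sq_nonneg (1 / β)]
    have h7 : β * ‖ξ‖ ^ 2 + 2 * -(1 / β) * ‖η‖ ^ 2 + (-(1 / β)) ^ 2 * (β * ‖η‖ ^ 2)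
        = ((β * ‖ξ‖) ^ 2 - ‖η‖ ^ 2) / β := by
      field_simp
      ring
    rw [h7] at h6
    have := mul_nonneg h6 hβ.le
    rw [div_mul_cancel₀ _ hβ.ne'] at this
    linarith
  exact (abs_le_of_sq_le_sq' h5 (by positivity)).2

theorem IsCoeff.memLp_cMul {ω : Set (Euc d)} {A : Euc d → Matrix (Fin d) (Fin d) ℝ}
    {α β : ℝ} (hA : IsCoeff ω A α β) {G : Euc d → Euc d} (hG : MemLp G 2 (volume.restrict ω)) :
    MemLp (fun x => cMul (A x) (G x)) 2 (volume.restrict ω) := by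
  have hm : AEStronglyMeasurable (fun x => cMul (A x) (G x)) (volume.restrict ω) := by
    refine (PiLp.continuous_toLp 2 (fun _ : Fin d => ℝ)).comp_aestronglyMeasurable
      (AEMeasurable.aestronglyMeasurable ?_)
    refine aemeasurable_pi_lambda _ fun i => Finset.aemeasurable_fun_sum _ fun j _ =>
      (hA.meas i j).mul ?_
    exact (EuclideanSpace.proj (𝕜 := ℝ) j).continuous.measurable.comp_aemeasurable
      hG.1.aemeasurable
  refine hG.of_le_mul (c := β) hm ?_
  filter_upwards [hA.symm, hA.elliptic] with x h1 h2
  exact norm_cMul_le h1 hA.pos hA.lt h2 _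

/-- The energy `∫_ω A G · H` of two vector fields. -/
def energy (A : Euc d → Matrix (Fin d) (Fin d) ℝ) (ω : Set (Euc d)) (G H : Euc d → Euc d) : ℝ :=
  ∫ x in ω, inner ℝ (cMul (A x) (G x)) (H x)

theorem energy_congr {A : Euc d → Matrix (Fin d) (Fin d) ℝ} {ω : Set (Euc d)}
    {G G' H H' : Euc d → Euc d} (hG : G =ᵐ[volume.restrict ω] G')
    (hH : H =ᵐ[volume.restrict ω] H') : energy A ω G H = energy A ω G' H' :=
  integral_congr_ae (by filter_upwards [hG, hH] with x h1 h2; rw [h1, h2])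

theorem aForm_eq_energy {A : Euc d → Matrix (Fin d) (Fin d) ℝ} {ω : Set (Euc d)} (hω : IsOpen ω)
    {u v : Euc d → ℝ} {G H : Euc d → Euc d} (hu : IsH1Pair ω u G) (hv : IsH1Pair ω v H) :
    aForm A ω u v = energy A ω G H := by
  rw [← energy_congr (hu.weakGrad_ae hω) (hv.weakGrad_ae hω)]
  exact integral_congr_ae (Eventually.of_forall fun x => (inner_cMul _ _ _).symm)

theorem energy_comm {A : Euc d → Matrix (Fin d) (Fin d) ℝ} {ω : Set (Euc d)} {α β : ℝ}
    (hA : IsCoeff ω A α β) (G H : Euc d → Euc d) : energy A ω G H = energy A ω H G :=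
  integral_congr_ae (by filter_upwards [hA.symm] with x hx; exact inner_cMul_comm hx _ _)

theorem energy_add_left {A : Euc d → Matrix (Fin d) (Fin d) ℝ} {ω : Set (Euc d)} {α β : ℝ}
    (hA : IsCoeff ω A α β) {G G' H : Euc d → Euc d} (hG : MemLp G 2 (volume.restrict ω))
    (hG' : MemLp G' 2 (volume.restrict ω)) (hH : MemLp H 2 (volume.restrict ω)) :
    energy A ω (G + G') H = energy A ω G H + energy A ω G' H := by
  rw [energy, energy, energy, ← integral_add (integrable_inner (hA.memLp_cMul hG) hH)
    (integrable_inner (hA.memLp_cMul hG') hH)]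
  exact integral_congr_ae (Eventually.of_forall fun x => by
    simp only [Pi.add_apply, cMul_add, inner_add_left])

theorem energy_smul_left (A : Euc d → Matrix (Fin d) (Fin d) ℝ) (ω : Set (Euc d)) (c : ℝ)
    (G H : Euc d → Euc d) : energy A ω (c • G) H = c * energy A ω G H := by
  rw [energy, energy, ← integral_const_mul]
  exact integral_congr_ae (Eventually.of_forall fun x => by
    simp only [Pi.smul_apply, cMul_smul, inner_smul_left, RCLike.conj_to_real])

theorem energy_self_bounds {A : Euc d → Matrix (Fin d) (Fin d) ℝ} {ω : Set (Euc d)} {α β : ℝ}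
    (hA : IsCoeff ω A α β) {G : Euc d → Euc d} (hG : MemLp G 2 (volume.restrict ω)) :
    α * (sqInt ω G).toReal ≤ energy A ω G G ∧ energy A ω G G ≤ β * (sqInt ω G).toReal := by
  have i1 := hG.integrable_norm_pow (p := 2) (by norm_num)
  have i2 := integrable_inner (hA.memLp_cMul hG) hG
  rw [← integral_norm_sq_eq_toReal hG, ← integral_const_mul, ← integral_const_mul]
  refine ⟨integral_mono_ae (i1.const_mul α) i2 ?_, integral_mono_ae i2 (i1.const_mul β) ?_⟩
  · filter_upwards [hA.elliptic] with x hx using (inner_cMul_self_mem hx _).1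
  · filter_upwards [hA.elliptic] with x hx using (inner_cMul_self_mem hx _).2

section aForm

variable {A : Euc d → Matrix (Fin d) (Fin d) ℝ} {ω : Set (Euc d)} {α β : ℝ}

theorem InH1.add {u v : Euc d → ℝ} (hu : InH1 ω u) (hv : InH1 ω v) : InH1 ω (u + v) :=
  (hu.isH1Pair.add hv.isH1Pair).inH1

theorem InH1.sub {u v : Euc d → ℝ} (hu : InH1 ω u) (hv : InH1 ω v) : InH1 ω (u - v) :=
  (hu.isH1Pair.sub hv.isH1Pair).inH1

theorem InH1.smul {u : Euc d → ℝ} (c : ℝ) (hu : InH1 ω u) : InH1 ω (c • u) :=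
  (hu.isH1Pair.smul c).inH1

theorem aForm_comm (hω : IsOpen ω) (hA : IsCoeff ω A α β) {u v : Euc d → ℝ} (hu : InH1 ω u)
    (hv : InH1 ω v) : aForm A ω u v = aForm A ω v u := by
  rw [aForm_eq_energy hω hu.isH1Pair hv.isH1Pair, aForm_eq_energy hω hv.isH1Pair hu.isH1Pair,
    energy_comm hA]

theorem aForm_add_left (hω : IsOpen ω) (hA : IsCoeff ω A α β) {u v w : Euc d → ℝ}
    (hu : InH1 ω u) (hv : InH1 ω v) (hw : InH1 ω w) :
    aForm A ω (u + v) w = aForm A ω u w + aForm A ω v w := by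
  rw [aForm_eq_energy hω (hu.isH1Pair.add hv.isH1Pair) hw.isH1Pair,
    aForm_eq_energy hω hu.isH1Pair hw.isH1Pair, aForm_eq_energy hω hv.isH1Pair hw.isH1Pair,
    energy_add_left hA hu.isH1Pair.2.1 hv.isH1Pair.2.1 hw.isH1Pair.2.1]

theorem aForm_smul_left (hω : IsOpen ω) (c : ℝ) {u w : Euc d → ℝ}
    (hu : InH1 ω u) (hw : InH1 ω w) : aForm A ω (c • u) w = c * aForm A ω u w := by
  rw [aForm_eq_energy hω (hu.isH1Pair.smul c) hw.isH1Pair,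
    aForm_eq_energy hω hu.isH1Pair hw.isH1Pair, energy_smul_left]

theorem aForm_add_right (hω : IsOpen ω) (hA : IsCoeff ω A α β) {u v w : Euc d → ℝ}
    (hu : InH1 ω u) (hv : InH1 ω v) (hw : InH1 ω w) :
    aForm A ω w (u + v) = aForm A ω w u + aForm A ω w v := by
  rw [aForm_comm hω hA hw (hu.add hv), aForm_add_left hω hA hu hv hw, aForm_comm hω hA hu hw,
    aForm_comm hω hA hv hw]

theorem aForm_smul_right (hω : IsOpen ω) (hA : IsCoeff ω A α β) (c : ℝ) {u w : Euc d → ℝ}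
    (hu : InH1 ω u) (hw : InH1 ω w) : aForm A ω w (c • u) = c * aForm A ω w u := by
  rw [aForm_comm hω hA hw (hu.smul c), aForm_smul_left hω c hu hw, aForm_comm hω hA hu hw]

theorem aForm_self_bounds (hω : IsOpen ω) (hA : IsCoeff ω A α β) {u : Euc d → ℝ}
    {G : Euc d → Euc d} (h : IsH1Pair ω u G) :
    α * (sqInt ω G).toReal ≤ aForm A ω u u ∧ aForm A ω u u ≤ β * (sqInt ω G).toReal := by
  rw [aForm_eq_energy hω h h]
  exact energy_self_bounds hA h.2.1

theorem aForm_self_nonneg (hω : IsOpen ω) (hA : IsCoeff ω A α β) {u : Euc d → ℝ}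
    (hu : InH1 ω u) : 0 ≤ aForm A ω u u :=
  (mul_nonneg hA.pos.le ENNReal.toReal_nonneg).trans (aForm_self_bounds hω hA hu.isH1Pair).1

theorem exists_const_of_aForm_eq_zero (hω : IsLipschitzDomain ω) (hA : IsCoeff ω A α β)
    {u : Euc d → ℝ} (hu : InH1 ω u) (h0 : aForm A ω u u = 0) :
    ∃ c : ℝ, u =ᵐ[volume.restrict ω] fun _ => c := by
  have hp := hu.isH1Pair
  have h1 := (aForm_self_bounds hω.isOpen hA hp).1
  rw [h0] at h1
  have h2 : (sqInt ω (weakGrad ω u)).toReal = 0 :=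
    le_antisymm (nonpos_of_mul_nonpos_right h1 hA.pos) ENNReal.toReal_nonneg
  rw [ENNReal.toReal_eq_zero_iff, or_iff_left (sqInt_lt_top hp.2.1).ne, sqInt,
    lintegral_eq_zero_iff' (hp.2.1.1.enorm.pow_const 2)] at h2
  have h3 : weakGrad ω u =ᵐ[volume.restrict ω] 0 := by
    filter_upwards [h2] with x hx
    simpa using hx
  exact (hp.congr (ae_eq_refl _) h3).exists_const hω.isOpen hω.isConnected hω.isBounded

end aForm

/-- A `C¹` function vanishing off a bounded open set, with vanishing gradient, is zero. -/
theorem IsCutoff.aForm_pos [Nontrivial (Euc d)] {A : Euc d → Matrix (Fin d) (Fin d) ℝ}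
    {ω : Set (Euc d)} {α β : ℝ} (hω : IsOpen ω) (hb : Bornology.IsBounded ω)
    (hA : IsCoeff ω A α β) {χ : Euc d → ℝ} (hχ : IsCutoff ω χ) : 0 < aForm A ω χ χ := by
  have hp : IsH1Pair ω χ (cgrad χ) := by
    refine (hχ.isH1Pair_mul hω hb (isH1Pair_const hb 1)).congr ?_ ?_
    · exact Eventually.of_forall fun x => by simp
    · exact Eventually.of_forall fun x => by simp
  have h1 := (aForm_self_bounds hω hA hp).1
  refine lt_of_lt_of_le (mul_pos hA.pos ?_) h1
  refine ENNReal.toReal_pos (fun h2 => ?_) (sqInt_lt_top hp.2.1).ne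
  rw [sqInt, lintegral_eq_zero_iff' (hp.2.1.1.enorm.pow_const 2)] at h2
  have hcont : ContinuousOn (fderiv ℝ χ) ω := hχ.contDiffOn.continuousOn_fderiv_of_isOpen hω le_rfl
  have h3 : EqOn (fderiv ℝ χ) (fun _ => 0) ω := by
    refine Measure.eqOn_open_of_ae_eq (μ := volume) ?_ hω hcont continuousOn_const
    filter_upwards [h2] with x hx
    simpa [norm_cgrad, ← norm_eq_zero (a := cgrad χ x)] using hx
  obtain ⟨x₀, hx₀⟩ := hχ.nontrivial
  -- Every point of this level set lies in `ω`, because the value is not zero there, and `χ` is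
  -- constant near it. A clopen set is empty or the whole space, and the latter would make `ω`
  -- unbounded.
  have hclopen : IsClopen {x | χ x = χ x₀} := by
    refine ⟨isClosed_eq hχ.cont continuous_const, ?_⟩
    rw [Metric.isOpen_iff]
    intro x hx
    have hxω : x ∈ ω := by_contra fun hn => hx₀ (by
      have hx' : χ x = χ x₀ := hx
      rw [← hx', hχ.eq_zero x hn])
    obtain ⟨r, hr, hball⟩ := Metric.isOpen_iff.1 hω x hxω
    refine ⟨r, hr, fun y hy => ?_⟩
    have hd : DifferentiableOn ℝ χ (Metric.ball x r) :=
      (hχ.contDiffOn.differentiableOn one_ne_zero).mono hball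
    have := Metric.isOpen_ball.is_const_of_fderiv_eq_zero
      (Metric.isPreconnected_ball) hd
      (fun z hz => h3 (hball hz)) hy (Metric.mem_ball_self hr)
    exact this.trans hx
  rcases isClopen_iff.1 hclopen with h4 | h4
  · have : x₀ ∈ {x | χ x = χ x₀} := rfl
    rw [h4] at this
    exact this
  · have hu : (univ : Set (Euc d)) ⊆ ω := fun x _ => by_contra fun hn => hx₀ (by
      have : x ∈ {x | χ x = χ x₀} := by rw [h4]; trivial
      have hx' : χ x = χ x₀ := this
      rw [← hx', hχ.eq_zero x hn])
    have hbu := hb.subset hu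
    exact NormedSpace.unbounded_univ ℝ (Euc d) hbu

/-! ### An abstract eigenproblem for a pair of bilinear forms -/

section Abstract

variable {V : Type*} [AddCommGroup V] [Module ℝ V]

/-- A pair of symmetric positive semidefinite forms `a`, `b` for which `b` is compact relative to
`a` on the complement of a vector `e` spanning the kernel of `a`, up to the common null space
`N`. -/
structure IsCompactPair (a b : LinearMap.BilinForm ℝ V) (e : V) (N : Submodule ℝ V) : Prop where
  a_symm : ∀ u v, a u v = a v u
  b_symm : ∀ u v, b u v = b v u
  a_nonneg : ∀ u, 0 ≤ a u u
  b_nonneg : ∀ u, 0 ≤ b u u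
  a_one : ∀ v, a e v = 0
  b_one : 0 < b e e
  b_null : ∀ u ∈ N, ∀ v, b u v = 0
  ker : ∀ u, a u u = 0 → b u e = 0 → u ∈ N
  compact : ∀ u : ℕ → V, (∀ k, b (u k) e = 0) → (∀ k, a (u k) (u k) ≤ 1) →
    ∃ s : ℕ → ℕ, StrictMono s ∧ ∃ u₀, (∀ v, Tendsto (fun k => a (u (s k)) v) atTop (𝓝 (a u₀ v))) ∧
      Tendsto (fun k => b (u (s k) - u₀) (u (s k) - u₀)) atTop (𝓝 0)

theorem bilin_sq_le {b : LinearMap.BilinForm ℝ V} (hs : ∀ u v, b u v = b v u)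
    (hn : ∀ u, 0 ≤ b u u) (u v : V) : b u v ^ 2 ≤ b u u * b v v := by
  have h : ∀ t : ℝ, 0 ≤ b v v * (t * t) + 2 * b u v * t + b u u := fun t => by
    have := hn (u + t • v)
    simp only [map_add, map_smul, LinearMap.add_apply, LinearMap.smul_apply, smul_eq_mul,
      hs v u] at this
    linarith
  have := discrim_le_zero h
  rw [discrim] at this
  nlinarith

namespace IsCompactPair

variable {a b : LinearMap.BilinForm ℝ V} {e : V} {N : Submodule ℝ V}

theorem b_eq_zero_of_self (h : IsCompactPair a b e N) {u : V} (hu : b u u = 0) (v : V) :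
    b u v = 0 := by
  have := bilin_sq_le h.b_symm h.b_nonneg u v
  rw [hu, zero_mul] at this
  exact pow_eq_zero_iff two_ne_zero |>.1 (le_antisymm this (sq_nonneg _))

theorem tendsto_b (h : IsCompactPair a b e N) {u : ℕ → V} {u₀ : V}
    (hu : Tendsto (fun k => b (u k - u₀) (u k - u₀)) atTop (𝓝 0)) (v : V) :
    Tendsto (fun k => b (u k) v) atTop (𝓝 (b u₀ v)) := by
  rw [← tendsto_sub_nhds_zero_iff]
  have h1 : Tendsto (fun k => √(b (u k - u₀) (u k - u₀) * b v v)) atTop (𝓝 0) := by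
    have := (hu.mul_const (b v v)).sqrt
    simpa using this
  refine squeeze_zero_norm (fun k => ?_) h1
  rw [Real.norm_eq_abs]
  refine Real.abs_le_sqrt ?_
  rw [← LinearMap.sub_apply, ← map_sub]
  exact bilin_sq_le h.b_symm h.b_nonneg _ _

theorem tendsto_b_self (h : IsCompactPair a b e N) {u : ℕ → V} {u₀ : V}
    (hu : Tendsto (fun k => b (u k - u₀) (u k - u₀)) atTop (𝓝 0)) :
    Tendsto (fun k => b (u k) (u k)) atTop (𝓝 (b u₀ u₀)) := by
  have h1 := (hu.add ((h.tendsto_b hu u₀).const_mul 2)).sub_const (b u₀ u₀)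
  have e1 : 0 + 2 * b u₀ u₀ - b u₀ u₀ = b u₀ u₀ := by ring
  rw [e1] at h1
  refine h1.congr fun k => ?_
  simp only [map_sub, LinearMap.sub_apply, h.b_symm u₀ (u k)]
  ring

/-- Weak lower semicontinuity of the energy, from Cauchy–Schwarz for `a (u k) u₀`. -/
theorem a_self_le_one (h : IsCompactPair a b e N) {u : ℕ → V} {u₀ : V}
    (hle : ∀ k, a (u k) (u k) ≤ 1)
    (hu : ∀ v, Tendsto (fun k => a (u k) v) atTop (𝓝 (a u₀ v))) : a u₀ u₀ ≤ 1 := by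
  have h1 : a u₀ u₀ ^ 2 ≤ 1 * a u₀ u₀ := le_of_tendsto ((hu u₀).pow 2) <|
    Eventually.of_forall fun k => (bilin_sq_le h.a_symm h.a_nonneg _ _).trans
      (mul_le_mul_of_nonneg_right (hle k) (h.a_nonneg _))
  rcases (h.a_nonneg u₀).eq_or_lt with h0 | h0
  · linarith
  · rw [sq] at h1
    exact le_of_mul_le_mul_right h1 h0

/-- An unbounded sequence of values of `b` would contradict their convergence along a subsequence.
-/
theorem exists_bound (h : IsCompactPair a b e N) :
    ∃ C, 0 ≤ C ∧ ∀ u, b u e = 0 → a u u ≤ 1 → b u u ≤ C := by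
  by_contra! hcon
  choose u hu1 hu2 hu3 using fun k : ℕ => hcon k (Nat.cast_nonneg k)
  obtain ⟨s, hs, u₀, -, hlim⟩ := h.compact u hu1 hu2
  have h1 := h.tendsto_b_self hlim
  have h2 : Tendsto (fun k => ((s k : ℕ) : ℝ)) atTop atTop :=
    tendsto_natCast_atTop_atTop.comp hs.tendsto_atTop
  exact not_tendsto_nhds_of_tendsto_atTop (tendsto_atTop_mono (fun k => (hu3 (s k)).le) h2) _ h1

/-- Homogeneity reduces to the unit ball of `a`. Vectors with `a w w = 0` cannot be normalized, but
they are null because `b w e = 0`. -/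
theorem b_le_mul_a (h : IsCompactPair a b e N) {W : Submodule ℝ V} (hW : ∀ w ∈ W, b w e = 0)
    {C : ℝ} (hC : ∀ w ∈ W, a w w ≤ 1 → b w w ≤ C) {w : V} (hw : w ∈ W) :
    b w w ≤ C * a w w := by
  rcases (h.a_nonneg w).eq_or_lt with h0 | h0
  · rw [h.b_null w (h.ker w h0.symm (hW w hw)) w, ← h0, mul_zero]
  · have hsq : √(a w w) ^ 2 = a w w := Real.sq_sqrt h0.le
    have hs : 0 < √(a w w) := Real.sqrt_pos.2 h0
    have h1 := hC ((√(a w w))⁻¹ • w) (W.smul_mem _ hw) (by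
      simp only [map_smul, LinearMap.smul_apply, smul_eq_mul]
      rw [← mul_assoc, ← sq, inv_pow, hsq, inv_mul_cancel₀ h0.ne'])
    simp only [map_smul, LinearMap.smul_apply, smul_eq_mul] at h1
    rw [← mul_assoc, ← sq, inv_pow, hsq, inv_mul_le_iff₀ h0] at h1
    linarith

/-- A Poincaré-type inequality. -/
theorem exists_b_le (h : IsCompactPair a b e N) :
    ∃ C, 0 ≤ C ∧ ∀ u, b u e = 0 → b u u ≤ C * a u u := by
  obtain ⟨C, hC0, hC⟩ := h.exists_bound
  refine ⟨C, hC0, fun u hu => h.b_le_mul_a (W := LinearMap.ker (b.flip e)) ?_ ?_ ?_⟩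
  · exact fun w hw => hw
  · exact fun w hw h1 => hC w hw h1
  · exact hu

/-- `(lam k, v k)` are the first eigenpairs of the pair of forms. -/
structure FirstEigen (a b : LinearMap.BilinForm ℝ V) (N : Submodule ℝ V) {n : ℕ}
    (lam : Fin n → ℝ) (v : Fin n → V) : Prop where
  eigen : ∀ k φ, a (v k) φ = lam k * b (v k) φ
  indep : ∀ c : Fin n → ℝ, ∑ k, c k • v k ∈ N → c = 0
  mono : Monotone lam
  first : ∀ μ w, (∀ φ, a w φ = μ * b w φ) → w ∉ N → (∃ k, μ < lam k) →
    ∃ c : Fin n → ℝ, w - ∑ k, c k • v k ∈ N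

variable {n : ℕ} {lam : Fin n → ℝ} {v : Fin n → V}

theorem b_comb_left (b : LinearMap.BilinForm ℝ V) (v : Fin n → V) (c : Fin n → ℝ) (w : V) :
    b (∑ k, c k • v k) w = ∑ k, c k * b (v k) w := by
  simp [map_sum, LinearMap.sum_apply]

theorem a_comb_left (hv : FirstEigen a b N lam v) (c : Fin n → ℝ) (w : V) :
    a (∑ k, c k • v k) w = ∑ k, lam k * c k * b (v k) w := by
  rw [b_comb_left]
  exact Finset.sum_congr rfl fun k _ => by rw [hv.eigen]; ring

/-- If `b φ φ = 0` then `b φ` vanishes identically, and the eigenvalue equation gives `a φ φ = 0` as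
well. So `φ` is null, against independence. -/
theorem b_self_pos (h : IsCompactPair a b e N) (hv : FirstEigen a b N lam v) {c : Fin n → ℝ}
    (hc : c ≠ 0) : 0 < b (∑ k, c k • v k) (∑ k, c k • v k) := by
  refine (h.b_nonneg _).lt_of_ne fun h0 => hc (hv.indep c ?_)
  have hz := h.b_eq_zero_of_self h0.symm
  refine h.ker _ ?_ (hz e)
  rw [a_comb_left hv]
  refine Finset.sum_eq_zero fun k _ => ?_
  rw [h.b_symm, hz, mul_zero]

theorem lam_nonneg (h : IsCompactPair a b e N) (hv : FirstEigen a b N lam v) (k : Fin n) :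
    0 ≤ lam k := by
  have hb := h.b_self_pos hv (c := Pi.single k 1) (by simp)
  have e1 : ∑ j, (Pi.single k (1 : ℝ) : Fin n → ℝ) j • v j = v k := by
    simp [Pi.single_apply]
  rw [e1] at hb
  have h1 := h.a_nonneg (v k)
  rw [hv.eigen] at h1
  exact nonneg_of_mul_nonneg_left h1 hb

/-- If the first eigenvalue is 0, its eigenvector is a nonzero multiple of `e` modulo `N`. If it is
positive, `e` is an eigenvector with the smaller eigenvalue 0, and by `first` it cannot have been
skipped. -/
theorem exists_comb_one (h : IsCompactPair a b e N) (hv : FirstEigen a b N lam v) (hn : 1 ≤ n) :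
    ∃ c : Fin n → ℝ, e - ∑ k, c k • v k ∈ N := by
  set k : Fin n := ⟨0, hn⟩
  rcases (h.lam_nonneg hv k).eq_or_lt with h0 | h0
  -- With this `t`, the vector `v k - t • e` has zero energy and is `b`-orthogonal to `e`, so it is
  -- null.
  · set t := b (v k) e / b e e with ht
    have hbe : b e e ≠ 0 := h.b_one.ne'
    have hmem : v k - t • e ∈ N := by
      refine h.ker _ ?_ ?_
      · simp only [map_sub, map_smul, LinearMap.sub_apply, LinearMap.smul_apply, h.a_one, hv.eigen,
          ← h0, smul_eq_mul]
        ring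
      · simp only [map_sub, map_smul, LinearMap.sub_apply, LinearMap.smul_apply, smul_eq_mul, ht]
        field_simp
        ring
    have ht0 : t ≠ 0 := fun h1 => by
      rw [h1, zero_smul, sub_zero] at hmem
      have := hv.indep (Pi.single k 1) (by simpa [Pi.single_apply] using hmem)
      simp at this
    refine ⟨Pi.single k t⁻¹, ?_⟩
    have h2 := N.smul_mem (-t⁻¹) hmem
    convert h2 using 1
    simp [Pi.single_apply, smul_sub, smul_smul, inv_mul_cancel₀ ht0]
    abel
  · refine hv.first 0 e (fun φ => by rw [h.a_one, zero_mul]) (fun he => ?_) ⟨k, h0⟩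
    exact h.b_one.ne' (h.b_null e he e)

theorem b_one_eq_zero (h : IsCompactPair a b e N) (hv : FirstEigen a b N lam v) (hn : 1 ≤ n)
    {w : V} (hw : ∀ k, b w (v k) = 0) : b w e = 0 := by
  obtain ⟨c, hc⟩ := h.exists_comb_one hv hn
  have h1 := h.b_null _ hc w
  rw [map_sub, LinearMap.sub_apply, b_comb_left, sub_eq_zero] at h1
  rw [h.b_symm, h1]
  exact Finset.sum_eq_zero fun k _ => by rw [h.b_symm, hw, mul_zero]

/-- The Gram map of the eigenvectors is injective because `b` is definite on their combinations,
hence surjective by finite dimension. -/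
theorem exists_projection (h : IsCompactPair a b e N) (hv : FirstEigen a b N lam v) (u : V) :
    ∃ c : Fin n → ℝ, ∀ k, b (u - ∑ j, c j • v j) (v k) = 0 := by
  let T : (Fin n → ℝ) →ₗ[ℝ] (Fin n → ℝ) :=
    { toFun := fun c k => b (∑ j, c j • v j) (v k)
      map_add' := fun c c' => by
        ext k
        simp [add_smul, Finset.sum_add_distrib]
      map_smul' := fun t c => by
        ext k
        simp [mul_smul, ← Finset.smul_sum] }
  have hinj : Function.Injective T := by
    rw [injective_iff_map_eq_zero]
    intro c hc
    by_contra hne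
    refine (h.b_self_pos hv hne).ne' ?_
    rw [h.b_symm, b_comb_left]
    refine Finset.sum_eq_zero fun k _ => ?_
    have : T c k = 0 := by rw [hc]; rfl
    rw [h.b_symm]
    exact mul_eq_zero_of_right _ this
  obtain ⟨c, hc⟩ := LinearMap.injective_iff_surjective.1 hinj fun k => b u (v k)
  refine ⟨c, fun k => ?_⟩
  have : T c k = b u (v k) := congrFun hc k
  rw [map_sub, LinearMap.sub_apply, ← this]
  exact sub_self _

theorem a_eq_zero_of_b_orthogonal (hv : FirstEigen a b N lam v) (h : IsCompactPair a b e N)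
    {w : V} (hw : ∀ k, b w (v k) = 0) (c : Fin n → ℝ) : a (∑ k, c k • v k) w = 0 := by
  rw [a_comb_left hv]
  exact Finset.sum_eq_zero fun k _ => by rw [h.b_symm, hw, mul_zero]

theorem b_comb_eq_zero (h : IsCompactPair a b e N)
    {w : V} (hw : ∀ k, b w (v k) = 0) (c : Fin n → ℝ) : b (∑ k, c k • v k) w = 0 := by
  rw [b_comb_left]
  exact Finset.sum_eq_zero fun k _ => by rw [h.b_symm, hw, mul_zero]

/-- The minimum principle for the eigenvalue following the first `n` ones. -/
theorem lam_mul_b_le (h : IsCompactPair a b e N) (hv : FirstEigen a b N lam v) (hn : 1 ≤ n)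
    {w : V} (hw : ∀ k, b w (v k) = 0) (i : Fin n) : lam i * b w w ≤ a w w := by
  by_contra! hlt
  let W : Submodule ℝ V :=
    { carrier := {w | ∀ k, b w (v k) = 0}
      zero_mem' := fun k => by simp
      add_mem' := fun {x y} hx hy k => by simp [hx k, hy k]
      smul_mem' := fun t x hx k => by simp [hx k] }
  have hWe : ∀ w ∈ W, b w e = 0 := fun w hw => h.b_one_eq_zero hv hn hw
  obtain ⟨C, -, hC⟩ := h.exists_bound
  -- A maximizing sequence for `b` on the `a`-unit ball of `W` has a limit `u₀` by compactness: `b`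
  -- converges along it, `a` is lower semicontinuous, and `W` is closed for this convergence.
  set S : Set ℝ := {t | ∃ w ∈ W, a w w ≤ 1 ∧ b w w = t} with hS
  have hSne : S.Nonempty := ⟨0, 0, W.zero_mem, by simp, by simp⟩
  have hSb : BddAbove S := ⟨C, by rintro _ ⟨w, h1, h2, rfl⟩; exact hC w (hWe w h1) h2⟩
  obtain ⟨t, -, ht, htS⟩ := exists_seq_tendsto_sSup hSne hSb
  choose u hu1 hu2 hu3 using htS
  obtain ⟨s, hs, u₀, hlim, hlim'⟩ := h.compact u (fun k => hWe _ (hu1 k)) hu2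
  have hau := h.a_self_le_one (fun k => hu2 (s k)) hlim
  have hu₀ : u₀ ∈ W := fun k => tendsto_nhds_unique (h.tendsto_b hlim' (v k))
    (tendsto_const_nhds.congr fun j => (hu1 (s j) k).symm)
  have hbu : b u₀ u₀ = sSup S := by
    refine tendsto_nhds_unique (h.tendsto_b_self hlim') ?_
    exact (ht.comp hs.tendsto_atTop).congr fun k => (hu3 (s k)).symm
  set σ := sSup S
  have hσ : ∀ w ∈ W, b w w ≤ σ * a w w := fun w hw =>
    h.b_le_mul_a hWe (fun w hw h1 => le_csSup hSb ⟨w, hw, h1, rfl⟩) hw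
  have hσw := hσ w hw
  have hlam := h.lam_nonneg hv i
  have haw : 0 < a w w := by
    refine (h.a_nonneg w).lt_of_ne fun h0 => ?_
    rw [← h0, mul_zero] at hσw
    rw [← h0] at hlt
    nlinarith [h.b_nonneg w]
  -- The assumed violation at `w` makes the maximum exceed `1 / lam i`, so the eigenvalue `σ⁻¹` of
  -- the maximizer will lie below `lam i`.
  have hσ1 : 1 < lam i * σ := by
    have : lam i * b w w ≤ lam i * (σ * a w w) := mul_le_mul_of_nonneg_left hσw hlam
    by_contra! h1
    nlinarith
  have hσ0 : 0 < σ := by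
    by_contra! h1
    nlinarith
  have hbu' : b u₀ u₀ = σ * a u₀ u₀ := by
    refine le_antisymm (hσ u₀ hu₀) ?_
    rw [hbu]
    nlinarith
  -- The Euler–Lagrange equation: the form `σ a - b` is nonnegative on `W` and zero at `u₀`. The
  -- constant term of the quadratic in `x` is therefore 0, and the discriminant forces its linear
  -- term to vanish.
  have horth : ∀ φ ∈ W, σ * a u₀ φ - b u₀ φ = 0 := fun φ hφ => by
    have hq : ∀ x : ℝ, 0 ≤ (σ * a φ φ - b φ φ) * (x * x) + 2 * (σ * a u₀ φ - b u₀ φ) * x + 0 :=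
      fun x => by
        have := hσ (u₀ + x • φ) (W.add_mem hu₀ (W.smul_mem x hφ))
        simp only [map_add, map_smul, LinearMap.add_apply, LinearMap.smul_apply, smul_eq_mul,
          h.a_symm φ u₀, h.b_symm φ u₀] at this
        linarith
    have := discrim_le_zero hq
    rw [discrim] at this
    have h2 : (σ * a u₀ φ - b u₀ φ) ^ 2 ≤ 0 := by nlinarith
    exact pow_eq_zero_iff two_ne_zero |>.1 (le_antisymm h2 (sq_nonneg _))
  -- The equation extends from `W` to all `φ`: the component of `φ` in the span of the `v k` is
  -- orthogonal to `u₀` for both forms.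
  have heig : ∀ φ, a u₀ φ = σ⁻¹ * b u₀ φ := fun φ => by
    obtain ⟨c, hc⟩ := h.exists_projection hv φ
    have h1 := horth _ hc
    simp only [map_sub] at h1
    rw [h.a_symm u₀ (∑ k, c k • v k), a_eq_zero_of_b_orthogonal hv h hu₀,
      h.b_symm u₀ (∑ k, c k • v k), h.b_comb_eq_zero hu₀, sub_zero, sub_zero] at h1
    rw [eq_inv_mul_iff_mul_eq₀ hσ0.ne']
    linarith
  have hnot : u₀ ∉ N := fun h1 => by
    have := h.b_null _ h1 u₀
    rw [hbu] at this
    exact hσ0.ne' this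
  -- Since no eigenvector below `lam i` is skipped, `u₀` is a combination of the `v k` modulo `N`.
  -- Being also `b`-orthogonal to them, it has `b u₀ u₀ = 0`, against `σ > 0`.
  obtain ⟨c, hc⟩ := hv.first σ⁻¹ u₀ heig hnot ⟨i, by
    rw [inv_lt_iff_one_lt_mul₀ hσ0]; exact hσ1⟩
  have h3 := h.b_null _ hc u₀
  rw [map_sub, LinearMap.sub_apply, h.b_comb_eq_zero hu₀, sub_zero, hbu] at h3
  exact hσ0.ne' h3

/-- The difference of the two sides is `b` evaluated at the combination with coefficients `√(lam i -
lam k) * c k`, since eigenvectors with distinct eigenvalues are `b`-orthogonal. Thus no orthogonal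
basis within an eigenspace has to be chosen. -/
theorem a_comb_le (h : IsCompactPair a b e N) (hv : FirstEigen a b N lam v) {i : Fin n}
    (hi : ∀ k, lam k ≤ lam i) (c : Fin n → ℝ) :
    a (∑ k, c k • v k) (∑ k, c k • v k) ≤ lam i * b (∑ k, c k • v k) (∑ k, c k • v k) := by
  have hjk : ∀ j k, lam j * b (v j) (v k) = lam k * b (v j) (v k) := fun j k => by
    rw [← hv.eigen, h.a_symm, hv.eigen, h.b_symm]
  have h0 := h.b_nonneg (∑ k, (√(lam i - lam k) * c k) • v k)
  have e1 : lam i * b (∑ k, c k • v k) (∑ k, c k • v k)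
      - a (∑ k, c k • v k) (∑ k, c k • v k)
      = b (∑ k, (√(lam i - lam k) * c k) • v k) (∑ k, (√(lam i - lam k) * c k) • v k) := by
    rw [a_comb_left hv, b_comb_left, b_comb_left, Finset.mul_sum, ← Finset.sum_sub_distrib]
    refine Finset.sum_congr rfl fun j _ => ?_
    rw [h.b_symm (v j), b_comb_left, h.b_symm (v j), b_comb_left, Finset.mul_sum, Finset.mul_sum,
      Finset.mul_sum, Finset.mul_sum, ← Finset.sum_sub_distrib]
    refine Finset.sum_congr rfl fun k _ => ?_
    by_cases hl : lam j = lam k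
    · have hs : √(lam i - lam k) * √(lam i - lam k) = lam i - lam k :=
        Real.mul_self_sqrt (sub_nonneg.2 (hi k))
      rw [hl]
      linear_combination (-(c j * c k * b (v k) (v j))) * hs
    · have hb : b (v k) (v j) = 0 := by
        have := hjk k j
        have h2 : (lam k - lam j) * b (v k) (v j) = 0 := by linarith
        exact (mul_eq_zero.1 h2).resolve_left fun h3 => hl (by linarith)
      rw [hb]; ring
  linarith

/-- The dimension count behind the lower bound for the `n`-width. -/
theorem exists_test_vector (h : IsCompactPair a b e N) (hv : FirstEigen a b N lam v)
    (hn : 1 ≤ n) (L : V →ₗ[ℝ] (Fin (n - 1) → ℝ)) {w : V} (hw : ∀ k, b w (v k) = 0)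
    (haw : 0 < a w w) :
    ∃ u, b u e = 0 ∧ L u = 0 ∧ 0 < a u u ∧ b w w * a u u ≤ b u u * a w w := by
  let J : ((Fin n → ℝ) × ℝ) →ₗ[ℝ] V :=
    { toFun := fun p => ∑ k, p.1 k • v k + p.2 • w
      map_add' := fun p q => by
        simp only [Prod.fst_add, Prod.snd_add, Pi.add_apply, add_smul, Finset.sum_add_distrib]
        abel
      map_smul' := fun t p => by
        simp [mul_smul, Finset.smul_sum] }
  -- `n + 1` coefficients against `1 + (n - 1) = n` conditions: the kernel is nontrivial.
  let T : ((Fin n → ℝ) × ℝ) →ₗ[ℝ] ℝ × (Fin (n - 1) → ℝ) := ((b.flip e).prod L) ∘ₗ J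
  have hker : LinearMap.ker T ≠ ⊥ := by
    refine LinearMap.ker_ne_bot_of_finrank_lt ?_
    simp only [Module.finrank_prod, Module.finrank_fin_fun, Module.finrank_self]
    omega
  obtain ⟨⟨c, t⟩, hT, hne⟩ := Submodule.exists_mem_ne_zero_of_ne_bot hker
  set φ := ∑ k, c k • v k with hφ
  set u := φ + t • w with hu
  have hT' : (b u e, L u) = (0, 0) := hT
  have hbe : b u e = 0 := congrArg Prod.fst hT'
  have hLu : L u = 0 := congrArg Prod.snd hT'
  have hwe := h.b_one_eq_zero hv hn hw
  have haφ : a φ w = 0 := a_eq_zero_of_b_orthogonal hv h hw c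
  have hbφ : b φ w = 0 := h.b_comb_eq_zero hw c
  have hauu : a u u = a φ φ + t ^ 2 * a w w := by
    simp only [hu, map_add, map_smul, LinearMap.add_apply, LinearMap.smul_apply, smul_eq_mul,
      h.a_symm w φ, haφ]
    ring
  have hbuu : b u u = b φ φ + t ^ 2 * b w w := by
    simp only [hu, map_add, map_smul, LinearMap.add_apply, LinearMap.smul_apply, smul_eq_mul,
      h.b_symm w φ, hbφ]
    ring
  -- Nonzero coefficients give positive energy: `a u u = 0` forces `t = 0` because `a w w > 0`, and
  -- then `u` is a null combination of the `v k`, so `c = 0`.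
  refine ⟨u, hbe, hLu, (h.a_nonneg u).lt_of_ne fun h0 => hne ?_, ?_⟩
  · have h1 := h.a_nonneg φ
    have ht : t = 0 := by
      have h2 : t ^ 2 * a w w ≤ 0 := by linarith
      have h3 : t ^ 2 ≤ 0 := nonpos_of_mul_nonpos_left h2 haw
      exact pow_eq_zero_iff two_ne_zero |>.1 (le_antisymm h3 (sq_nonneg _))
    have huφ : u = φ := by rw [hu, ht, zero_smul, add_zero]
    have hc : c = 0 := by
      refine hv.indep c ?_
      rw [← hφ, ← huφ]
      exact h.ker u h0.symm hbe
    rw [hc, ht]; rfl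
  -- The largest listed eigenvalue separates the two parts: `a φ φ ≤ lam i * b φ φ` and `lam i * b w
  -- w ≤ a w w`. Chaining them avoids division by `lam i`, which may be zero.
  · set i : Fin n := ⟨n - 1, by omega⟩
    have hi : ∀ k, lam k ≤ lam i := fun k => hv.mono (Fin.le_def.2 (by
      have := k.2
      change (k : ℕ) ≤ n - 1
      omega))
    have h1 := h.a_comb_le hv hi c
    have h2 := h.lam_mul_b_le hv hn hw i
    rw [← hφ] at h1
    have h3 : a φ φ * b w w ≤ b φ φ * a w w := by
      calc a φ φ * b w w ≤ lam i * b φ φ * b w w :=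
            mul_le_mul_of_nonneg_right h1 (h.b_nonneg w)
        _ = b φ φ * (lam i * b w w) := by ring
        _ ≤ b φ φ * a w w := mul_le_mul_of_nonneg_left h2 (h.b_nonneg φ)
    rw [hauu, hbuu]
    nlinarith

end IsCompactPair

end Abstract

/-! ### `A`-harmonic functions -/

theorem aForm_congr {A : Euc d → Matrix (Fin d) (Fin d) ℝ} {ω : Set (Euc d)} (hω : IsOpen ω)
    {u u' v v' : Euc d → ℝ} (hu : InH1 ω u) (hv : InH1 ω v) (h : u =ᵐ[volume.restrict ω] u')
    (h' : v =ᵐ[volume.restrict ω] v') : aForm A ω u v = aForm A ω u' v' := by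
  rw [aForm_eq_energy hω hu.isH1Pair hv.isH1Pair,
    aForm_eq_energy hω (hu.isH1Pair.congr h (ae_eq_refl _)) (hv.isH1Pair.congr h' (ae_eq_refl _))]

theorem energy_indicator_right {A : Euc d → Matrix (Fin d) (Fin d) ℝ} {ω ω' : Set (Euc d)}
    (hω : MeasurableSet ω) (hs : ω ⊆ ω') (G H : Euc d → Euc d) :
    energy A ω' G (ω.indicator H) = energy A ω G H := by
  have : ∀ x, inner ℝ (cMul (A x) (G x)) (ω.indicator H x)
      = ω.indicator (fun x => inner ℝ (cMul (A x) (G x)) (H x)) x := fun x => by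
    by_cases hx : x ∈ ω <;> simp [hx]
  simp only [energy, this]
  rw [setIntegral_indicator hω, inter_eq_right.2 hs]

theorem InHA.mul_cutoff {A : Euc d → Matrix (Fin d) (Fin d) ℝ} {ω ωs : Set (Euc d)}
    (hω : IsOpen ω) (hωs : IsLipschitzDomain ωs) (hs : ω ⊆ ωs) {χ : Euc d → ℝ}
    (hχ : IsCutoff ω χ) {u : Euc d → ℝ} (hu : InHA A ωs u) : InH10 ω (χ * u) :=
  hχ.inH10_mul hω (hωs.isBounded.subset hs) (hu.1.isH1Pair.mono hωs.isOpen hs)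

/-- Caccioppoli's inequality. -/
theorem InHA.caccioppoli {A : Euc d → Matrix (Fin d) (Fin d) ℝ} {ω ωs : Set (Euc d)} {α β : ℝ}
    (hω : IsOpen ω) (hωs : IsLipschitzDomain ωs) (hs : ω ⊆ ωs) (hA : IsCoeff ωs A α β)
    {χ : Euc d → ℝ} (hχ : IsCutoff ω χ) {C : ℝ} (hC : ∀ x ∈ ω, ‖fderiv ℝ χ x‖ ≤ C)
    {u : Euc d → ℝ} (hu : InHA A ωs u) :
    aForm A ω (χ * u) (χ * u) ≤ β * C ^ 2 * (sqInt ω u).toReal := by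
  have hb := hωs.isBounded.subset hs
  have hAω := hA.mono hs
  have hβ : 0 < β := hA.pos.trans hA.lt
  set G := weakGrad ωs u
  have hp : IsH1Pair ωs u G := hu.1.isH1Pair
  have hpω := hp.mono hωs.isOpen hs
  have p1 := hχ.isH1Pair_mul hω hb hpω
  have p2 := hχ.isH1Pair_mul hω hb p1
  -- The test function for harmonicity is `χ² u`, extended by zero from `ω` to `ω*`.
  obtain ⟨p3, h3⟩ := (hχ.inH10_mul hω hb p1).extend hω hb hωs.isOpen hωs.isBounded hs p2
  have h4 := hu.2 _ h3
  rw [aForm_eq_energy hωs.isOpen hp p3, energy_indicator_right hω.measurableSet hs] at h4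
  rw [aForm_eq_energy hω p1 p1, ← sub_zero (energy _ _ _ _), ← h4, energy, energy,
    ← integral_sub (integrable_inner (hAω.memLp_cMul p1.2.1) p1.2.1)
      (integrable_inner (hAω.memLp_cMul hpω.2.1) p2.2.1),
    ← integral_norm_sq_eq_toReal hpω.1, ← integral_const_mul]
  refine integral_mono_ae ((integrable_inner (hAω.memLp_cMul p1.2.1) p1.2.1).sub
      (integrable_inner (hAω.memLp_cMul hpω.2.1) p2.2.1))
      ((hpω.1.integrable_norm_pow (p := 2) (by norm_num)).const_mul _) ?_
  filter_upwards [hAω.symm, hAω.elliptic, ae_restrict_mem hω.measurableSet] with x h1 h2 hx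
  -- The identity `A∇(χu)·∇(χu) - A∇u·∇(χ²u) = u² A∇χ·∇χ`. The second term integrates to zero, and
  -- no derivative of `u` remains on the right.
  have e1 : inner ℝ (cMul (A x) (χ x • G x + u x • cgrad χ x)) (χ x • G x + u x • cgrad χ x)
      - inner ℝ (cMul (A x) (G x))
        (χ x • (χ x • G x + u x • cgrad χ x) + (χ * u) x • cgrad χ x)
      = u x ^ 2 * inner ℝ (cMul (A x) (cgrad χ x)) (cgrad χ x) := by
    simp only [cMul_add, cMul_smul, inner_add_left, inner_add_right, inner_smul_left,
      inner_smul_right, RCLike.conj_to_real, Pi.mul_apply,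
      inner_cMul_comm h1 (cgrad χ x) (G x)]
    ring
  beta_reduce
  rw [e1, Real.norm_eq_abs, sq_abs]
  have h5 := (inner_cMul_self_mem h2 (cgrad χ x)).2
  have h6 : ‖cgrad χ x‖ ^ 2 ≤ C ^ 2 :=
    pow_le_pow_left₀ (norm_nonneg _) ((norm_cgrad χ x).trans_le (hC x hx)) 2
  calc u x ^ 2 * inner ℝ (cMul (A x) (cgrad χ x)) (cgrad χ x)
      ≤ u x ^ 2 * (β * C ^ 2) := by
        refine mul_le_mul_of_nonneg_left (h5.trans ?_) (sq_nonneg _)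
        exact mul_le_mul_of_nonneg_left h6 hβ.le
    _ = β * C ^ 2 * u x ^ 2 := by ring

/-- The space `H_A(ω*)`. -/
def haSpace {A : Euc d → Matrix (Fin d) (Fin d) ℝ} {ωs : Set (Euc d)} {α β : ℝ}
    (hωs : IsLipschitzDomain ωs) (hA : IsCoeff ωs A α β) : Submodule ℝ (Euc d → ℝ) where
  carrier := {u | InHA A ωs u}
  zero_mem' := by
    have hp : IsH1Pair ωs (0 : Euc d → ℝ) 0 := isH1Pair_const hωs.isBounded 0
    refine ⟨hp.inH1, fun φ hφ => ?_⟩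
    have := aForm_smul_left (A := A) hωs.isOpen 0 hp.inH1 hφ.1
    rwa [zero_smul, zero_mul] at this
  add_mem' := fun {u v} hu hv => ⟨hu.1.add hv.1, fun φ hφ => by
    rw [aForm_add_left hωs.isOpen hA hu.1 hv.1 hφ.1, hu.2 φ hφ, hv.2 φ hφ, add_zero]⟩
  smul_mem' := fun c u hu => ⟨hu.1.smul c, fun φ hφ => by
    rw [aForm_smul_left hωs.isOpen c hu.1 hφ.1, hu.2 φ hφ, mul_zero]⟩

theorem inHA_one {A : Euc d → Matrix (Fin d) (Fin d) ℝ} {ωs : Set (Euc d)}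
    (hωs : IsLipschitzDomain ωs) : InHA A ωs 1 := by
  have hp : IsH1Pair ωs (1 : Euc d → ℝ) 0 := isH1Pair_const hωs.isBounded 1
  refine ⟨hp.inH1, fun φ hφ => ?_⟩
  rw [aForm_eq_energy hωs.isOpen hp hφ.1.isH1Pair, energy]
  refine integral_eq_zero_of_ae (Eventually.of_forall fun x => ?_)
  have : cMul (A x) 0 = 0 := by ext i; simp [cMul]
  simp [this]

theorem aForm_one_left {A : Euc d → Matrix (Fin d) (Fin d) ℝ} {ωs : Set (Euc d)}
    (hωs : IsLipschitzDomain ωs) {v : Euc d → ℝ} (hv : InH1 ωs v) : aForm A ωs 1 v = 0 := by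
  have hp : IsH1Pair ωs (1 : Euc d → ℝ) 0 := isH1Pair_const hωs.isBounded 1
  rw [aForm_eq_energy hωs.isOpen hp hv.isH1Pair, energy]
  refine integral_eq_zero_of_ae (Eventually.of_forall fun x => ?_)
  have : cMul (A x) 0 = 0 := by ext i; simp [cMul]
  simp [this]

section Harmonic

variable {A : Euc d → Matrix (Fin d) (Fin d) ℝ} {ω ωs : Set (Euc d)} {α β : ℝ} {χ : Euc d → ℝ}

/-- The energy form on `H_A(ω*)`. -/
def aBilin (hωs : IsLipschitzDomain ωs) (hA : IsCoeff ωs A α β) :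
    LinearMap.BilinForm ℝ (haSpace hωs hA) :=
  LinearMap.mk₂ ℝ (fun u v => aForm A ωs u v)
    (fun u v w => aForm_add_left hωs.isOpen hA u.2.1 v.2.1 w.2.1)
    (fun c u w => aForm_smul_left hωs.isOpen c u.2.1 w.2.1)
    (fun w u v => aForm_add_right hωs.isOpen hA u.2.1 v.2.1 w.2.1)
    (fun c w u => aForm_smul_right hωs.isOpen hA c u.2.1 w.2.1)

/-- The form `a_ω(χ u, χ v)` on `H_A(ω*)`. -/
def bBilin (hω : IsOpen ω) (hωs : IsLipschitzDomain ωs) (hs : ω ⊆ ωs) (hA : IsCoeff ωs A α β)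
    (hχ : IsCutoff ω χ) : LinearMap.BilinForm ℝ (haSpace hωs hA) :=
  have hm : ∀ u : haSpace hωs hA, InH1 ω (χ * (u : Euc d → ℝ)) := fun u =>
    (InHA.mul_cutoff hω hωs hs hχ u.2).1
  LinearMap.mk₂ ℝ (fun u v => aForm A ω (χ * (u : Euc d → ℝ)) (χ * (v : Euc d → ℝ)))
    (fun u v w => by
      rw [Submodule.coe_add, mul_add]
      exact aForm_add_left hω (hA.mono hs) (hm u) (hm v) (hm w))
    (fun c u w => by
      rw [Submodule.coe_smul, mul_smul_comm]
      exact aForm_smul_left hω c (hm u) (hm w))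
    (fun w u v => by
      rw [Submodule.coe_add, mul_add]
      exact aForm_add_right hω (hA.mono hs) (hm u) (hm v) (hm w))
    (fun c w u => by
      rw [Submodule.coe_smul, mul_smul_comm]
      exact aForm_smul_right hω (hA.mono hs) c (hm u) (hm w))

theorem bBilin_apply (hω : IsOpen ω) (hωs : IsLipschitzDomain ωs) (hs : ω ⊆ ωs)
    (hA : IsCoeff ωs A α β) (hχ : IsCutoff ω χ) (u v : haSpace hωs hA) :
    bBilin hω hωs hs hA hχ u v = aForm A ω (χ * (u : Euc d → ℝ)) (χ * (v : Euc d → ℝ)) :=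
  rfl

/-- The functions of `H_A(ω*)` vanishing almost everywhere. -/
def nullSpace (hωs : IsLipschitzDomain ωs) (hA : IsCoeff ωs A α β) :
    Submodule ℝ (haSpace hωs hA) where
  carrier := {u | (u : Euc d → ℝ) =ᵐ[volume.restrict ωs] 0}
  zero_mem' := ae_eq_refl _
  add_mem' := fun {u v} hu hv => by
    have h1 : (u : Euc d → ℝ) =ᵐ[volume.restrict ωs] 0 := hu
    have h2 : (v : Euc d → ℝ) =ᵐ[volume.restrict ωs] 0 := hv
    have := h1.add h2
    rwa [add_zero] at this
  smul_mem' := fun c u hu => by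
    have h1 : (u : Euc d → ℝ) =ᵐ[volume.restrict ωs] 0 := hu
    have := h1.const_smul c
    rwa [smul_zero] at this

theorem mem_nullSpace (hωs : IsLipschitzDomain ωs) (hA : IsCoeff ωs A α β)
    {u : haSpace hωs hA} : u ∈ nullSpace hωs hA ↔ (u : Euc d → ℝ) =ᵐ[volume.restrict ωs] 0 :=
  Iff.rfl

/-- The constant function one. -/
def haOne (hωs : IsLipschitzDomain ωs) (hA : IsCoeff ωs A α β) : haSpace hωs hA :=
  ⟨1, inHA_one hωs⟩

/-- Zero energy on the connected domain makes `u` a constant `c`, and `b u 1 = c * a_ω(χ,χ)` with a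
positive factor. -/
theorem mem_nullSpace_of_forms [Nontrivial (Euc d)] (hω : IsOpen ω) (hωs : IsLipschitzDomain ωs)
    (hs : ω ⊆ ωs) (hA : IsCoeff ωs A α β) (hχ : IsCutoff ω χ) {u : haSpace hωs hA}
    (h0 : aBilin hωs hA u u = 0) (h1 : bBilin hω hωs hs hA hχ u (haOne hωs hA) = 0) :
    u ∈ nullSpace hωs hA := by
  obtain ⟨c, hc⟩ := exists_const_of_aForm_eq_zero hωs hA u.2.1 h0
  have hpos := hχ.aForm_pos hω (hωs.isBounded.subset hs) (hA.mono hs)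
  rw [bBilin_apply] at h1
  have hχ1 : χ * ((haOne hωs hA : haSpace hωs hA) : Euc d → ℝ) = χ := mul_one χ
  have hχH : InH1 ω χ := by
    have := (InHA.mul_cutoff hω hωs hs hχ (haOne hωs hA).2).1
    rwa [hχ1] at this
  have he : χ * (u : Euc d → ℝ) =ᵐ[volume.restrict ω] c • χ := by
    filter_upwards [ae_restrict_of_ae_restrict_of_subset hs hc] with x hx
    simp [hx, mul_comm]
  rw [hχ1, aForm_congr hω (InHA.mul_cutoff hω hωs hs hχ u.2).1 hχH he (ae_eq_refl _),
    aForm_smul_left hω c hχH hχH] at h1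
  have hc0 : c = 0 := (mul_eq_zero.1 h1).resolve_right hpos.ne'
  rw [mem_nullSpace]
  filter_upwards [hc] with x hx
  rw [hx, hc0]; rfl

/-- Rellich's theorem gives strong L² convergence, which Caccioppoli's inequality upgrades to
convergence of `χ u` in energy. The L² bound is a separate hypothesis so that the lemma can serve in
proving Poincaré's inequality. -/
theorem exists_subseq_harmonic (hω : IsOpen ω) (hωs : IsLipschitzDomain ωs)
    (hs : ω ⊆ ωs) (hA : IsCoeff ωs A α β) (hχ : IsCutoff ω χ) (u : ℕ → haSpace hωs hA)
    {C : ℝ≥0∞} (hC : C ≠ ⊤) (huC : ∀ k, sqInt ωs (u k : Euc d → ℝ) ≤ C)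
    (hua : ∀ k, aBilin hωs hA (u k) (u k) ≤ 1) :
    ∃ s : ℕ → ℕ, StrictMono s ∧ ∃ u₀ : haSpace hωs hA,
      (∀ v, Tendsto (fun k => aBilin hωs hA (u (s k)) v) atTop (𝓝 (aBilin hωs hA u₀ v))) ∧
      Tendsto (fun k => bBilin hω hωs hs hA hχ (u (s k) - u₀) (u (s k) - u₀)) atTop (𝓝 0) ∧
      Tendsto (fun k => sqInt ωs ((u (s k) : Euc d → ℝ) - (u₀ : Euc d → ℝ))) atTop (𝓝 0) := by
  have hp := fun k => (u k).2.1.isH1Pair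
  have hG : ∀ k, sqInt ωs (weakGrad ωs (u k)) ≤ ENNReal.ofReal α⁻¹ := fun k => by
    have h1 := (aForm_self_bounds hωs.isOpen hA (hp k)).1.trans (hua k)
    rw [← ENNReal.ofReal_toReal (sqInt_lt_top (hp k).2.1).ne]
    refine ENNReal.ofReal_le_ofReal ?_
    rwa [← one_div, le_div_iff₀ hA.pos, mul_comm]
  obtain ⟨s, hsm, w, G, hw, hlim, hlimG⟩ := exists_subseq_rellich hωs hp
    (C := max C (ENNReal.ofReal α⁻¹)) (max_lt hC.lt_top ENNReal.ofReal_lt_top).ne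
    (fun k => (huC k).trans (le_max_left _ _)) (fun k => (hG k).trans (le_max_right _ _))
  have hweak : ∀ v, InH1 ωs v →
      Tendsto (fun k => aForm A ωs (u (s k)) v) atTop (𝓝 (aForm A ωs w v)) := fun v hv => by
    have hm := hA.memLp_cMul hv.isH1Pair.2.1
    have e : ∀ {u : Euc d → ℝ} {G : Euc d → Euc d}, IsH1Pair ωs u G →
        ∫ x in ωs, inner ℝ (G x) (cMul (A x) (weakGrad ωs v x)) = aForm A ωs u v :=
      fun {u G} hu => by
        rw [aForm_eq_energy hωs.isOpen hu hv.isH1Pair, energy_comm hA]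
        exact integral_congr_ae (Eventually.of_forall fun x => real_inner_comm _ _)
    have := hlimG _ hm
    rw [e hw] at this
    exact this.congr fun k => e (hp (s k))
  -- Harmonicity is a family of linear equations and passes to the weak limit.
  have hwA : InHA A ωs w := ⟨hw.inH1, fun φ hφ => tendsto_nhds_unique (hweak φ hφ.1)
    (tendsto_const_nhds.congr fun k => ((u (s k)).2.2 φ hφ).symm)⟩
  refine ⟨s, hsm, ⟨w, hwA⟩, fun v => hweak v v.2.1, ?_, hlim⟩
  obtain ⟨K, hK⟩ := hχ.grad_bdd
  have hbd : ∀ k, bBilin hω hωs hs hA hχ (u (s k) - ⟨w, hwA⟩) (u (s k) - ⟨w, hwA⟩)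
      ≤ β * K ^ 2 * (sqInt ωs ((u (s k) : Euc d → ℝ) - w)).toReal := fun k => by
    have h1 := InHA.caccioppoli hω hωs hs hA hχ hK (u (s k) - ⟨w, hwA⟩).2
    refine h1.trans (mul_le_mul_of_nonneg_left ?_
      (mul_nonneg (hA.pos.trans hA.lt).le (sq_nonneg _)))
    exact ENNReal.toReal_mono (sqInt_lt_top ((hp (s k)).1.sub hw.1)).ne (sqInt_mono_set hs _)
  have hlim' : Tendsto (fun k => β * K ^ 2 * (sqInt ωs ((u (s k) : Euc d → ℝ) - w)).toReal)
      atTop (𝓝 0) := by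
    have := ((ENNReal.tendsto_toReal ENNReal.zero_ne_top).comp hlim).const_mul (β * K ^ 2)
    simpa using this
  exact squeeze_zero (fun k => aForm_self_nonneg hω (hA.mono hs)
    (InHA.mul_cutoff hω hωs hs hχ (u (s k) - ⟨w, hwA⟩).2).1) hbd hlim'

/-! ### Poincaré's inequality and relative compactness of the two forms. -/

theorem sqInt_const_smul {E : Type*} [NormedAddCommGroup E] [NormedSpace ℝ E] (ω : Set (Euc d))
    (c : ℝ) (u : Euc d → E) : sqInt ω (c • u) = ENNReal.ofReal (c ^ 2) * sqInt ω u := by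
  simp only [sqInt]
  rw [← lintegral_const_mul' _ _ ENNReal.ofReal_ne_top]
  refine lintegral_congr fun x => ?_
  rw [Pi.smul_apply, enorm_smul, mul_pow, ← ofReal_norm, ← ENNReal.ofReal_pow (norm_nonneg _),
    Real.norm_eq_abs, sq_abs]

/-- Poincaré's inequality for `A`-harmonic functions with vanishing weighted mean. -/
theorem exists_sqInt_bound [Nontrivial (Euc d)] (hω : IsOpen ω) (hωs : IsLipschitzDomain ωs)
    (hs : ω ⊆ ωs) (hA : IsCoeff ωs A α β) (hχ : IsCutoff ω χ) :
    ∃ C : ℝ≥0∞, C ≠ ⊤ ∧ ∀ u : haSpace hωs hA, bBilin hω hωs hs hA hχ u (haOne hωs hA) = 0 →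
      aBilin hωs hA u u ≤ 1 → sqInt ωs (u : Euc d → ℝ) ≤ C := by
  by_contra! hcon
  choose u hu1 hu2 hu3 using fun k : ℕ => hcon ((k : ℝ≥0∞) + 1) (by simp)
  have hfin : ∀ k, sqInt ωs (u k : Euc d → ℝ) ≠ ⊤ := fun k => (sqInt_lt_top (u k).2.1.1).ne
  set m : ℕ → ℝ := fun k => (sqInt ωs (u k : Euc d → ℝ)).toReal with hm
  have hmk : ∀ k : ℕ, (k : ℝ) + 1 < m k := fun k => by
    have := (ENNReal.toReal_lt_toReal (by simp) (hfin k)).2 (hu3 k)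
    rwa [ENNReal.toReal_add (by simp) (by simp), ENNReal.toReal_natCast, ENNReal.toReal_one] at this
  have hm0 : ∀ k, 0 < m k := fun k => lt_trans (by positivity) (hmk k)
  -- Normalized in L², the counterexamples have energy tending to zero. Their limit has zero energy
  -- and zero weighted mean, so it is null, although the L² norms equal 1.
  set v : ℕ → haSpace hωs hA := fun k => (√(m k))⁻¹ • u k with hv
  have hsq : ∀ k, (√(m k))⁻¹ ^ 2 = (m k)⁻¹ := fun k => by rw [inv_pow, Real.sq_sqrt (hm0 k).le]
  have hv1 : ∀ k, sqInt ωs (v k : Euc d → ℝ) = 1 := fun k => by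
    have : (v k : Euc d → ℝ) = (√(m k))⁻¹ • (u k : Euc d → ℝ) := rfl
    rw [this, sqInt_const_smul, hsq, ← ENNReal.ofReal_toReal (hfin k),
      ← ENNReal.ofReal_mul (inv_nonneg.2 (hm0 k).le), inv_mul_cancel₀ (hm0 k).ne',
      ENNReal.ofReal_one]
  have hva : ∀ k : ℕ, aBilin hωs hA (v k) (v k) ≤ 1 / ((k : ℝ) + 1) := fun k => by
    simp only [hv, map_smul, LinearMap.smul_apply, smul_eq_mul]
    rw [← mul_assoc, ← sq, hsq]
    calc (m k)⁻¹ * aBilin hωs hA (u k) (u k) ≤ (m k)⁻¹ * 1 :=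
          mul_le_mul_of_nonneg_left (hu2 k) (inv_nonneg.2 (hm0 k).le)
      _ ≤ 1 / ((k : ℝ) + 1) := by
          rw [mul_one, one_div]
          exact inv_anti₀ (by positivity) (hmk k).le
  have hvb : ∀ k, bBilin hω hωs hs hA hχ (v k) (haOne hωs hA) = 0 := fun k => by
    simp only [hv, map_smul, LinearMap.smul_apply, hu1, smul_zero]
  obtain ⟨s, hsm, v₀, l1, l2, l3⟩ := exists_subseq_harmonic hω hωs hs hA hχ v
    (C := 1) (by simp) (fun k => (hv1 k).le) (fun k => (hva k).trans (by
      rw [div_le_one (by positivity)]; simp))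
  have hasymm : ∀ u v, aBilin hωs hA u v = aBilin hωs hA v u := fun u v =>
    aForm_comm hωs.isOpen hA u.2.1 v.2.1
  have hann : ∀ u, 0 ≤ aBilin hωs hA u u := fun u => aForm_self_nonneg hωs.isOpen hA u.2.1
  have hbsymm : ∀ u v, bBilin hω hωs hs hA hχ u v = bBilin hω hωs hs hA hχ v u := fun u v =>
    aForm_comm hω (hA.mono hs) (InHA.mul_cutoff hω hωs hs hχ u.2).1
      (InHA.mul_cutoff hω hωs hs hχ v.2).1
  have hbnn : ∀ u, 0 ≤ bBilin hω hωs hs hA hχ u u := fun u =>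
    aForm_self_nonneg hω (hA.mono hs) (InHA.mul_cutoff hω hωs hs hχ u.2).1
  have h0 : aBilin hωs hA v₀ v₀ = 0 := by
    have t1 : Tendsto (fun k => aBilin hωs hA (v (s k)) v₀ ^ 2) atTop (𝓝 0) := by
      have t2 : Tendsto (fun k => 1 / ((s k : ℝ) + 1) * aBilin hωs hA v₀ v₀) atTop (𝓝 0) := by
        have := (tendsto_one_div_add_atTop_nhds_zero_nat (𝕜 := ℝ)).comp hsm.tendsto_atTop
        have := this.mul_const (aBilin hωs hA v₀ v₀)
        rwa [zero_mul] at this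
      exact squeeze_zero (fun k => sq_nonneg _) (fun k => (bilin_sq_le hasymm hann _ _).trans
        (mul_le_mul_of_nonneg_right (hva _) (hann _))) t2
    have := tendsto_nhds_unique ((l1 v₀).pow 2) t1
    exact pow_eq_zero_iff two_ne_zero |>.1 this
  have h1 : bBilin hω hωs hs hA hχ v₀ (haOne hωs hA) = 0 := by
    have t2 : Tendsto (fun k => bBilin hω hωs hs hA hχ (v (s k) - v₀) (v (s k) - v₀)
        * bBilin hω hωs hs hA hχ (haOne hωs hA) (haOne hωs hA)) atTop (𝓝 0) := by
      have := l2.mul_const (bBilin hω hωs hs hA hχ (haOne hωs hA) (haOne hωs hA))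
      rwa [zero_mul] at this
    have h2 : ∀ k, bBilin hω hωs hs hA hχ v₀ (haOne hωs hA) ^ 2
        ≤ bBilin hω hωs hs hA hχ (v (s k) - v₀) (v (s k) - v₀)
        * bBilin hω hωs hs hA hχ (haOne hωs hA) (haOne hωs hA) := fun k => by
      have := bilin_sq_le hbsymm hbnn (v (s k) - v₀) (haOne hωs hA)
      simpa only [map_sub, LinearMap.sub_apply, hvb, zero_sub, neg_sq] using this
    have := ge_of_tendsto t2 (Eventually.of_forall h2)
    exact pow_eq_zero_iff two_ne_zero |>.1 (le_antisymm this (sq_nonneg _))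
  have h2 := (mem_nullSpace hωs hA).1 (mem_nullSpace_of_forms hω hωs hs hA hχ h0 h1)
  have h3 : ∀ k, sqInt ωs ((v (s k) : Euc d → ℝ) - (v₀ : Euc d → ℝ)) = 1 := fun k => by
    rw [← hv1 (s k)]
    refine sqInt_congr ?_
    filter_upwards [h2] with x hx
    simp [hx]
  simp_rw [h3] at l3
  exact one_ne_zero (tendsto_nhds_unique tendsto_const_nhds l3)

theorem isCompactPair [Nontrivial (Euc d)] (hω : IsOpen ω) (hωs : IsLipschitzDomain ωs)
    (hs : ω ⊆ ωs) (hA : IsCoeff ωs A α β) (hχ : IsCutoff ω χ) :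
    IsCompactPair (aBilin hωs hA) (bBilin hω hωs hs hA hχ) (haOne hωs hA) (nullSpace hωs hA) where
  a_symm u v := aForm_comm hωs.isOpen hA u.2.1 v.2.1
  b_symm u v := aForm_comm hω (hA.mono hs) (InHA.mul_cutoff hω hωs hs hχ u.2).1
      (InHA.mul_cutoff hω hωs hs hχ v.2).1
  a_nonneg u := aForm_self_nonneg hωs.isOpen hA u.2.1
  b_nonneg u := aForm_self_nonneg hω (hA.mono hs) (InHA.mul_cutoff hω hωs hs hχ u.2).1
  a_one v := aForm_one_left hωs v.2.1
  b_one := by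
    have := hχ.aForm_pos hω (hωs.isBounded.subset hs) (hA.mono hs)
    have hχ1 : χ * ((haOne hωs hA : haSpace hωs hA) : Euc d → ℝ) = χ := mul_one χ
    rwa [bBilin_apply, hχ1]
  b_null u hu v := by
    have he : χ * (u : Euc d → ℝ) =ᵐ[volume.restrict ω]
        χ * ((0 : haSpace hωs hA) : Euc d → ℝ) := by
      filter_upwards [ae_restrict_of_ae_restrict_of_subset hs ((mem_nullSpace hωs hA).1 hu)] with x hx
      simp [hx]
    have : bBilin hω hωs hs hA hχ u v = bBilin hω hωs hs hA hχ 0 v :=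
      aForm_congr hω (InHA.mul_cutoff hω hωs hs hχ u.2).1
        (InHA.mul_cutoff hω hωs hs hχ v.2).1 he (ae_eq_refl _)
    rw [this, map_zero, LinearMap.zero_apply]
  ker u h0 h1 := mem_nullSpace_of_forms hω hωs hs hA hχ h0 h1
  compact u hu hua := by
    obtain ⟨C, hC, hbd⟩ := exists_sqInt_bound hω hωs hs hA hχ
    obtain ⟨s, hsm, u₀, l1, l2, -⟩ := exists_subseq_harmonic hω hωs hs hA hχ u hC
      (fun k => hbd _ (hu k) (hua k)) hua
    exact ⟨s, hsm, u₀, l1, l2⟩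

end Harmonic

/-! ### The local problem -/

theorem aForm_sub_left {A : Euc d → Matrix (Fin d) (Fin d) ℝ} {ω : Set (Euc d)} {α β : ℝ}
    (hω : IsOpen ω) (hA : IsCoeff ω A α β) {u v w : Euc d → ℝ}
    (hu : InH1 ω u) (hv : InH1 ω v) (hw : InH1 ω w) :
    aForm A ω (u - v) w = aForm A ω u w - aForm A ω v w := by
  have h := aForm_add_left hω hA (hu.sub hv) hv hw
  rw [sub_add_cancel] at h
  linarith

/-- The approximating test functions vanish on the frontier, which is disjoint from the open set. -/
theorem InH10.isTrace_zero {Ω : Set (Euc d)} (hΩ : IsOpen Ω) {v : Euc d → ℝ}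
    (hv : InH10 Ω v) : IsTrace Ω v 0 := by
  choose w hw hlt using fun k : ℕ => hv.2 (1 / ((k : ℝ) + 1)) (by positivity)
  refine ⟨hv.1, MemLp.zero, w, fun k => (hw k).1, ?_, ?_⟩
  · exact squeeze_zero (fun k => Real.sqrt_nonneg _) (fun k => (hlt k).le)
      tendsto_one_div_add_atTop_nhds_zero_nat
  · refine tendsto_const_nhds.congr fun k => ?_
    have : (0 - w k : Euc d → ℝ) =ᵐ[surf Ω] 0 := by
      filter_upwards [ae_restrict_mem isClosed_frontier.measurableSet] with x hx
      have hxΩ : x ∉ Ω := by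
        rw [hΩ.frontier_eq] at hx
        exact hx.2
      have hz : w k x = 0 := image_eq_zero_of_notMem_tsupport fun h => hxΩ ((hw k).2.2 h)
      simp [hz]
    rw [eLpNorm_congr_ae this, eLpNorm_zero]

theorem InH10.hasTraceOn_zero {Ω : Set (Euc d)} (hΩ : IsOpen Ω) {v : Euc d → ℝ}
    (hv : InH10 Ω v) (Γ : Set (Euc d)) : HasTraceOn Ω Γ v 0 :=
  ⟨0, hv.isTrace_zero hΩ, ae_eq_refl _⟩

/-- Extension by zero of `φ` is admissible in the global problem and has trace 0, so the boundary
term is `g 0 = 0`. -/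
theorem IsWeakSolution.aForm_local {A : Euc d → Matrix (Fin d) (Fin d) ℝ}
    {Ω ΓD ΓN ωs : Set (Euc d)} {f : Euc d → ℝ} {g : (Euc d → ℝ) →ₗ[ℝ] ℝ} {q u₀ : Euc d → ℝ}
    (hΩ : IsLipschitzDomain Ω) (hωs : IsLipschitzDomain ωs) (hs : ωs ⊆ Ω)
    (hu₀ : IsWeakSolution A Ω ΓD ΓN f g q u₀) {φ : Euc d → ℝ} (hφ : InH10 ωs φ) :
    aForm A ωs u₀ φ = ∫ x in ωs, f x * φ x := by
  have hp := hφ.1.isH1Pair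
  obtain ⟨hpe, h0⟩ := hφ.extend hωs.isOpen hωs.isBounded hΩ.isOpen hΩ.isBounded hs hp
  have h1 := hu₀.2.2 _ ⟨hpe.inH1, h0.hasTraceOn_zero hΩ.isOpen ΓD⟩ 0
    (h0.hasTraceOn_zero hΩ.isOpen ΓN)
  have hu := hu₀.1.isH1Pair
  rw [aForm_eq_energy hΩ.isOpen hu hpe, energy_indicator_right hωs.isOpen.measurableSet hs,
    ← aForm_eq_energy hωs.isOpen (hu.mono hΩ.isOpen hs) hp, map_zero, zero_add] at h1
  rw [h1]
  have : ∀ x, f x * ωs.indicator φ x = ωs.indicator (fun x => f x * φ x) x := fun x => by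
    by_cases hx : x ∈ ωs <;> simp [hx]
  simp_rw [this]
  rw [setIntegral_indicator hωs.isOpen.measurableSet, inter_eq_right.2 hs]

theorem inHA_sub {A : Euc d → Matrix (Fin d) (Fin d) ℝ} {ωs : Set (Euc d)} {α β : ℝ}
    (hωs : IsLipschitzDomain ωs) (hA : IsCoeff ωs A α β) {f u₀ ψ : Euc d → ℝ}
    (hu₀ : InH1 ωs u₀) (hloc : ∀ φ, InH10 ωs φ → aForm A ωs u₀ φ = ∫ x in ωs, f x * φ x)
    (hψ : IsDirichletSolution A ωs f ψ) : InHA A ωs (u₀ - ψ) :=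
  ⟨hu₀.sub hψ.1.1, fun φ hφ => by
    rw [aForm_sub_left hωs.isOpen hA hu₀ hψ.1.1 hφ.1, hloc φ hφ, hψ.2 φ hφ, sub_self]⟩

/-- Pythagoras: an `A`-harmonic function is `a`-orthogonal to `H¹₀(ω*)`. -/
theorem InHA.aForm_le_add {A : Euc d → Matrix (Fin d) (Fin d) ℝ} {ωs : Set (Euc d)} {α β : ℝ}
    (hωs : IsLipschitzDomain ωs) (hA : IsCoeff ωs A α β) {u ψ : Euc d → ℝ}
    (hu : InHA A ωs u) (hψ : InH10 ωs ψ) :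
    aForm A ωs u u ≤ aForm A ωs (u + ψ) (u + ψ) := by
  rw [aForm_add_left hωs.isOpen hA hu.1 hψ.1 (hu.1.add hψ.1),
    aForm_add_right hωs.isOpen hA hu.1 hψ.1 hu.1, aForm_add_right hωs.isOpen hA hu.1 hψ.1 hψ.1,
    aForm_comm hωs.isOpen hA hψ.1 hu.1, hu.2 ψ hψ]
  linarith [aForm_self_nonneg hωs.isOpen hA hψ.1]

/-! ### The `n`-width -/

section Width

variable {A : Euc d → Matrix (Fin d) (Fin d) ℝ} {ω ωs : Set (Euc d)} {α β : ℝ} {χ : Euc d → ℝ}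

theorem coe_comb {hωs : IsLipschitzDomain ωs} {hA : IsCoeff ωs A α β} {n : ℕ}
    (v : Fin n → haSpace hωs hA) (c : Fin n → ℝ) :
    ((∑ k, c k • v k : haSpace hωs hA) : Euc d → ℝ) = ∑ k, c k • (v k : Euc d → ℝ) := by
  simp

theorem IsFirstEigenpairs.firstEigen (hω : IsOpen ω) (hωs : IsLipschitzDomain ωs)
    (hs : ω ⊆ ωs) (hA : IsCoeff ωs A α β) (hχ : IsCutoff ω χ) {n : ℕ} {lam : Fin n → ℝ}
    {v : Fin n → Euc d → ℝ} (hv : IsFirstEigenpairs A χ ω ωs lam v) :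
    IsCompactPair.FirstEigen (aBilin hωs hA) (bBilin hω hωs hs hA hχ) (nullSpace hωs hA) lam
      (fun k => (⟨v k, (hv.eigen k).1⟩ : haSpace hωs hA)) where
  eigen k φ := (hv.eigen k).2.2 φ φ.2
  indep c hc := by
    rw [mem_nullSpace, coe_comb] at hc
    exact hv.indep c hc
  mono := hv.mono
  first μ w hw hN hk := by
    obtain ⟨φ, hφ, he⟩ := hv.first μ w ⟨w.2, hN, fun φ hφ => hw ⟨φ, hφ⟩⟩ hk
    obtain ⟨c, rfl⟩ := (Submodule.mem_span_range_iff_exists_fun ℝ).1 hφ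
    refine ⟨c, ?_⟩
    rw [mem_nullSpace, Submodule.coe_sub, coe_comb]
    filter_upwards [he] with x hx
    simp only [Pi.sub_apply, hx]
    simp

/-- The denominator of the weighted mean is positive, so the mean vanishes exactly when its
numerator `b u 1` does. -/
theorem inHA0_iff [Nontrivial (Euc d)] (hω : IsOpen ω) (hωs : IsLipschitzDomain ωs)
    (hs : ω ⊆ ωs) (hA : IsCoeff ωs A α β) (hχ : IsCutoff ω χ) (u : haSpace hωs hA) :
    InHA0 A χ ω ωs u ↔ bBilin hω hωs hs hA hχ u (haOne hωs hA) = 0 := by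
  have hpos := hχ.aForm_pos hω (hωs.isBounded.subset hs) (hA.mono hs)
  have hχ1 : χ * ((haOne hωs hA : haSpace hωs hA) : Euc d → ℝ) = χ := mul_one χ
  rw [bBilin_apply, hχ1, InHA0, wMean, div_eq_zero_iff, or_iff_left hpos.ne']
  exact and_iff_right u.2

theorem InH1.span {n : ℕ} {b : Fin n → Euc d → ℝ} (hb : ∀ k, InH1 ω (b k))
    {v : Euc d → ℝ} (hv : v ∈ Submodule.span ℝ (range b)) : InH1 ω v := by
  induction hv using Submodule.span_induction with
  | mem x hx => obtain ⟨k, rfl⟩ := hx; exact hb k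
  | zero =>
    refine ⟨MemLp.zero, 0, MemLp.zero, fun φ hφ e => ?_⟩
    simp
  | add x y _ _ hx hy => exact hx.add hy
  | smul c x _ hx => exact hx.smul c

/-- The Poincaré-type inequality bounds the quotient even for approximation by 0. Some
`m`-dimensional subspace of `H¹₀(ω)` must still be exhibited, as the infimum over none would be
infinite; the functions `χ v k` span one. -/
theorem nWidth_lt_top [Nontrivial (Euc d)] (hω : IsOpen ω) (hωs : IsLipschitzDomain ωs)
    (hs : ω ⊆ ωs) (hA : IsCoeff ωs A α β) (hχ : IsCutoff ω χ) {m : ℕ} {lam : Fin (m + 1) → ℝ}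
    {v : Fin (m + 1) → Euc d → ℝ} (hv : IsFirstEigenpairs A χ ω ωs lam v) :
    nWidth A χ ω ωs m < ⊤ := by
  have hcp := isCompactPair hω hωs hs hA hχ
  have hfe := hv.firstEigen hω hωs hs hA hχ
  obtain ⟨C, hC0, hC⟩ := hcp.exists_b_le
  have hin : ∀ k : Fin m, InH10 ω (χ * v k.castSucc) := fun k =>
    InHA.mul_cutoff hω hωs hs hχ (hv.eigen k.castSucc).1
  have hli : LinIndepOn ω (fun k : Fin m => χ * v k.castSucc) := by
    intro c hc
    by_contra hne
    -- Padding with 0 for the last eigenfunction lets the definiteness of `b` on all `m + 1` of them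
    -- give independence of the first `m` products.
    have hne' : (Fin.snoc c 0 : Fin (m + 1) → ℝ) ≠ 0 := fun h0 => hne <| by
      ext k
      have := congrFun h0 k.castSucc
      simpa using this
    refine (hcp.b_self_pos hfe hne').ne' ?_
    rw [bBilin_apply, coe_comb]
    have he : χ * ∑ k, (Fin.snoc c 0 : Fin (m + 1) → ℝ) k • v k
        =ᵐ[volume.restrict ω] (0 : ℝ) • (χ * v (Fin.last m)) := by
      filter_upwards [hc] with x hx
      rw [zero_smul, ← hx, Fin.sum_univ_castSucc]
      simp [Finset.mul_sum, mul_left_comm]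
    have hin' : InH1 ω (χ * ∑ k, (Fin.snoc c 0 : Fin (m + 1) → ℝ) k • v k) := by
      have := (InHA.mul_cutoff hω hωs hs hχ (∑ k, (Fin.snoc c 0 : Fin (m + 1) → ℝ) k •
        (⟨v k, (hv.eigen k).1⟩ : haSpace hωs hA)).2).1
      rwa [coe_comb] at this
    have hl : InH1 ω (χ * v (Fin.last m)) :=
      (InHA.mul_cutoff hω hωs hs hχ (hv.eigen (Fin.last m)).1).1
    rw [aForm_congr hω hin' hin' he he, aForm_smul_left hω 0 hl (hl.smul 0), zero_mul]
  have hle : nWidth A χ ω ωs m ≤ ENNReal.ofReal √C := by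
    refine iInf_le_of_le _ (iInf_le_of_le hin (iInf_le_of_le hli ?_))
    refine iSup_le fun u => iSup_le fun hu => ?_
    refine iInf_le_of_le 0 (iInf_le_of_le (Submodule.zero_mem _) ?_)
    rw [sub_zero]
    refine ENNReal.div_le_of_le_mul ?_
    rw [← ENNReal.ofReal_mul (Real.sqrt_nonneg _)]
    refine ENNReal.ofReal_le_ofReal ?_
    rw [aNorm, aNorm, ← Real.sqrt_mul hC0]
    exact Real.sqrt_le_sqrt (hC ⟨u, hu.1⟩ ((inHA0_iff hω hωs hs hA hχ ⟨u, hu.1⟩).1 hu))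
  exact hle.trans_lt ENNReal.ofReal_lt_top

/-- For each competing subspace, the test vector from the dimension count has zero weighted mean, is
orthogonal to the subspace after multiplication by `χ`, and has a Rayleigh quotient at least that of
`w`. -/
theorem div_sqrt_le_nWidth [Nontrivial (Euc d)] (hω : IsOpen ω) (hωs : IsLipschitzDomain ωs)
    (hs : ω ⊆ ωs) (hA : IsCoeff ωs A α β) (hχ : IsCutoff ω χ) {n : ℕ} (hn : 1 ≤ n)
    {lam : Fin n → ℝ} {v : Fin n → Euc d → ℝ} (hv : IsFirstEigenpairs A χ ω ωs lam v)
    {w : haSpace hωs hA}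
    (hw : ∀ k, bBilin hω hωs hs hA hχ w ⟨v k, (hv.eigen k).1⟩ = 0)
    (haw : 0 < aBilin hωs hA w w) :
    ENNReal.ofReal √(bBilin hω hωs hs hA hχ w w) / ENNReal.ofReal √(aBilin hωs hA w w)
      ≤ nWidth A χ ω ωs (n - 1) := by
  have hcp := isCompactPair hω hωs hs hA hχ
  have hfe := hv.firstEigen hω hωs hs hA hχ
  have hAω := hA.mono hs
  refine le_iInf fun b => le_iInf fun hb => le_iInf fun _ => ?_
  have hm : ∀ u : haSpace hωs hA, InH1 ω (χ * (u : Euc d → ℝ)) := fun u =>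
    (InHA.mul_cutoff hω hωs hs hχ u.2).1
  let L : haSpace hωs hA →ₗ[ℝ] (Fin (n - 1) → ℝ) :=
    { toFun := fun u i => aForm A ω (χ * (u : Euc d → ℝ)) (b i)
      map_add' := fun u u' => by
        ext i
        rw [Submodule.coe_add, mul_add]
        exact aForm_add_left hω hAω (hm u) (hm u') (hb i).1
      map_smul' := fun t u => by
        ext i
        rw [Submodule.coe_smul, mul_smul_comm]
        exact aForm_smul_left hω t (hm u) (hb i).1 }
  obtain ⟨u, hue, hLu, hau, hle⟩ := hcp.exists_test_vector hfe hn L hw haw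
  refine le_iSup_of_le (u : Euc d → ℝ)
    (le_iSup_of_le ((inHA0_iff hω hωs hs hA hχ u).2 hue) ?_)
  refine le_iInf fun z => le_iInf fun hz => ?_
  have hzH : InH1 ω z := InH1.span (fun k => (hb k).1) hz
  have horth : aForm A ω (χ * (u : Euc d → ℝ)) z = 0 := by
    have : ∀ z, z ∈ Submodule.span ℝ (range b) →
        InH1 ω z ∧ aForm A ω (χ * (u : Euc d → ℝ)) z = 0 := fun z hz => by
      refine ⟨InH1.span (fun k => (hb k).1) hz, ?_⟩
      obtain ⟨c, rfl⟩ := (Submodule.mem_span_range_iff_exists_fun ℝ).1 hz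
      have hsum : ∀ s : Finset (Fin (n - 1)), InH1 ω (∑ i ∈ s, c i • b i) ∧
          aForm A ω (χ * (u : Euc d → ℝ)) (∑ i ∈ s, c i • b i) = 0 := fun s => by
        induction s using Finset.cons_induction with
        | empty =>
          have h0 : InH1 ω (0 : Euc d → ℝ) := InH1.span (fun k => (hb k).1) (Submodule.zero_mem _)
          refine ⟨h0, ?_⟩
          have := aForm_smul_right hω hAω 0 h0 (hm u)
          simpa using this
        | cons i s his ih =>
          rw [Finset.sum_cons]
          refine ⟨((hb i).1.smul _).add ih.1, ?_⟩
          rw [aForm_add_right hω hAω ((hb i).1.smul _) ih.1 (hm u), ih.2,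
            aForm_smul_right hω hAω _ (hb i).1 (hm u)]
          have : aForm A ω (χ * (u : Euc d → ℝ)) (b i) = 0 := congrFun hLu i
          rw [this]; ring
      exact (hsum Finset.univ).2
    exact (this z hz).2
  -- Pythagoras: `χ u` is orthogonal to `z`, so subtracting `z` cannot reduce its energy.
  have hge : aForm A ω (χ * (u : Euc d → ℝ)) (χ * (u : Euc d → ℝ))
      ≤ aForm A ω (χ * (u : Euc d → ℝ) - z) (χ * (u : Euc d → ℝ) - z) := by
    have h1 := aForm_sub_left hω hAω (hm u) hzH ((hm u).sub hzH)
    rw [aForm_comm hω hAω (hm u) ((hm u).sub hzH), aForm_comm hω hAω hzH ((hm u).sub hzH),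
      aForm_sub_left hω hAω (hm u) hzH (hm u), aForm_sub_left hω hAω (hm u) hzH hzH,
      aForm_comm hω hAω hzH (hm u), horth] at h1
    rw [h1]
    linarith [aForm_self_nonneg hω hAω hzH]
  have hsw := Real.sqrt_pos.2 haw
  have hsu : 0 < √(aForm A ωs u u) := Real.sqrt_pos.2 hau
  rw [aNorm, aNorm, ← ENNReal.ofReal_div_of_pos hsw, ← ENNReal.ofReal_div_of_pos hsu]
  refine ENNReal.ofReal_le_ofReal ?_
  rw [div_le_div_iff₀ hsw hsu, ← Real.sqrt_mul (hcp.b_nonneg w),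
    ← Real.sqrt_mul (aForm_self_nonneg hω hAω ((hm u).sub hzH))]
  refine Real.sqrt_le_sqrt (hle.trans ?_)
  exact mul_le_mul_of_nonneg_right hge haw.le

/-- The multiplied form also covers `a w w = 0`: then `w` is null, since orthogonality to the `v k`
includes orthogonality to constants. -/
theorem sqrt_b_le_nWidth_mul [Nontrivial (Euc d)] (hω : IsOpen ω) (hωs : IsLipschitzDomain ωs)
    (hs : ω ⊆ ωs) (hA : IsCoeff ωs A α β) (hχ : IsCutoff ω χ) {n : ℕ} (hn : 1 ≤ n)
    {lam : Fin n → ℝ} {v : Fin n → Euc d → ℝ} (hv : IsFirstEigenpairs A χ ω ωs lam v)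
    {w : haSpace hωs hA}
    (hw : ∀ k, bBilin hω hωs hs hA hχ w ⟨v k, (hv.eigen k).1⟩ = 0) :
    ENNReal.ofReal √(bBilin hω hωs hs hA hχ w w)
      ≤ nWidth A χ ω ωs (n - 1) * ENNReal.ofReal √(aBilin hωs hA w w) := by
  have hcp := isCompactPair hω hωs hs hA hχ
  have hfe := hv.firstEigen hω hωs hs hA hχ
  rcases (hcp.a_nonneg w).eq_or_lt with h0 | h0
  · have h1 := hcp.ker w h0.symm (hcp.b_one_eq_zero hfe hn hw)
    rw [hcp.b_null w h1]
    simp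
  · refine (ENNReal.div_le_iff_le_mul (Or.inl ?_) (Or.inl ENNReal.ofReal_ne_top)).1
      (div_sqrt_le_nWidth hω hωs hs hA hχ hn hv hw h0)
    exact (ENNReal.ofReal_pos.2 (Real.sqrt_pos.2 h0)).ne'

end Width

end MSGFEM

end

/-! ### The approximation theorem. -/

open MSGFEM in
theorem theorem3p3 {d : ℕ} (hd : d = 2 ∨ d = 3)
    (Ω ΓD ΓN : Set (Euc d)) (hΩ : IsLipschitzDomain Ω)
    (hΓ : ΓD ∩ ΓN = ∅) (hΓ' : closure ΓD ∪ closure ΓN = frontier Ω)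
    (A : Euc d → Matrix (Fin d) (Fin d) ℝ) (α β : ℝ) (hA : IsCoeff Ω A α β)
    (f : Euc d → ℝ) (hf : MemLp f 2 (volume.restrict Ω))
    (g : (Euc d → ℝ) →ₗ[ℝ] ℝ) (hg : InHMinusHalf Ω ΓD ΓN g)
    (q u₀ : Euc d → ℝ) (hu₀ : IsWeakSolution A Ω ΓD ΓN f g q u₀)
    (ω ωs : Set (Euc d)) (hω : IsOpen ω) (hωs : IsLipschitzDomain ωs)
    (hωωs : ω ⊆ ωs) (hωsΩ : ωs ⊆ Ω)
    (χ : Euc d → ℝ) (hχ : IsCutoff ω χ)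
    (ψ : Euc d → ℝ) (hψ : IsDirichletSolution A ωs f ψ)
    (n : ℕ) (hn : 1 ≤ n) (lam : Fin n → ℝ) (v : Fin n → Euc d → ℝ)
    (hv : IsFirstEigenpairs A χ ω ωs lam v) :
    (∀ c : ℝ, ∃ φ ∈ Submodule.span ℝ (range v), φ =ᵐ[volume.restrict ω] fun _ => c) ∧
    nWidth A χ ω ωs (n - 1) < ⊤ ∧
    ∃ φ ∈ Submodule.span ℝ (range v),
      ENNReal.ofReal (aNorm A ω (χ * (u₀ - ψ - φ))) ≤
        nWidth A χ ω ωs (n - 1) * ENNReal.ofReal (aNorm A ωs u₀) := by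
  -- This makes the space nontrivial, so that a cutoff vanishing off a bounded set has positive
  -- energy.
  have : NeZero d := ⟨by omega⟩
  have hAs := hA.mono hωsΩ
  have hcp := isCompactPair hω hωs hωωs hAs hχ
  have hfe := hv.firstEigen hω hωs hωωs hAs hχ
  refine ⟨fun c => ?_, ?_, ?_⟩
  · obtain ⟨t, ht⟩ := hcp.exists_comb_one hfe hn
    rw [mem_nullSpace, Submodule.coe_sub, coe_comb] at ht
    refine ⟨c • ∑ k, t k • v k, Submodule.smul_mem _ _ (Submodule.sum_mem _ fun k _ =>
      Submodule.smul_mem _ _ (Submodule.subset_span ⟨k, rfl⟩)), ?_⟩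
    filter_upwards [ae_restrict_of_ae_restrict_of_subset hωωs ht] with x hx
    have h1 : 1 - (∑ k, t k • v k) x = 0 := hx
    rw [Pi.smul_apply, ← sub_eq_zero.1 h1, smul_eq_mul, mul_one]
  · obtain ⟨m, rfl⟩ : ∃ m, n = m + 1 := ⟨n - 1, by omega⟩
    exact nWidth_lt_top hω hωs hωωs hAs hχ hv
  · have hu₀H : InH1 ωs u₀ := (hu₀.1.isH1Pair.mono hΩ.isOpen hωsΩ).inH1
    have hloc : InHA A ωs (u₀ - ψ) := inHA_sub hωs hAs hu₀H
      (fun φ hφ => hu₀.aForm_local hΩ hωs hωsΩ hφ) hψ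
    have hen := InHA.aForm_le_add hωs hAs hloc hψ.1
    rw [sub_add_cancel] at hen
    set u : haSpace hωs hAs := ⟨u₀ - ψ, hloc⟩ with hu
    -- The approximant is the `b`-orthogonal projection of `u₀ - ψ`; its residual satisfies the
    -- orthogonality required by the width estimate.
    obtain ⟨c, hc⟩ := hcp.exists_projection hfe u
    refine ⟨∑ k, c k • v k, Submodule.sum_mem _ fun k _ =>
      Submodule.smul_mem _ _ (Submodule.subset_span ⟨k, rfl⟩), ?_⟩
    set φ : haSpace hωs hAs := ∑ k, c k • ⟨v k, (hv.eigen k).1⟩ with hφ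
    have h1 := sqrt_b_le_nWidth_mul hω hωs hωωs hAs hχ hn hv hc
    have horth : aBilin hωs hAs φ (u - φ) = 0 :=
      IsCompactPair.a_eq_zero_of_b_orthogonal hfe hcp hc c
    -- Two orthogonal decompositions for `a`: `u = (u - φ) + φ` by the eigenvalue equation, and `u₀
    -- = u + ψ` by harmonicity.
    have hle : aBilin hωs hAs (u - φ) (u - φ) ≤ aForm A ωs u₀ u₀ := by
      refine le_trans ?_ hen
      change _ ≤ aBilin hωs hAs u u
      have e1 : aBilin hωs hAs u u
          = aBilin hωs hAs (u - φ) (u - φ) + 2 * aBilin hωs hAs φ (u - φ)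
            + aBilin hωs hAs φ φ := by
        simp only [map_sub, LinearMap.sub_apply, hcp.a_symm u φ]
        ring
      rw [e1, horth]
      linarith [hcp.a_nonneg φ]
    have e2 : (((u - φ : haSpace hωs hAs)) : Euc d → ℝ) = u₀ - ψ - ∑ k, c k • v k := by
      rw [Submodule.coe_sub, hφ, coe_comb]
    have e3 : aNorm A ω (χ * (u₀ - ψ - ∑ k, c k • v k))
        = √(bBilin hω hωs hωωs hAs hχ (u - φ) (u - φ)) := by
      rw [bBilin_apply, e2, aNorm]
    rw [e3]
    exact h1.trans (mul_le_mul' le_rfl (ENNReal.ofReal_le_ofReal (Real.sqrt_le_sqrt hle)))
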